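/- Let $n\ge 3$, read indices modulo $n$, and let $\varphi:\mathbb R^{2n}\to\mathbb R^{2n}$ be the pentagram automaton, which sends $(x_i,y_i)_{i}$ to $$\bigl(x_i+\max(0,x_{i-1}+y_{i-1})-\max(0,x_{i+1}+y_{i+1}),\ \ y_{i+1}+\max(0,x_{i+2}+y_{i+2})-\max(0,x_i+y_i)\bigr)_{i}.$$ Call a pair $(S,J)$ of subsets of $\mathbb Z/n$ admissible if $j\notin\{i-2,i-1,i+1,i+2\}$ for all distinct $i,j\in S$, $j\notin\{i-1,i,i+1,i+2\}$ for all $i\in S$, $j\in J$, and $i+1\notin J$ for all $i\in J$. For $1\le k\le[\frac n2]$ put $$\tilde O_k(x,y)=\max_{(S,J)}\Bigl(\sum_{i\in S}(x_i+y_i+x_{i+1})+\sum_{j\in J}x_j\Bigr),\qquad \tilde E_k(x,y)=\max_{(S,J)}\Bigl(\sum_{i\in S}(y_i+x_{i+1}+y_{i+1})+\sum_{j\in J}y_j\Bigr),$$ both maxima being over all admissible pairs with $|S|+|J|=k$ (these are the max-plus versions of the Ovsienko–Schwartz–Tabachnikov invariants $O_k$, $E_k$). For $q\in\mathbb R^{2n}$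 let $P(q)$ be the set of all points of $\mathbb R^{2n}$ at which the $2[\frac n2]+2$ functions $\sum_i x_i$, $\sum_i y_i$, $\tilde O_k$, $\tilde E_k$ $(1\le k\le[\frac n2])$ take the same values as at $q$. Then for every $q\in\mathbb R^{2n}$ the whole orbit $\{\varphi^l(q):l\ge 0\}$ lies in $P(q)$; and for generic $q$, namely for all $q$ outside a finite union of proper affine subspaces of $\mathbb R^{2n}$ depending only on $n$, the set $P(q)$ is a polytope of dimension $2[\frac{n+1}{2}]-2$, i.e. a nonempty finite union of (compact) convex polytopes all of dimension $2[\frac{n+1}{2}]-2$. -/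

import Mathlib

namespace Pentagram

noncomputable section

/-- The phase space `ℝ^{2n}`: a point is `q = (x, y)` with `x = q.1` and `y = q.2`,
the indices being read modulo `n`. -/
abbrev Phase (n : ℕ) : Type := (ZMod n → ℝ) × (ZMod n → ℝ)

/-- The pentagram automaton. -/
def automaton {n : ℕ} (q : Phase n) : Phase n :=
  (fun i => q.1 i + max 0 (q.1 (i - 1) + q.2 (i - 1)) - max 0 (q.1 (i + 1) + q.2 (i + 1)),
   fun i => q.2 (i + 1) + max 0 (q.1 (i + 2) + q.2 (i + 2)) - max 0 (q.1 i + q.2 i))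

/-- A square-free product of "long" factors (indexed by `long`) and "short" factors (indexed by
`short`). For the invariants `O_k` the long factors are `Z_i = z_i w_i z_{i+1}` and the short ones
are `z_j`; for the invariants `E_k` the long factors are `W_i = w_i z_{i+1} w_{i+1}` and the short
ones are `w_j`. -/
structure Mon (n : ℕ) where
  long : Finset (ZMod n)
  short : Finset (ZMod n)

/-- No two factors are consecutive. Two long factors `i`, `j` are consecutive if
`j ∈ {i-2, i-1, i, i+1, i+2}`, a long factor `i` and a short factor `j` if
`j ∈ {i-1, i, i+1, i+2}`, and the short factors `i`, `i+1` are consecutive. -/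
def Mon.Admissible {n : ℕ} (m : Mon n) : Prop :=
  (∀ i ∈ m.long, ∀ j ∈ m.long, i ≠ j → j ∉ ({i - 2, i - 1, i, i + 1, i + 2} : Set (ZMod n))) ∧
  (∀ i ∈ m.long, ∀ j ∈ m.short, j ∉ ({i - 1, i, i + 1, i + 2} : Set (ZMod n))) ∧
  (∀ i ∈ m.short, i + 1 ∉ m.short)

/-- The number of factors. -/
def Mon.length {n : ℕ} (m : Mon n) : ℕ := m.long.card + m.short.card

/-- The tropicalization of the monomial, read as a monomial of `O`-type. -/
def Mon.valO {n : ℕ} (m : Mon n) (q : Phase n) : ℝ :=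
  ∑ i ∈ m.long, (q.1 i + q.2 i + q.1 (i + 1)) + ∑ j ∈ m.short, q.1 j

/-- The tropicalization of the monomial, read as a monomial of `E`-type. -/
def Mon.valE {n : ℕ} (m : Mon n) (q : Phase n) : ℝ :=
  ∑ i ∈ m.long, (q.2 i + q.1 (i + 1) + q.2 (i + 1)) + ∑ j ∈ m.short, q.2 j

/-- The max-plus version of `O_k`: the maximum over all admissible monomials with `k` factors
(a finite set, nonempty for `k ≤ n / 2`). -/
def tropO {n : ℕ} (k : ℕ) (q : Phase n) : ℝ :=
  ⨆ m : {m : Mon n // m.Admissible ∧ m.length = k}, m.1.valO q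

/-- The max-plus version of `E_k`. -/
def tropE {n : ℕ} (k : ℕ) (q : Phase n) : ℝ :=
  ⨆ m : {m : Mon n // m.Admissible ∧ m.length = k}, m.1.valE q

/-- The common level set through `q` of the `2 [n/2] + 2` tropical invariants: the max-plus
versions `∑ x_i`, `∑ y_i` of `O_n`, `E_n`, and those of `O_k`, `E_k` for `1 ≤ k ≤ [n/2]`. -/
def levelSet {n : ℕ} [NeZero n] (q : Phase n) : Set (Phase n) :=
  {p | ∑ i, p.1 i = ∑ i, q.1 i ∧ ∑ i, p.2 i = ∑ i, q.2 i ∧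
    ∀ k ∈ Finset.Icc 1 (n / 2), tropO k p = tropO k q ∧ tropE k p = tropE k q}

/-- A `d`-dimensional (not necessarily convex) compact polytope: a nonempty finite union of convex
polytopes, all of dimension `d`. -/
def IsPolytopeOfDim {V : Type*} [AddCommGroup V] [Module ℝ V] (P : Set V) (d : ℕ) : Prop :=
  ∃ C : Set (Finset V), C.Finite ∧ C.Nonempty ∧
    (∀ s ∈ C, s.Nonempty ∧ Module.finrank ℝ (vectorSpan ℝ (s : Set V)) = d) ∧
    P = ⋃ s ∈ C, convexHull ℝ (s : Set V)

end

end Pentagram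

namespace Pentagram

set_option linter.unusedSectionVars false

/-! Admissible monomials are encoded as words in four letters on the cycle `ZMod n`, so that local
claims become finite checks on neighbouring letters. The invariants are then maxima of the linear
forms `form τ S` over words with a given number of factors.

Invariance: group the O-monomials at `q` by the set of last sites of their factors, and those at the
image point by the set of first sites. For each set the two groups have the same maximum, `weight`.
The reflection `rho` carries the result over to the E-monomials.

Dimension: where the maximizers are unique, the invariants are locally linear with gradients `vec
s`, and what must be shown is that these `2[n/2] + 2` vectors are independent. Near a special point
the optimal words are `evens k` and independence is a triangular computation. From there one follows
a segment to a generic point and crosses walls one at a time (`indep_seg`). At a wall all gradients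
change by multiples of one vector `g` (`wall_crossing`), and two mechanisms preserve independence.
The first is the log-canonical bracket `omega`: at a generic point optimal monomials commute
(`omega_form_eq_zero`), because a non-zero bracket would allow an exchange into another pair with
the same product and lengths, against uniqueness. If the two monomials tied at the wall do not
commute, `g` therefore lies outside the span of the gradients. In the other cases of `rearrange` the
product of the tied monomials is also a product of monomials belonging to other invariants; this
yields a relation between gradients on one side that fails on the other
(`linearIndependent_of_add_smul_of_fold`).

Polytopes: a level set is bounded, since the first invariants bound the coordinates above and the
totals then bound them below. It is a finite union of polyhedra `piece s q`, and for `q` outside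
finitely many subspaces each non-empty piece contains a point where every nontrivial inequality is
strict (`exists_interior`), hence has full dimension in its fibre. -/

/-- The state of a site of the cycle `ZMod n` in an admissible monomial: empty, occupied by a short
factor, or occupied by the head or the tail of a long factor. -/
inductive Cell
  | e | s | l | m
  deriving DecidableEq

instance : Fintype Cell := ⟨{.e, .s, .l, .m}, fun x => by cases x <;> decide⟩

namespace Cell

/-- The states that may stand on neighbouring sites. -/
def Step (a b : Cell) : Prop :=
  match a with
  | e => b ≠ m
  | s => b = e
  | l => b = m
  | m => b = e

instance : DecidableRel Step := fun a b => by
  cases a <;> simp only [Step] <;> infer_instance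

/-- `1` on the occupied sites. -/
def cov : Cell → ℤ | e => 0 | s => 1 | l => 1 | m => 1
/-- `1` on the heads of long factors. -/
def hd : Cell → ℤ | e => 0 | s => 0 | l => 1 | m => 0
/-- `1` on the tails of long factors. -/
def tl : Cell → ℤ | e => 0 | s => 0 | l => 0 | m => 1
/-- `1` on the first sites of factors. -/
def st : Cell → ℤ | e => 0 | s => 1 | l => 1 | m => 0

/-- Exchange of heads and tails. -/
def rev : Cell → Cell | e => e | s => s | l => m | m => l

/-- The exponent of `x` contributed by a site. -/
def fx : Bool → Cell → ℤ | true => cov | false => tl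
/-- The exponent of `y` contributed by a site. -/
def fy : Bool → Cell → ℤ | true => hd | false => cov

end Cell

/-! ### Configurations on the cycle and their exponent vectors -/

open Cell

variable {n : ℕ}

/-- A function on the cycle describing an admissible monomial. -/
def IsConfig (S : ZMod n → Cell) : Prop := ∀ i, Step (S i) (S (i + 1))

variable [NeZero n]

/-- The number of factors. -/
def cnt (S : ZMod n → Cell) : ℤ := ∑ i, st (S i)

/-- The exponent vector, of `O`-type for `true` and of `E`-type for `false`. -/
noncomputable def form (τ : Bool) (S : ZMod n → Cell) : Phase n :=
  (fun i => (fx τ (S i) : ℝ), fun i => (fy τ (S i) : ℝ))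

/-- The standard scalar product. -/
noncomputable def dot : Phase n →ₗ[ℝ] Phase n →ₗ[ℝ] ℝ :=
  LinearMap.mk₂ ℝ (fun v q => ∑ i, (v.1 i * q.1 i + v.2 i * q.2 i))
    (fun a b c => by simp only [← Finset.sum_add_distrib, Prod.fst_add, Prod.snd_add, Pi.add_apply]
                     exact Finset.sum_congr rfl fun i _ => by ring)
    (fun a b c => by simp only [Finset.mul_sum, Prod.smul_fst, Prod.smul_snd, Pi.smul_apply,
                      smul_eq_mul]
                     exact Finset.sum_congr rfl fun i _ => by ring)
    (fun a b c => by simp only [← Finset.sum_add_distrib, Prod.fst_add, Prod.snd_add, Pi.add_apply]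
                     exact Finset.sum_congr rfl fun i _ => by ring)
    (fun a b c => by simp only [Finset.mul_sum, Prod.smul_fst, Prod.smul_snd, Pi.smul_apply,
                      smul_eq_mul]
                     exact Finset.sum_congr rfl fun i _ => by ring)

theorem dot_apply (v q : Phase n) : dot v q = ∑ i, (v.1 i * q.1 i + v.2 i * q.2 i) := rfl

theorem sum_shift {M : Type*} [AddCommMonoid M] (g : ZMod n → M) (c : ZMod n) :
    ∑ i, g (i + c) = ∑ i, g i := Equiv.sum_comp (Equiv.addRight c) g

/-- Tails are exactly the successors of heads, so the weight of a long factor may be booked on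
either of its two sites. The invariance proof needs both bookings. -/
theorem sum_tl_eq_sum_hd {M : Type*} [AddCommMonoid M] {S : ZMod n → Cell} (hS : IsConfig S)
    (g : ZMod n → M) :
    (∑ i, if S i = m then g i else 0) = ∑ i, if S i = l then g (i + 1) else 0 := by
  rw [← sum_shift _ 1]
  refine Finset.sum_congr rfl fun i _ => ?_
  have h : S (i + 1) = m ↔ S i = l := by
    have := hS i
    revert this; generalize S i = a; generalize S (i + 1) = b; revert a b; decide
  simp only [h]

/-! ### Dictionary between monomials and configurations -/

/-- The value of a monomial of either type. -/
noncomputable def monVal (τ : Bool) (μ : Mon n) (q : Phase n) : ℝ :=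
  match τ with | true => μ.valO q | false => μ.valE q

/-- The tropical invariant of either type. -/
noncomputable def trop (τ : Bool) (k : ℕ) (q : Phase n) : ℝ :=
  match τ with | true => tropO k q | false => tropE k q

theorem one_ne (hn : 3 ≤ n) : (1 : ZMod n) ≠ 0 := by
  have : Fact (1 < n) := ⟨by omega⟩
  exact one_ne_zero

/-- For `3 ≤ n` the sites at distance one and two from a long factor differ from it, so the clause
`i ≠ j` in `Mon.Admissible` does not switch these exclusions off. -/
theorem two_ne (hn : 3 ≤ n) : (2 : ZMod n) ≠ 0 := by
  intro h
  have : ((2 : ℕ) : ZMod n) = 0 := by exact_mod_cast h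
  rw [ZMod.natCast_eq_zero_iff] at this
  exact absurd (Nat.le_of_dvd (by norm_num) this) (by omega)

/-- The configuration of a monomial. -/
noncomputable def Mon.config (μ : Mon n) (i : ZMod n) : Cell :=
  open Classical in
  if i ∈ μ.long then l else if i ∈ μ.short then s else if i - 1 ∈ μ.long then m else e

theorem Mon.Admissible.isConfig (hn : 3 ≤ n) {μ : Mon n} (h : μ.Admissible) :
    IsConfig μ.config := by
  obtain ⟨h1, h2, h3⟩ := h
  have hL1 : ∀ i, i ∈ μ.long → i + 1 ∉ μ.long := fun i hi hj =>
    h1 i hi (i + 1) hj (by simpa using one_ne hn) (by simp)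
  have hL2 : ∀ i, i ∈ μ.long → i + 2 ∉ μ.long := fun i hi hj =>
    h1 i hi (i + 2) hj (by simpa using two_ne hn) (by simp)
  have hS : ∀ i, i ∈ μ.long → i ∉ μ.short ∧ i + 1 ∉ μ.short ∧ i + 2 ∉ μ.short ∧
      i - 1 ∉ μ.short := fun i hi =>
    ⟨fun hj => h2 i hi _ hj (by simp), fun hj => h2 i hi _ hj (by simp),
      fun hj => h2 i hi _ hj (by simp), fun hj => h2 i hi _ hj (by simp)⟩
  intro i
  have e1 : i + 1 - 1 = i := by ring
  have e2 : i - 1 + 2 = i + 1 := by ring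
  have e3 : i - 1 + 1 = i := by ring
  have a1 := hL1 i
  have a2 := hL2 (i - 1)
  have a3 := hL1 (i - 1)
  have b1 := hS i
  have b2 := hS (i + 1)
  have b3 := hS (i - 1)
  have c1 := h3 i
  simp only [e1, e2, e3] at a1 a2 a3 b1 b2 b3
  unfold Mon.config
  simp only [e1]
  split_ifs <;> simp_all [Step]

theorem Mon.Admissible.cov_config {μ : Mon n} (hn : 3 ≤ n) (h : μ.Admissible) (i : ZMod n) :
    open Classical in
    cov (μ.config i) = (if i ∈ μ.long then 1 else 0) + (if i ∈ μ.short then 1 else 0) +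
      (if i - 1 ∈ μ.long then 1 else 0) := by
  obtain ⟨h1, h2, h3⟩ := h
  have hL1 : i - 1 ∈ μ.long → i ∉ μ.long := fun hi hj =>
    h1 _ hi i hj (fun h => one_ne hn (by simpa using (congrArg (· - i + 1) h).symm)) (by simp)
  have hS : i ∈ μ.long → i ∉ μ.short := fun hi hj => h2 i hi _ hj (by simp)
  have hS' : i - 1 ∈ μ.long → i ∉ μ.short := fun hi hj => h2 _ hi _ hj (by simp)
  unfold Mon.config
  split_ifs <;> simp_all [cov]

theorem Mon.Admissible.hd_config {μ : Mon n} (i : ZMod n) :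
    open Classical in
    hd (μ.config i) = if i ∈ μ.long then 1 else 0 := by
  unfold Mon.config
  split_ifs <;> simp_all [hd]

theorem Mon.Admissible.tl_config {μ : Mon n} (hn : 3 ≤ n) (h : μ.Admissible) (i : ZMod n) :
    open Classical in
    tl (μ.config i) = if i - 1 ∈ μ.long then 1 else 0 := by
  obtain ⟨h1, h2, h3⟩ := h
  have hL1 : i - 1 ∈ μ.long → i ∉ μ.long := fun hi hj =>
    h1 _ hi i hj (fun h => one_ne hn (by simpa using (congrArg (· - i + 1) h).symm)) (by simp)
  have hS' : i - 1 ∈ μ.long → i ∉ μ.short := fun hi hj => h2 _ hi _ hj (by simp)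
  unfold Mon.config
  split_ifs <;> simp_all [tl]

theorem sum_long_shift (A : Finset (ZMod n)) (g : ZMod n → ℝ) :
    open Classical in
    (∑ i, if i - 1 ∈ A then g i else 0) = ∑ i ∈ A, g (i + 1) := by
  classical
  rw [← sum_shift _ 1, ← Finset.sum_filter]
  simp

theorem Mon.Admissible.monVal_eq (hn : 3 ≤ n) {μ : Mon n} (h : μ.Admissible) (τ : Bool)
    (q : Phase n) : monVal τ μ q = dot (form τ μ.config) q := by
  classical
  cases τ
  · simp only [monVal, Mon.valE, dot_apply, form, fx, fy, h.cov_config hn, h.tl_config hn]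
    push_cast
    simp only [add_mul, ite_mul, one_mul, zero_mul, Finset.sum_add_distrib, sum_long_shift]
    simp [Finset.sum_ite_mem]
    ring
  · simp only [monVal, Mon.valO, dot_apply, form, fx, fy, h.cov_config hn,
      Mon.Admissible.hd_config]
    push_cast
    simp only [add_mul, ite_mul, one_mul, zero_mul, Finset.sum_add_distrib, sum_long_shift]
    simp [Finset.sum_ite_mem]
    ring

theorem st_config {μ : Mon n} (h : ∀ i ∈ μ.long, i ∉ μ.short) (i : ZMod n) :
    open Classical in
    st (μ.config i) = (if i ∈ μ.long then 1 else 0) + (if i ∈ μ.short then 1 else 0) := by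
  have := h i
  unfold Mon.config
  split_ifs <;> simp_all [st]

theorem Mon.Admissible.cnt_config {μ : Mon n} (h : μ.Admissible) :
    cnt μ.config = μ.length := by
  classical
  have h' : ∀ i ∈ μ.long, i ∉ μ.short := fun i hi hj => h.2.1 i hi i hj (by simp)
  simp only [cnt, st_config h', Finset.sum_add_distrib, Mon.length]
  simp

/-- The monomial of a configuration. -/
def toMon (S : ZMod n → Cell) : Mon n :=
  ⟨Finset.univ.filter fun i => S i = l, Finset.univ.filter fun i => S i = s⟩

theorem IsConfig.admissible {S : ZMod n → Cell} (hS : IsConfig S) : (toMon S).Admissible := by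
  have key : ∀ i, (S i = l → S (i + 1) = m ∧ S (i + 2) = e) ∧ (S i = s → S (i + 1) = e) := by
    intro i
    have h1 := hS i
    have h2 := hS (i + 1)
    rw [show i + 1 + 1 = i + 2 by ring] at h2
    revert h1 h2
    generalize S i = a; generalize S (i + 1) = b; generalize S (i + 2) = c
    revert a b c; decide
  have p1 : ∀ i, S i = l → S (i - 1) = e := by
    intro i hi
    have h1 := hS (i - 1)
    rw [show i - 1 + 1 = i by ring, hi] at h1
    revert h1; generalize S (i - 1) = a; revert a; decide
  have p2 : ∀ i, S i = l → S (i - 2) ≠ l := by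
    intro i hi h
    have := (key (i - 2)).1 h
    rw [show i - 2 + 1 = i - 1 by ring, p1 i hi] at this
    simp at this
  refine ⟨?_, ?_, ?_⟩
  · intro i hi j hj hij
    simp only [toMon, Finset.mem_filter, Finset.mem_univ, true_and] at hi hj
    simp only [Set.mem_insert_iff, Set.mem_singleton_iff, not_or]
    refine ⟨?_, ?_, fun h => hij h.symm, ?_, ?_⟩ <;> rintro rfl
    · exact p2 i hi hj
    · simp [p1 i hi] at hj
    · simp [(key i).1 hi] at hj
    · simp [(key i).1 hi] at hj
  · intro i hi j hj
    simp only [toMon, Finset.mem_filter, Finset.mem_univ, true_and] at hi hj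
    simp only [Set.mem_insert_iff, Set.mem_singleton_iff, not_or]
    refine ⟨?_, ?_, ?_, ?_⟩ <;> rintro rfl
    · simp [p1 i hi] at hj
    · simp [hi] at hj
    · simp [(key i).1 hi] at hj
    · simp [(key i).1 hi] at hj
  · intro i hi hj
    simp only [toMon, Finset.mem_filter, Finset.mem_univ, true_and] at hi hj
    simp [(key i).2 hi] at hj

theorem IsConfig.config_toMon {S : ZMod n → Cell} (hS : IsConfig S) : (toMon S).config = S := by
  funext i
  have h1 := hS (i - 1)
  rw [show i - 1 + 1 = i by ring] at h1
  simp only [Mon.config, toMon, Finset.mem_filter, Finset.mem_univ, true_and]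
  revert h1; generalize S (i - 1) = a; generalize S i = b
  revert a b
  decide

/-! ### Optimal configurations and the values of the invariants -/

/-- A configuration is optimal at `q` if it has the largest value among all configurations with
the same number of factors. -/
def IsOpt (τ : Bool) (S : ZMod n → Cell) (q : Phase n) : Prop :=
  IsConfig S ∧ ∀ S', IsConfig S' → cnt S' = cnt S → dot (form τ S') q ≤ dot (form τ S) q

theorem IsOpt.trop_eq (hn : 3 ≤ n) {τ : Bool} {S : ZMod n → Cell} {q : Phase n}
    (h : IsOpt τ S q) {k : ℕ} (hk : cnt S = k) : trop τ k q = dot (form τ S) q := by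
  have hb : ∀ μ : {μ : Mon n // μ.Admissible ∧ μ.length = k},
      monVal τ μ.1 q ≤ dot (form τ S) q := by
    rintro ⟨μ, hμ, hl⟩
    rw [hμ.monVal_eq hn]
    exact h.2 _ (hμ.isConfig hn) (by rw [hμ.cnt_config, hl, hk])
  have hl : (toMon S).length = k := by
    have := h.1.admissible.cnt_config
    rw [h.1.config_toMon, hk] at this
    exact_mod_cast this.symm
  have : trop τ k q = ⨆ μ : {μ : Mon n // μ.Admissible ∧ μ.length = k}, monVal τ μ.1 q := by
    cases τ <;> rfl
  rw [this]
  -- A real `⨆` is meaningful only over a non-empty index and a bounded range; the optimal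
  -- configuration supplies both.
  have : Nonempty {μ : Mon n // μ.Admissible ∧ μ.length = k} := ⟨⟨toMon S, h.1.admissible, hl⟩⟩
  refine le_antisymm (ciSup_le hb) ?_
  refine le_ciSup_of_le ⟨_, by rintro _ ⟨μ, rfl⟩; exact hb μ⟩ ⟨toMon S, h.1.admissible, hl⟩ ?_
  simp only
  rw [h.1.admissible.monVal_eq hn, h.1.config_toMon]

/-! ### The reflection exchanging the two types -/

/-- The reflection of the phase space that exchanges the two types of invariants. -/
def rho : Phase n →ₗ[ℝ] Phase n where
  toFun q := (fun i => q.2 (-i), fun i => q.1 (-i))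
  map_add' _ _ := rfl
  map_smul' _ _ := rfl

theorem rho_rho (q : Phase n) : rho (rho q) = q := by
  simp [rho]

theorem sum_neg_index {M : Type*} [AddCommMonoid M] (g : ZMod n → M) :
    ∑ i, g (-i) = ∑ i, g i := Equiv.sum_comp (Equiv.neg _) g

theorem dot_rho_rho (u v : Phase n) : dot (rho u) (rho v) = dot u v := by
  simp only [dot_apply, rho, LinearMap.coe_mk, AddHom.coe_mk]
  rw [← sum_neg_index]
  simp only [neg_neg]
  exact Finset.sum_congr rfl fun i _ => by ring

/-- The reflected configuration. -/
def refl (S : ZMod n → Cell) (i : ZMod n) : Cell := rev (S (-i))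

theorem refl_refl (S : ZMod n → Cell) : refl (refl S) = S := by
  funext i
  simp only [refl, neg_neg]
  generalize S i = a
  revert a; decide

theorem IsConfig.refl {S : ZMod n → Cell} (hS : IsConfig S) : IsConfig (refl S) := by
  intro i
  have h1 := hS (-(i + 1))
  have h0 := hS (-(i + 1) - 1)
  rw [show -(i + 1) + 1 = -i by ring] at h1
  rw [show -(i + 1) - 1 + 1 = -(i + 1) by ring] at h0
  simp only [Pentagram.refl]
  revert h1 h0
  generalize S (-(i + 1)) = a; generalize S (-i) = b; generalize S (-(i + 1) - 1) = c
  revert a b c; decide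

theorem cnt_eq_sum (S : ZMod n → Cell) :
    cnt S = (∑ i, if S i = s then 1 else 0) + ∑ i, if S i = l then 1 else 0 := by
  rw [cnt, ← Finset.sum_add_distrib]
  refine Finset.sum_congr rfl fun i _ => ?_
  generalize S i = a; revert a; decide

theorem IsConfig.cnt_eq_sum_tl {S : ZMod n → Cell} (hS : IsConfig S) :
    cnt S = (∑ i, if S i = s then 1 else 0) + ∑ i, if S i = m then 1 else 0 := by
  rw [cnt_eq_sum, sum_tl_eq_sum_hd hS]

theorem IsConfig.cnt_refl {S : ZMod n → Cell} (hS : IsConfig S) : cnt (Pentagram.refl S) = cnt S := by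
  rw [hS.cnt_eq_sum_tl, cnt_eq_sum, ← sum_neg_index (fun i => if S i = s then (1 : ℤ) else 0),
    ← sum_neg_index (fun i => if S i = m then (1 : ℤ) else 0)]
  have h : ∀ a, ((if rev a = s then (1 : ℤ) else 0) = if a = s then 1 else 0) ∧
      ((if rev a = l then (1 : ℤ) else 0) = if a = m then 1 else 0) := by decide
  congr 1
  · exact Finset.sum_congr rfl fun i _ => (h (S (-i))).1
  · exact Finset.sum_congr rfl fun i _ => (h (S (-i))).2

/-- Reversing the cycle and swapping `x` with `y` turns `x_i y_i x_{i+1}` into `y x y` on the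
reflected pair of sites, with head and tail interchanged. -/
theorem form_refl (τ : Bool) (S : ZMod n → Cell) : form (!τ) (refl S) = rho (form τ S) := by
  have h : ∀ τ a, fx (!τ) (rev a) = fy τ a ∧ fy (!τ) (rev a) = fx τ a := by decide
  simp only [form, rho, LinearMap.coe_mk, AddHom.coe_mk, refl]
  simp [h]

theorem dot_form_refl (τ : Bool) (S : ZMod n → Cell) (q : Phase n) :
    dot (form (!τ) (refl S)) (rho q) = dot (form τ S) q := by
  rw [form_refl, dot_rho_rho]

theorem IsOpt.refl {τ : Bool} {S : ZMod n → Cell} {q : Phase n} (h : IsOpt τ S q) :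
    IsOpt (!τ) (refl S) (rho q) := by
  refine ⟨h.1.refl, fun S' hS' hc => ?_⟩
  rw [dot_form_refl]
  have := h.2 (Pentagram.refl S') hS'.refl (by rw [hS'.cnt_refl, hc, h.1.cnt_refl])
  rwa [← dot_form_refl, refl_refl] at this

/-! ### Existence of configurations -/

/-- The configuration with short factors at `0, 2, …, 2k - 2`. -/
def evens (k : ℕ) (i : ZMod n) : Cell := if i.val % 2 = 0 ∧ i.val < 2 * k then s else e

theorem val_add_one_cases (i : ZMod n) :
    ((i + 1).val = i.val + 1 ∧ i.val + 1 < n) ∨ ((i + 1).val = 0 ∧ i.val + 1 = n) := by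
  have h0 : i.val < n := ZMod.val_lt i
  have h : (i + 1).val = (i.val + 1) % n := by
    have : i + 1 = ((i.val + 1 : ℕ) : ZMod n) := by push_cast; simp
    rw [this, ZMod.val_natCast]
  rcases Nat.lt_or_ge (i.val + 1) n with h1 | h1
  · left; rw [h, Nat.mod_eq_of_lt h1]; exact ⟨rfl, h1⟩
  · right
    have : i.val + 1 = n := by omega
    rw [h, this, Nat.mod_self]; exact ⟨rfl, rfl⟩

theorem isConfig_evens {k : ℕ} (hk : k ≤ n / 2) : IsConfig (evens k : ZMod n → Cell) := by
  intro i
  rcases val_add_one_cases i with ⟨h1, h2⟩ | ⟨h1, h2⟩ <;> unfold evens <;> rw [h1] <;>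
    split_ifs <;> first | omega | simp [Step]

theorem sum_zmod_eq_sum_range {M : Type*} [AddCommMonoid M] (g : ZMod n → M) (i : ZMod n) :
    ∑ j, g j = ∑ t ∈ Finset.range n, g (i + t) := by
  rw [← sum_shift g i]
  refine (Finset.sum_bij (fun t _ => ((t : ℕ) : ZMod n)) (fun _ _ => Finset.mem_univ _) ?_ ?_ ?_).symm
  · intro a ha b hb hab
    rw [Finset.mem_range] at ha hb
    have := congrArg ZMod.val hab
    rwa [ZMod.val_natCast, ZMod.val_natCast, Nat.mod_eq_of_lt ha, Nat.mod_eq_of_lt hb] at this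
  · intro b _
    exact ⟨b.val, Finset.mem_range.2 (ZMod.val_lt b), by simp⟩
  · intro a _
    rw [add_comm]

theorem cnt_evens {k : ℕ} (hk : k ≤ n / 2) : cnt (evens k : ZMod n → Cell) = k := by
  rw [cnt, sum_zmod_eq_sum_range _ 0]
  have h : ∀ t ∈ Finset.range n, st (evens k (0 + (t : ZMod n))) =
      if t % 2 = 0 ∧ t < 2 * k then 1 else 0 := by
    intro t ht
    rw [Finset.mem_range] at ht
    rw [zero_add, evens, ZMod.val_natCast, Nat.mod_eq_of_lt ht]
    split_ifs <;> rfl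
  rw [Finset.sum_congr rfl h, Finset.sum_boole]
  have : (Finset.range n).filter (fun t => t % 2 = 0 ∧ t < 2 * k) =
      (Finset.range k).image (fun j => 2 * j) := by
    ext t
    simp only [Finset.mem_filter, Finset.mem_range, Finset.mem_image]
    constructor
    · rintro ⟨_, h1, h2⟩
      exact ⟨t / 2, by omega, by omega⟩
    · rintro ⟨j, h1, rfl⟩
      omega
  rw [this, Finset.card_image_of_injective _ (fun a b h => by simpa using h), Finset.card_range]

theorem exists_isOpt (τ : Bool) (q : Phase n) {k : ℕ} (hk : k ≤ n / 2) :
    ∃ S : ZMod n → Cell, IsOpt τ S q ∧ cnt S = k := by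
  classical
  let F : Finset (ZMod n → Cell) := Finset.univ.filter fun S => IsConfig S ∧ cnt S = k
  have hF : F.Nonempty := ⟨evens k, by simp [F, isConfig_evens hk, cnt_evens hk]⟩
  obtain ⟨S, hS, hmax⟩ := F.exists_max_image (fun S => dot (form τ S) q) hF
  simp only [F, Finset.mem_filter, Finset.mem_univ, true_and] at hS hmax
  exact ⟨S, ⟨hS.1, fun S' h1 h2 => hmax S' ⟨h1, h2.trans hS.2⟩⟩, hS.2⟩

theorem cnt_nonneg (S : ZMod n → Cell) : 0 ≤ cnt S :=
  Finset.sum_nonneg fun i _ => by generalize S i = a; revert a; decide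

theorem IsConfig.two_mul_cnt_le {S : ZMod n → Cell} (hS : IsConfig S) : 2 * cnt S ≤ n := by
  have h1 : cnt S = ∑ i, st (S (i + 1)) := (sum_shift (fun i => st (S i)) 1).symm
  have h2 : 2 * cnt S = ∑ i, (st (S i) + st (S (i + 1))) := by
    rw [Finset.sum_add_distrib, ← h1, cnt]; ring
  rw [h2]
  calc ∑ i, (st (S i) + st (S (i + 1))) ≤ ∑ i : ZMod n, (1 : ℤ) := by
        refine Finset.sum_le_sum fun i _ => ?_
        have := hS i
        revert this; generalize S i = a; generalize S (i + 1) = b; revert a b; decide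
    _ = n := by simp [ZMod.card]

/-! ### Invariance -/

section Invariance

variable (q : Phase n)

/-- The tropicalization of `1 + x_i y_i`. -/
noncomputable def gap (i : ZMod n) : ℝ := max 0 (q.1 i + q.2 i)

/-- The sum of the values of all monomials whose factors end in the sites of `I` tropicalizes
to this weight. -/
noncomputable def weight (I : ZMod n → Bool) : ℝ :=
  ∑ i, if I i then q.1 i + (if I (i - 2) then 0 else gap q (i - 1)) else 0

theorem dot_formO (S : ZMod n → Cell) :
    dot (form true S) q = ∑ i, ((if S i = s ∨ S i = m then q.1 i else 0) +
      if S i = l then q.1 i + q.2 i else 0) := by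
  rw [dot_apply]
  refine Finset.sum_congr rfl fun i _ => ?_
  simp only [form, fx, fy]
  generalize S i = a
  cases a <;> simp [cov, hd]

/-- Book `x + y` of the head on the tail. A last site `i` then receives at most `x_i` plus the gap
at `i - 1`, and the gap is not available when `i - 2` is also a last site, since the site behind it
must be empty. -/
theorem dot_formO_le_weight {S : ZMod n → Cell} (hS : IsConfig S) :
    dot (form true S) q ≤ weight q fun i => S i = s ∨ S i = m := by
  have h := sum_tl_eq_sum_hd hS fun i => q.1 (i - 1) + q.2 (i - 1)
  simp only [add_sub_cancel_right] at h
  rw [dot_formO, Finset.sum_add_distrib, ← h, ← Finset.sum_add_distrib]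
  refine Finset.sum_le_sum fun i _ => ?_
  have h1 := hS (i - 1)
  have h2 := hS (i - 2)
  have hg : q.1 (i - 1) + q.2 (i - 1) ≤ gap q (i - 1) := le_max_right _ _
  have hg0 : 0 ≤ gap q (i - 1) := le_max_left _ _
  rw [show i - 1 + 1 = i by ring] at h1
  rw [show i - 2 + 1 = i - 1 by ring] at h2
  cases hc : S i <;> cases hb : S (i - 1) <;> cases ha : S (i - 2) <;>
    simp [hc, hb, ha, Step] at h1 h2 ⊢ <;> linarith

/-- Whether `x_i + y_i` is positive. -/
noncomputable def pos (i : ZMod n) : Bool := decide (0 < q.1 i + q.2 i)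

theorem gap_eq (i : ZMod n) : gap q i = if pos q i then q.1 i + q.2 i else 0 := by
  by_cases h : 0 < q.1 i + q.2 i
  · simp [gap, pos, h, h.le]
  · simp [gap, pos, h, not_lt.1 h]

/-- Spread a set of last sites of factors to a configuration, choosing long factors where
they have the larger value. -/
noncomputable def ofLast (I : ZMod n → Bool) (i : ZMod n) : Cell :=
  if I i then (if !I (i - 2) && pos q (i - 1) then m else s)
  else if I (i + 1) && !I (i - 1) && pos q i then l else e

theorem isConfig_ofLast {I : ZMod n → Bool} (hI : ∀ i, I i → ¬ I (i + 1)) :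
    IsConfig (ofLast q I) := by
  intro i
  have h1 := hI i
  have h0 := hI (i + 1)
  simp only [ofLast, show i + 1 - 2 = i - 1 by ring, show i + 1 - 1 = i by ring,
    show i + 1 + 1 = i + 2 by ring] at h0 ⊢
  revert h0 h1
  generalize I i = a; generalize I (i + 1) = b; generalize I (i + 2) = c
  generalize I (i - 1) = d; generalize I (i - 2) = f
  generalize pos q i = u; generalize pos q (i - 1) = v; generalize pos q (i + 1) = w
  revert a b c d f u v w
  decide

theorem ofLast_eq_tail (I : ZMod n → Bool) (i : ZMod n) :
    ((ofLast q I i = s ∨ ofLast q I i = m) ↔ I i = true) ∧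
    (ofLast q I i = m ↔ (I i ∧ ¬ I (i - 2) ∧ pos q (i - 1))) := by
  simp only [ofLast]
  split_ifs <;> simp_all

theorem weight_eq_dot_ofLast {I : ZMod n → Bool} (hI : ∀ i, I i → ¬ I (i + 1)) :
    weight q I = dot (form true (ofLast q I)) q := by
  have h := sum_tl_eq_sum_hd (isConfig_ofLast q hI) fun i => q.1 (i - 1) + q.2 (i - 1)
  simp only [add_sub_cancel_right] at h
  rw [dot_formO, Finset.sum_add_distrib, ← h, ← Finset.sum_add_distrib, weight]
  refine Finset.sum_congr rfl fun i _ => ?_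
  rw [if_congr (ofLast_eq_tail q I i).1 rfl rfl, if_congr (ofLast_eq_tail q I i).2 rfl rfl, gap_eq]
  by_cases a1 : I i <;> by_cases a2 : I (i - 2) <;>
    by_cases a3 : pos q (i - 1) <;> simp [a1, a2, a3]

/-- Booked on the head, the transformed long factor loses its gaps at `i` and `i + 2` by
cancellation and becomes the transformed short factor plus `x_{i+1} + y_{i+1}`. -/
theorem dot_formO_automaton {S : ZMod n → Cell} (hS : IsConfig S) :
    dot (form true S) (automaton q) = ∑ i, ((if S i = s ∨ S i = l then
        q.1 i + gap q (i - 1) - gap q (i + 1) else 0) +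
      if S i = l then q.1 (i + 1) + q.2 (i + 1) else 0) := by
  have h := sum_tl_eq_sum_hd hS (automaton q).1
  have h1 : dot (form true S) (automaton q) = ∑ i, (((if S i = s ∨ S i = l then
      (automaton q).1 i else 0) + if S i = l then (automaton q).2 i else 0) +
      if S i = m then (automaton q).1 i else 0) := by
    rw [dot_apply]
    refine Finset.sum_congr rfl fun i _ => ?_
    simp only [form, fx, fy]
    generalize S i = a
    cases a <;> simp [cov, hd]
  rw [h1, Finset.sum_add_distrib, h, ← Finset.sum_add_distrib]
  refine Finset.sum_congr rfl fun i _ => ?_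
  simp only [automaton, gap, show i + 1 + 1 = i + 2 by ring, show i + 1 - 1 = i by ring]
  generalize S i = a
  cases a <;> simp <;> ring

/-- A gap is lost once for each pair of sites of `I` at distance two. Charging the loss to the left
site of the pair instead of the right one gives the form that matches the image under the automaton.
-/
theorem weight_eq_forward (I : ZMod n → Bool) :
    weight q I = ∑ i, if I i then q.1 i + gap q (i - 1) - gap q (i + 1) +
      (if I (i + 2) then 0 else gap q (i + 1)) else 0 := by
  have h : (∑ i, if I i ∧ I (i - 2) then gap q (i - 1) else 0) =
      ∑ i, if I i ∧ I (i + 2) then gap q (i + 1) else 0 := by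
    rw [← sum_shift _ 2]
    refine Finset.sum_congr rfl fun i _ => ?_
    simp only [show i + 2 - 2 = i by ring, show i + 2 - 1 = i + 1 by ring, and_comm]
  have h1 : weight q I = (∑ i, if I i then q.1 i + gap q (i - 1) else 0) -
      ∑ i, if I i ∧ I (i - 2) then gap q (i - 1) else 0 := by
    rw [weight, ← Finset.sum_sub_distrib]
    refine Finset.sum_congr rfl fun i _ => ?_
    by_cases a1 : I i <;> by_cases a2 : I (i - 2) <;> simp [a1, a2]
  rw [h1, h, ← Finset.sum_sub_distrib]
  refine Finset.sum_congr rfl fun i _ => ?_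
  by_cases a1 : I i <;> by_cases a2 : I (i + 2) <;> simp [a1, a2]

theorem dot_formO_automaton_le_weight {S : ZMod n → Cell} (hS : IsConfig S) :
    dot (form true S) (automaton q) ≤ weight q fun i => S i = s ∨ S i = l := by
  rw [dot_formO_automaton q hS, weight_eq_forward]
  refine Finset.sum_le_sum fun i _ => ?_
  have h1 := hS i
  have h2 := hS (i + 1)
  have hg : q.1 (i + 1) + q.2 (i + 1) ≤ gap q (i + 1) := le_max_right _ _
  have hg0 : 0 ≤ gap q (i + 1) := le_max_left _ _
  rw [show i + 1 + 1 = i + 2 by ring] at h2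
  cases hc : S i <;> cases hb : S (i + 1) <;> cases ha : S (i + 2) <;>
    simp [hc, hb, ha, Step] at h1 h2 ⊢ <;> linarith

/-- Spread a set of first sites of factors to a configuration, choosing long factors where
they have the larger value after one step of the automaton. -/
noncomputable def ofFirst (I : ZMod n → Bool) (i : ZMod n) : Cell :=
  if I i then (if !I (i + 2) && pos q (i + 1) then l else s)
  else if I (i - 1) && !I (i + 1) && pos q i then m else e

theorem isConfig_ofFirst {I : ZMod n → Bool} (hI : ∀ i, I i → ¬ I (i + 1)) :
    IsConfig (ofFirst q I) := by
  intro i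
  have h1 := hI i
  have h2 := hI (i - 1)
  have h3 := hI (i + 1)
  simp only [ofFirst, show i + 1 + 2 = i + 3 by ring, show i + 1 - 1 = i by ring,
    show i - 1 + 1 = i by ring, show i + 1 + 1 = i + 2 by ring] at h2 h3 ⊢
  revert h1 h2 h3
  generalize I i = a; generalize I (i + 1) = b; generalize I (i + 2) = c
  generalize I (i - 1) = d; generalize I (i + 3) = f
  generalize pos q i = u; generalize pos q (i + 1) = v; generalize pos q (i + 2) = w
  revert a b c d f u v w
  decide

theorem ofFirst_eq_head (I : ZMod n → Bool) (i : ZMod n) :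
    ((ofFirst q I i = s ∨ ofFirst q I i = l) ↔ I i = true) ∧
    (ofFirst q I i = l ↔ (I i ∧ ¬ I (i + 2) ∧ pos q (i + 1))) := by
  simp only [ofFirst]
  split_ifs <;> simp_all

theorem weight_eq_dot_ofFirst {I : ZMod n → Bool} (hI : ∀ i, I i → ¬ I (i + 1)) :
    weight q I = dot (form true (ofFirst q I)) (automaton q) := by
  rw [dot_formO_automaton q (isConfig_ofFirst q hI), weight_eq_forward]
  refine Finset.sum_congr rfl fun i _ => ?_
  rw [if_congr (ofFirst_eq_head q I i).1 rfl rfl, if_congr (ofFirst_eq_head q I i).2 rfl rfl,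
    gap_eq q (i + 1)]
  by_cases a1 : I i <;> by_cases a2 : I (i + 2) <;>
    by_cases a3 : pos q (i + 1) <;> simp [a1, a2, a3]

theorem cnt_eq_of_first (S : ZMod n → Cell) {I : ZMod n → Bool}
    (h : ∀ i, (S i = s ∨ S i = l) ↔ I i = true) : cnt S = ∑ i, if I i then 1 else 0 := by
  refine Finset.sum_congr rfl fun i _ => ?_
  simp only [← h]
  generalize S i = a; revert a; decide

theorem cnt_eq_of_last {S : ZMod n → Cell} (hS : IsConfig S) {I : ZMod n → Bool}
    (h : ∀ i, (S i = s ∨ S i = m) ↔ I i = true) : cnt S = ∑ i, if I i then 1 else 0 := by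
  rw [hS.cnt_eq_sum_tl, ← Finset.sum_add_distrib]
  refine Finset.sum_congr rfl fun i _ => ?_
  simp only [← h]
  generalize S i = a; revert a; decide

/-- The last sites of the factors at `q` are reused as first sites at the image: both families share
the upper bound `weight`, and `ofFirst` attains it. -/
theorem exists_ge_automaton {S : ZMod n → Cell} (hS : IsConfig S) :
    ∃ S' : ZMod n → Cell, IsConfig S' ∧ cnt S' = cnt S ∧
      dot (form true S) q ≤ dot (form true S') (automaton q) := by
  set I : ZMod n → Bool := fun i => S i = s ∨ S i = m with hI
  have hI' : ∀ i, I i → ¬ I (i + 1) := by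
    intro i
    have := hS i
    simp only [I, decide_eq_true_eq]
    revert this; generalize S i = a; generalize S (i + 1) = b; revert a b; decide
  refine ⟨ofFirst q I, isConfig_ofFirst q hI', ?_, ?_⟩
  · rw [cnt_eq_of_first _ fun i => (ofFirst_eq_head q I i).1, cnt_eq_of_last hS (I := I)]
    simp [I]
  · rw [← weight_eq_dot_ofFirst q hI']
    exact dot_formO_le_weight q hS

theorem exists_ge_of_automaton {S : ZMod n → Cell} (hS : IsConfig S) :
    ∃ S' : ZMod n → Cell, IsConfig S' ∧ cnt S' = cnt S ∧
      dot (form true S) (automaton q) ≤ dot (form true S') q := by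
  set I : ZMod n → Bool := fun i => S i = s ∨ S i = l with hI
  have hI' : ∀ i, I i → ¬ I (i + 1) := by
    intro i
    have := hS i
    simp only [I, decide_eq_true_eq]
    revert this; generalize S i = a; generalize S (i + 1) = b; revert a b; decide
  refine ⟨ofLast q I, isConfig_ofLast q hI', ?_, ?_⟩
  · rw [cnt_eq_of_last (isConfig_ofLast q hI') fun i => (ofLast_eq_tail q I i).1,
      cnt_eq_of_first S (I := I)]
    simp [I]
  · rw [← weight_eq_dot_ofLast q hI']
    exact dot_formO_automaton_le_weight q hS

theorem trop_le_of_exists (hn : 3 ≤ n) {τ τ' : Bool} {q q' : Phase n} {k : ℕ} (hk : k ≤ n / 2)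
    (h : ∀ S : ZMod n → Cell, IsConfig S → ∃ S' : ZMod n → Cell, IsConfig S' ∧ cnt S' = cnt S ∧
      dot (form τ S) q ≤ dot (form τ' S') q') : trop τ k q ≤ trop τ' k q' := by
  obtain ⟨S, hS, hc⟩ := exists_isOpt τ q hk
  obtain ⟨S', h1, h2, h3⟩ := h S hS.1
  obtain ⟨T, hT, hTc⟩ := exists_isOpt τ' q' hk
  rw [hS.trop_eq hn hc, hT.trop_eq hn hTc]
  exact h3.trans (hT.2 S' h1 (by rw [h2, hc, hTc]))

theorem tropO_automaton (hn : 3 ≤ n) {k : ℕ} (hk : k ≤ n / 2) :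
    trop true k (automaton q) = trop true k q :=
  le_antisymm (trop_le_of_exists hn hk fun _ hS => exists_ge_of_automaton q hS)
    (trop_le_of_exists hn hk fun _ hS => exists_ge_automaton q hS)

/-! ### Transfer of invariance from O to E -/

theorem trop_rho (hn : 3 ≤ n) (τ : Bool) {k : ℕ} (hk : k ≤ n / 2) :
    trop (!τ) k (rho q) = trop τ k q := by
  obtain ⟨S, hS, hc⟩ := exists_isOpt τ q hk
  rw [hS.trop_eq hn hc, hS.refl.trop_eq hn (by rw [hS.1.cnt_refl, hc]), dot_form_refl]

/-- Translation of the indices. -/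
def translate (c : ZMod n) (q : Phase n) : Phase n := (fun i => q.1 (i + c), fun i => q.2 (i + c))

theorem trop_translate_le (hn : 3 ≤ n) (τ : Bool) (c : ZMod n) {k : ℕ} (hk : k ≤ n / 2) :
    trop τ k q ≤ trop τ k (translate c q) := by
  refine trop_le_of_exists hn hk fun S hS => ⟨fun i => S (i + c), fun i => ?_, ?_, ?_⟩
  · have := hS (i + c)
    rwa [show i + c + 1 = i + 1 + c by ring] at this
  · exact sum_shift (fun i => st (S i)) c
  · rw [dot_apply, dot_apply, ← sum_shift _ c]
    rfl

theorem trop_translate (hn : 3 ≤ n) (τ : Bool) (c : ZMod n) {k : ℕ} (hk : k ≤ n / 2) :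
    trop τ k (translate c q) = trop τ k q := by
  refine le_antisymm ?_ (trop_translate_le q hn τ c hk)
  have := trop_translate_le (translate c q) hn τ (-c) hk
  simpa [translate] using this

/-- The reflection commutes with the automaton up to a translation of the indices, which the
invariants do not see. Invariance for one type therefore gives it for the other. -/
theorem automaton_rho : automaton (rho q) = translate 1 (rho (automaton q)) := by
  refine Prod.ext (funext fun i => ?_) (funext fun i => ?_)
  · simp only [automaton, rho, translate, LinearMap.coe_mk, AddHom.coe_mk]
    rw [show -(i + 1) + 1 = -i by ring, show -(i + 1) + 2 = -(i - 1) by ring,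
      add_comm (q.2 (-(i - 1))), add_comm (q.2 (-(i + 1)))]
  · simp only [automaton, rho, translate, LinearMap.coe_mk, AddHom.coe_mk]
    rw [show -(i + 1) - 1 = -(i + 2) by ring, show -(i + 1) + 1 = -i by ring,
      add_comm (q.2 (-(i + 2))), add_comm (q.2 (-i))]

theorem trop_automaton (hn : 3 ≤ n) (τ : Bool) {k : ℕ} (hk : k ≤ n / 2) :
    trop τ k (automaton q) = trop τ k q := by
  cases τ
  · rw [← trop_rho _ hn false hk, ← trop_rho q hn false hk, ← trop_translate _ hn _ 1 hk,
      ← automaton_rho]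
    exact tropO_automaton _ hn hk
  · exact tropO_automaton q hn hk

theorem automaton_mem_levelSet (hn : 3 ≤ n) : automaton q ∈ levelSet q := by
  refine ⟨?_, ?_, fun k hk => ?_⟩
  · simp only [automaton, Finset.sum_sub_distrib, Finset.sum_add_distrib]
    have h1 := sum_shift (fun i => max 0 (q.1 (i - 1) + q.2 (i - 1))) 2
    simp only [show ∀ i : ZMod n, i + 2 - 1 = i + 1 from fun i => by ring] at h1
    linarith
  · simp only [automaton, Finset.sum_sub_distrib, Finset.sum_add_distrib]
    have h1 := sum_shift (fun i => max 0 (q.1 i + q.2 i)) 2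
    have h2 := sum_shift q.2 1
    linarith
  · have := (Finset.mem_Icc.1 hk).2
    exact ⟨trop_automaton q hn true this, trop_automaton q hn false this⟩

theorem iterate_mem_levelSet (hn : 3 ≤ n) (k : ℕ) : automaton^[k] q ∈ levelSet q := by
  induction k with
  | zero => exact ⟨rfl, rfl, fun _ _ => ⟨rfl, rfl⟩⟩
  | succ k ih =>
    rw [Function.iterate_succ_apply']
    obtain ⟨h1, h2, h3⟩ := automaton_mem_levelSet (automaton^[k] q) hn
    obtain ⟨g1, g2, g3⟩ := ih
    exact ⟨h1.trans g1, h2.trans g2, fun j hj =>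
      ⟨(h3 j hj).1.trans (g3 j hj).1, (h3 j hj).2.trans (g3 j hj).2⟩⟩

end Invariance

/-! ### The bracket -/

/-- The log-canonical Poisson bracket of two exponent vectors. -/
noncomputable def omega : Phase n →ₗ[ℝ] Phase n →ₗ[ℝ] ℝ :=
  LinearMap.mk₂ ℝ (fun u v => ∑ i, (u.1 i * v.1 (i + 1) - u.1 (i + 1) * v.1 i -
      u.2 i * v.2 (i + 1) + u.2 (i + 1) * v.2 i))
    (fun a b c => by simp only [← Finset.sum_add_distrib, Prod.fst_add, Prod.snd_add, Pi.add_apply]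
                     exact Finset.sum_congr rfl fun i _ => by ring)
    (fun a b c => by simp only [Finset.mul_sum, Prod.smul_fst, Prod.smul_snd, Pi.smul_apply,
                      smul_eq_mul]
                     exact Finset.sum_congr rfl fun i _ => by ring)
    (fun a b c => by simp only [← Finset.sum_add_distrib, Prod.fst_add, Prod.snd_add, Pi.add_apply]
                     exact Finset.sum_congr rfl fun i _ => by ring)
    (fun a b c => by simp only [Finset.mul_sum, Prod.smul_fst, Prod.smul_snd, Pi.smul_apply,
                      smul_eq_mul]
                     exact Finset.sum_congr rfl fun i _ => by ring)

theorem omega_apply (u v : Phase n) : omega u v = ∑ i, (u.1 i * v.1 (i + 1) - u.1 (i + 1) * v.1 i -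
    u.2 i * v.2 (i + 1) + u.2 (i + 1) * v.2 i) := rfl

theorem omega_swap (u v : Phase n) : omega u v = - omega v u := by
  rw [omega_apply, omega_apply, ← Finset.sum_neg_distrib]
  exact Finset.sum_congr rfl fun i _ => by ring

theorem omega_self (u : Phase n) : omega u u = 0 := by
  have := omega_swap u u
  linarith

theorem omega_rho_rho (u v : Phase n) : omega (rho u) (rho v) = omega u v := by
  rw [omega_apply, omega_apply, ← sum_neg_index, ← sum_shift _ 1]
  simp only [rho, LinearMap.coe_mk, AddHom.coe_mk]
  refine Finset.sum_congr rfl fun i _ => ?_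
  simp only [neg_neg, show -(-(i + 1) + 1) = i by ring]
  ring

/-- The exponent vector of the product of all `x_i` (`true`) or of all `y_i` (`false`). -/
def total (τ : Bool) : Phase n := if τ then (1, 0) else (0, 1)

theorem rho_total (τ : Bool) : rho (total τ : Phase n) = total (!τ) := by
  cases τ <;> rfl

/-- The two totals are Casimirs: each component of the bracket with a constant vector telescopes
round the cycle. -/
theorem omega_total (τ : Bool) (v : Phase n) : omega v (total τ) = 0 := by
  rw [omega_apply]
  cases τ
  · simp only [total, Finset.sum_add_distrib, Finset.sum_sub_distrib]
    simp [sum_shift v.2 1]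
  · simp only [total, Finset.sum_add_distrib, Finset.sum_sub_distrib]
    simp [sum_shift v.1 1]

/-- The contribution of two neighbouring sites to the bracket. -/
def locW (τ τ' : Bool) (a a' b b' : Cell) : ℤ :=
  fx τ a * fx τ' b' - fx τ b * fx τ' a' - fy τ a * fy τ' b' + fy τ b * fy τ' a'

theorem omega_form (τ τ' : Bool) (A B : ZMod n → Cell) :
    omega (form τ A) (form τ' B) =
      ((∑ i, locW τ τ' (A i) (B i) (A (i + 1)) (B (i + 1)) : ℤ) : ℝ) := by
  rw [omega_apply]
  push_cast
  refine Finset.sum_congr rfl fun i _ => ?_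
  simp only [locW, form]
  push_cast
  ring

/-! ### Genericity -/

/-- Different configurations of the same type and length have different values. -/
def Gen (q : Phase n) : Prop :=
  ∀ (τ : Bool) (S S' : ZMod n → Cell), IsConfig S → IsConfig S' → cnt S = cnt S' →
    dot (form τ S) q = dot (form τ S') q → S = S'

theorem Gen.rho {q : Phase n} (h : Gen q) : Gen (rho q) := by
  intro τ S S' hS hS' hc hd
  rw [← refl_refl S, ← refl_refl S', h (!τ) (refl S) (refl S') hS.refl hS'.refl
    (by rw [hS.cnt_refl, hS'.cnt_refl, hc])]
  rw [← dot_form_refl, ← dot_form_refl (!τ)]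
  simpa [refl_refl] using hd

/-- The two new values have the same sum as the two maxima and neither exceeds its maximum, so both
are attained; genericity makes maximizers unique. This rigidity drives all commutation results. -/
theorem Gen.exchange {q : Phase n} (h : Gen q) {τ τ' : Bool} {A B A' B' : ZMod n → Cell}
    (hA : IsOpt τ A q) (hB : IsOpt τ' B q) (hA' : IsConfig A') (hB' : IsConfig B')
    (cA : cnt A' = cnt A) (cB : cnt B' = cnt B)
    (hf : form τ A' + form τ' B' = form τ A + form τ' B) : A' = A ∧ B' = B := by
  have h1 := hA.2 A' hA' cA
  have h2 := hB.2 B' hB' cB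
  have h3 := congrArg (fun v => dot v q) hf
  simp only [map_add, LinearMap.add_apply] at h3
  exact ⟨h τ A' A hA' hA.1 cA (by linarith), h τ' B' B hB' hB.1 cB (by linarith)⟩

/-! ### Cutting the cycle at the common empty sites -/

/-- `i` and `i + k` are consecutive sites with property `P`. -/
structure IsSeg (P : ZMod n → Prop) (i : ZMod n) (k : ℕ) : Prop where
  left : P i
  right : P (i + k)
  pos : 0 < k
  le : k ≤ n
  mid : ∀ t : ℕ, 0 < t → t < k → ¬ P (i + t)

theorem exists_isSeg {P : ZMod n → Prop} {i : ZMod n} (h : P i) : ∃ k, IsSeg P i k := by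
  classical
  have hex : ∃ k : ℕ, 0 < k ∧ P (i + k) := ⟨n, Nat.pos_of_ne_zero (NeZero.ne n), by simpa using h⟩
  refine ⟨Nat.find hex, h, (Nat.find_spec hex).2, (Nat.find_spec hex).1, ?_, ?_⟩
  · exact Nat.find_min' hex ⟨Nat.pos_of_ne_zero (NeZero.ne n), by simpa using h⟩
  · intro t ht hlt hP
    exact Nat.find_min hex hlt ⟨ht, hP⟩

/-- Starting at a site of `P`, one turn round the cycle is a concatenation of segments; strong
induction peels off the first. -/
theorem sum_nonpos_of_segments {P : ZMod n → Prop} {i₀ : ZMod n} (h₀ : P i₀) (g : ZMod n → ℤ)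
    (h : ∀ i k, IsSeg P i k → ∑ t ∈ Finset.range k, g (i + t) ≤ 0) : ∑ i, g i ≤ 0 := by
  have key : ∀ (k : ℕ) (i : ZMod n), P i → P (i + k) → ∑ t ∈ Finset.range k, g (i + t) ≤ 0 := by
    intro k
    induction k using Nat.strong_induction_on with
    | _ k ih =>
      intro i hi hk
      rcases Nat.eq_zero_or_pos k with rfl | hpos
      · simp
      obtain ⟨k₁, hs⟩ := exists_isSeg hi
      have hle : k₁ ≤ k := by
        by_contra hlt
        exact hs.mid k hpos (not_le.1 hlt) hk
      obtain ⟨r, rfl⟩ := Nat.exists_eq_add_of_le hle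
      rw [Finset.sum_range_add]
      have h2 := ih r (by have := hs.pos; omega) (i + k₁) hs.right
        (by simpa [add_assoc] using hk)
      have h1 := h i k₁ hs
      simp only [Nat.cast_add, ← add_assoc] at h2 ⊢
      linarith
  rw [sum_zmod_eq_sum_range g i₀]
  exact key n i₀ h₀ (by simpa using h₀)

theorem sum_ite_val_lt {M : Type*} [AddCommMonoid M] (g : ZMod n → M) (i : ZMod n) {k : ℕ}
    (hk : k ≤ n) :
    (∑ j, if (j - i).val < k then g j else 0) = ∑ t ∈ Finset.range k, g (i + t) := by
  rw [sum_zmod_eq_sum_range _ i]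
  have h : ∀ t ∈ Finset.range n, (if ((i + t : ZMod n) - i).val < k then g (i + t) else 0) =
      if t < k then g (i + t) else 0 := by
    intro t ht
    rw [add_sub_cancel_left, ZMod.val_natCast, Nat.mod_eq_of_lt (Finset.mem_range.1 ht)]
  rw [Finset.sum_congr rfl h, ← Finset.sum_filter]
  congr 1
  ext t
  simp only [Finset.mem_filter, Finset.mem_range]
  omega

/-! ### Splicing two configurations, and the bracket within one type -/

/-- Replace `A` by `B` on the `k` sites from `i` on. -/
def splice (i : ZMod n) (k : ℕ) (A B : ZMod n → Cell) (j : ZMod n) : Cell :=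
  if (j - i).val < k then B j else A j

/-- The site is empty in both configurations. -/
def Both (A B : ZMod n → Cell) (i : ZMod n) : Prop := A i = e ∧ B i = e

theorem Both.symm {A B : ZMod n → Cell} {i : ZMod n} (h : Both A B i) : Both B A i := ⟨h.2, h.1⟩

/-- At both seams `A` and `B` are empty, so a step across a seam is a step already made by `A` or by
`B`. -/
theorem isConfig_splice {A B : ZMod n → Cell} (hA : IsConfig A) (hB : IsConfig B) {i : ZMod n}
    {k : ℕ} (h0 : Both A B i) (hk : Both A B (i + k)) :
    IsConfig (splice i k A B) := by
  intro j
  have hj := hA j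
  have hj' := hB j
  simp only [splice]
  have e1 : j + 1 - i = j - i + 1 := by ring
  rcases val_add_one_cases (j - i) with ⟨h1, h2⟩ | ⟨h1, h2⟩
  · rw [e1, h1]
    split_ifs with c1 c2 c2
    · exact hj'
    · have : j + 1 = i + k := by
        have h3 : (j - i).val + 1 = k := by omega
        rw [← h3]; push_cast; rw [ZMod.natCast_zmod_val]; ring
      rw [this] at hj' ⊢
      rwa [hk.1, ← hk.2]
    · omega
    · exact hj
  · have : j + 1 = i := by
      have : j - i + 1 = 0 := by rwa [ZMod.val_eq_zero] at h1
      linear_combination this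
    rw [e1, h1, this]
    rw [this] at hj hj'
    rw [h0.1] at hj
    rw [h0.2] at hj'
    split_ifs <;> simp only [h0.1, h0.2] <;> assumption

theorem form_splice (τ : Bool) (i : ZMod n) (k : ℕ) (A B : ZMod n → Cell) :
    form τ (splice i k A B) + form τ (splice i k B A) = form τ A + form τ B := by
  refine Prod.ext (funext fun j => ?_) (funext fun j => ?_) <;>
    simp only [form, Prod.fst_add, Prod.snd_add, Pi.add_apply, splice] <;> split_ifs <;> ring

/-- The difference of the numbers of factors on `k` sites. -/
def segD (A B : ZMod n → Cell) (i : ZMod n) (k : ℕ) : ℤ :=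
  ∑ t ∈ Finset.range k, (st (A (i + t)) - st (B (i + t)))

/-- The bracket of two configurations on `k` sites. -/
def segW (A B : ZMod n → Cell) (i : ZMod n) (k : ℕ) : ℤ :=
  ∑ t ∈ Finset.range k,
    locW true true (A (i + t)) (B (i + t)) (A (i + t + 1)) (B (i + t + 1))

theorem cnt_splice {i : ZMod n} {k : ℕ} (hk : k ≤ n) (A B : ZMod n → Cell) :
    cnt (splice i k A B) = cnt A - segD A B i k := by
  rw [segD, ← sum_ite_val_lt (fun j => st (A j) - st (B j)) i hk, cnt, cnt,
    ← Finset.sum_sub_distrib]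
  refine Finset.sum_congr rfl fun j _ => ?_
  simp only [splice]
  split_ifs <;> ring

theorem segD_symm (A B : ZMod n → Cell) (i : ZMod n) (k : ℕ) : segD B A i k = - segD A B i k := by
  simp only [segD, ← Finset.sum_neg_distrib]
  exact Finset.sum_congr rfl fun j _ => by ring

/-- The configuration that comes first, as a sign, for the states behind a common empty site. -/
def lead (b b' : Cell) : ℤ :=
  match b, b' with
  | s, e => 1 | l, e => 1 | e, s => -1 | e, l => -1 | s, l => 1 | l, s => -1 | _, _ => 0

/-- A potential for the number of factors plus the bracket. -/
def potL (b b' : Cell) : ℤ :=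
  match b, b' with
  | s, l => -1 | m, l => -1 | l, s => 1 | l, m => 1 | _, _ => 0

/-- A potential for the number of factors minus the bracket: the configuration that comes last. -/
def potR (b b' : Cell) : ℤ :=
  match b, b' with
  | e, s => -1 | e, l => -1 | e, m => -1 | m, s => -1
  | s, e => 1 | l, e => 1 | m, e => 1 | s, m => 1 | _, _ => 0

/-- Length difference plus bracket is a coboundary except just behind a common empty site; with a
minus sign it is one except just before such a site. Summed over a segment, only one end
contributes. -/
theorem st_add_locW : ∀ a a' b b', Step a b → Step a' b' →
    st b - st b' + locW true true a a' b b' =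
      potL b b' - potL a a' + if a = e ∧ a' = e then lead b b' else 0 := by decide

theorem st_sub_locW : ∀ a a' b b', Step a b → Step a' b' →
    st b - st b' - locW true true a a' b b' =
      potR b b' - potR a a' + if b = e ∧ b' = e then potR a a' else 0 := by decide

theorem abs_lead_le : ∀ a b, |lead a b| ≤ 1 := by decide

section Segments

variable {A B : ZMod n → Cell} (hA : IsConfig A) (hB : IsConfig B)
include hA hB

theorem segD_eq_shift {i : ZMod n} {k : ℕ} (h : IsSeg (Both A B) i k) :
    segD A B i k = ∑ t ∈ Finset.range k, (st (A (i + t + 1)) - st (B (i + t + 1))) := by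
  have h1 := Finset.sum_range_succ (fun t : ℕ => st (A (i + t)) - st (B (i + t))) k
  have h2 := Finset.sum_range_succ' (fun t : ℕ => st (A (i + t)) - st (B (i + t))) k
  rw [h1] at h2
  simp only [h.right.1, h.right.2, Nat.cast_zero, add_zero, h.left.1, h.left.2, sub_self] at h2
  rw [segD, h2]
  refine Finset.sum_congr rfl fun t _ => ?_
  push_cast
  rw [add_assoc]

theorem segD_add_segW {i : ZMod n} {k : ℕ} (h : IsSeg (Both A B) i k) :
    segD A B i k + segW A B i k = lead (A (i + 1)) (B (i + 1)) := by
  rw [segD_eq_shift hA hB h, segW, ← Finset.sum_add_distrib]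
  have h1 : ∀ t ∈ Finset.range k, st (A (i + t + 1)) - st (B (i + t + 1)) +
      locW true true (A (i + t)) (B (i + t)) (A (i + t + 1)) (B (i + t + 1)) =
      (potL (A (i + (t + 1 : ℕ))) (B (i + (t + 1 : ℕ))) - potL (A (i + t)) (B (i + t))) +
        if t = 0 then lead (A (i + 1)) (B (i + 1)) else 0 := by
    intro t ht
    rw [st_add_locW _ _ _ _ (hA _) (hB _)]
    push_cast
    rw [← add_assoc]
    congr 1
    rcases Nat.eq_zero_or_pos t with rfl | hpos
    · simp [h.left.1, h.left.2]
    · rw [if_neg (show ¬ (_ ∧ _) from h.mid t hpos (Finset.mem_range.1 ht)), if_neg hpos.ne']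
  rw [Finset.sum_congr rfl h1, Finset.sum_add_distrib,
    Finset.sum_range_sub (fun t : ℕ => potL (A (i + t)) (B (i + t)))]
  simp [h.right.1, h.right.2, h.left.1, h.left.2, h.pos]

theorem segD_sub_segW {i : ZMod n} {k : ℕ} (h : IsSeg (Both A B) i k) :
    |segD A B i k - segW A B i k| ≤ 1 := by
  rw [segD_eq_shift hA hB h, segW, ← Finset.sum_sub_distrib]
  have h1 : ∀ t ∈ Finset.range k, st (A (i + t + 1)) - st (B (i + t + 1)) -
      locW true true (A (i + t)) (B (i + t)) (A (i + t + 1)) (B (i + t + 1)) =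
      (potR (A (i + (t + 1 : ℕ))) (B (i + (t + 1 : ℕ))) - potR (A (i + t)) (B (i + t))) +
        if t = k - 1 then potR (A (i + t)) (B (i + t)) else 0 := by
    intro t ht
    rw [st_sub_locW _ _ _ _ (hA _) (hB _)]
    push_cast
    rw [← add_assoc]
    congr 1
    have ht' := Finset.mem_range.1 ht
    by_cases hk : t = k - 1
    · have hr := h.right
      rw [show k = t + 1 by omega, Both] at hr
      push_cast at hr
      rw [← add_assoc] at hr
      rw [if_pos hr, if_pos hk]
    · have hm := h.mid (t + 1) (by omega) (by omega)
      rw [Both] at hm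
      push_cast at hm
      rw [← add_assoc] at hm
      rw [if_neg hm, if_neg hk]
  rw [Finset.sum_congr rfl h1, Finset.sum_add_distrib,
    Finset.sum_range_sub (fun t : ℕ => potR (A (i + t)) (B (i + t)))]
  have h2 : ∀ a b, |potR a b| ≤ 1 := by decide
  have h3 : k - 1 < k := by have := h.pos; omega
  simp only [h.right.1, h.right.2, h.left.1, h.left.2, Nat.cast_zero, add_zero, sub_self,
    zero_add, Finset.sum_ite_eq', Finset.mem_range, h3, if_true]
  exact h2 _ _

/-- The integers `segD + segW` and `segD - segW` both have absolute value at most one, so at most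
one of `segD`, `segW` is non-zero. -/
theorem segD_cases {i : ZMod n} {k : ℕ} (h : IsSeg (Both A B) i k) :
    (segD A B i k = 0 ∧ segW A B i k = lead (A (i + 1)) (B (i + 1))) ∨
    ((segD A B i k = 1 ∨ segD A B i k = -1) ∧ segW A B i k = 0) := by
  have h1 := segD_add_segW hA hB h
  have h2 := segD_sub_segW hA hB h
  have h3 := abs_lead_le (A (i + 1)) (B (i + 1))
  rw [abs_le] at h2 h3
  omega

/-- No correction terms occur, so both coboundary identities telescope round the cycle: length
difference plus bracket and minus bracket both vanish. -/
theorem cnt_eq_of_no_both (h : ∀ i, ¬ Both A B i) :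
    cnt A = cnt B ∧ ∑ i, locW true true (A i) (B i) (A (i + 1)) (B (i + 1)) = 0 := by
  have h1 : ∑ i, (st (A (i + 1)) - st (B (i + 1)) +
      locW true true (A i) (B i) (A (i + 1)) (B (i + 1))) =
      ∑ i, (potL (A (i + 1)) (B (i + 1)) - potL (A i) (B i)) := by
    refine Finset.sum_congr rfl fun i _ => ?_
    rw [st_add_locW _ _ _ _ (hA _) (hB _), if_neg (show ¬ (_ ∧ _) from h i), add_zero]
  have h2 : ∑ i, (st (A (i + 1)) - st (B (i + 1)) -
      locW true true (A i) (B i) (A (i + 1)) (B (i + 1))) =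
      ∑ i, (potR (A (i + 1)) (B (i + 1)) - potR (A i) (B i)) := by
    refine Finset.sum_congr rfl fun i _ => ?_
    rw [st_sub_locW _ _ _ _ (hA _) (hB _), if_neg (show ¬ (_ ∧ _) from h (i + 1)), add_zero]
  simp only [Finset.sum_add_distrib, Finset.sum_sub_distrib] at h1 h2
  have s1 := sum_shift (fun i => potL (A i) (B i)) 1
  have s2 := sum_shift (fun i => potR (A i) (B i)) 1
  have s3 := sum_shift (fun i => st (A i)) 1
  have s4 := sum_shift (fun i => st (B i)) 1
  simp only [cnt]
  omega

/-- Concavity: two configurations whose lengths differ by two can be rearranged into two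
different configurations of the intermediate length. -/
theorem exists_intermediate (h : cnt A = cnt B + 2) :
    ∃ C D : ZMod n → Cell, IsConfig C ∧ IsConfig D ∧ C ≠ D ∧ cnt C = cnt B + 1 ∧
      cnt D = cnt B + 1 ∧ ∀ τ, form τ C + form τ D = form τ A + form τ B := by
  have hex : ∃ i, Both A B i := by
    by_contra hno
    push Not at hno
    have := (cnt_eq_of_no_both hA hB hno).1
    omega
  obtain ⟨i₀, h₀⟩ := hex
  -- Some segment must carry a positive part of the total difference 2, and a segment carries at
  -- most 1. Swapping it moves exactly one factor.
  have hseg : ∃ i k, IsSeg (Both A B) i k ∧ 0 < segD A B i k := by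
    by_contra hno
    push Not at hno
    have := sum_nonpos_of_segments h₀ (fun i => st (A i) - st (B i)) hno
    rw [Finset.sum_sub_distrib] at this
    simp only [cnt] at h
    omega
  obtain ⟨i, k, hs, hpos⟩ := hseg
  have hd : segD A B i k = 1 := by
    rcases segD_cases hA hB hs with h1 | h1 <;> omega
  refine ⟨splice i k A B, splice i k B A, isConfig_splice hA hB hs.left hs.right,
    isConfig_splice hB hA hs.left.symm hs.right.symm, ?_, ?_, ?_, fun τ => form_splice _ _ _ _ _⟩
  · intro heq
    have : A = B := by
      funext j
      have := congrFun heq j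
      simp only [splice] at this
      split_ifs at this
      · exact this.symm
      · exact this
    rw [this] at h
    omega
  · rw [cnt_splice hs.le]; omega
  · rw [cnt_splice hs.le, segD_symm]; omega

theorem eq_on_of_splice_eq {i : ZMod n} {k : ℕ} (hs : IsSeg (Both A B) i k)
    (h : splice i k A B = A) : A (i + 1) = B (i + 1) := by
  rcases Nat.lt_or_ge 1 k with h1 | h1
  · have := congrFun h (i + 1)
    have hv : (i + 1 - i).val = 1 := by
      rw [add_sub_cancel_left]
      have := ZMod.val_natCast n 1
      rw [Nat.mod_eq_of_lt (by have := hs.le; omega)] at this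
      exact_mod_cast this
    rw [splice, if_pos (by rw [hv]; exact h1)] at this
    exact this.symm
  · have hk : k = 1 := by have := hs.pos; omega
    have := hs.right
    rw [hk, Nat.cast_one] at this
    rw [this.1, this.2]

end Segments

theorem lead_self : ∀ a, lead a a = 0 := by decide

/-- Segments with different numbers of factors have bracket zero. On one with equal numbers the
splice is a length-preserving exchange, hence trivial; then both configurations leave the common
empty site in the same way and `lead` vanishes. -/
theorem omega_formO_eq_zero {q : Phase n} (hq : Gen q) {A B : ZMod n → Cell}
    (hA : IsOpt true A q) (hB : IsOpt true B q) : omega (form true A) (form true B) = 0 := by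
  rw [omega_form]
  norm_cast
  by_cases hex : ∃ i, Both A B i
  swap
  · push Not at hex
    exact (cnt_eq_of_no_both hA.1 hB.1 hex).2
  obtain ⟨i₀, h₀⟩ := hex
  have key : ∀ i k, IsSeg (Both A B) i k → segW A B i k = 0 := by
    intro i k hs
    rcases segD_cases hA.1 hB.1 hs with ⟨h1, h2⟩ | ⟨_, h2⟩
    swap
    · exact h2
    have hsp := hq.exchange hA hB (isConfig_splice hA.1 hB.1 hs.left hs.right)
      (isConfig_splice hB.1 hA.1 hs.left.symm hs.right.symm)
      (by rw [cnt_splice hs.le, h1, sub_zero]) (by rw [cnt_splice hs.le, segD_symm, h1]; ring)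
      (form_splice _ _ _ _ _)
    rw [h2, eq_on_of_splice_eq hA.1 hB.1 hs hsp.1, lead_self]
  refine le_antisymm ?_ ?_
  · exact sum_nonpos_of_segments h₀ _ fun i k hs => (key i k hs).le
  · have := sum_nonpos_of_segments h₀
      (fun i => - locW true true (A i) (B i) (A (i + 1)) (B (i + 1))) fun i k hs => by
        rw [Finset.sum_neg_distrib]
        exact neg_nonpos.2 (key i k hs).ge
    rw [Finset.sum_neg_distrib] at this
    linarith

/-- Two different configurations of the same length with a common empty site: either they can be
rearranged into configurations of lengths one more and one less, or they can be rearranged into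
configurations of the same length, and then the bracket does not vanish if the
rearrangement stays on the line through them. -/
theorem rearrange_of_both {A B : ZMod n → Cell} (hA : IsConfig A) (hB : IsConfig B)
    (hc : cnt A = cnt B) (hne : A ≠ B) (hex : ∃ i, Both A B i) :
    (∃ C D : ZMod n → Cell, IsConfig C ∧ IsConfig D ∧ cnt C = cnt A + 1 ∧ cnt D = cnt A - 1 ∧
      ∀ τ, form τ C + form τ D = form τ A + form τ B) ∨
    ∃ C D : ZMod n → Cell, IsConfig C ∧ IsConfig D ∧ cnt C = cnt A ∧ cnt D = cnt A ∧ C ≠ A ∧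
      (∀ τ, form τ C + form τ D = form τ A + form τ B) ∧
      ∀ c : ℝ, form true B - form true A = c • (form true C - form true A) →
        omega (form true A) (form true B) ≠ 0 := by
  obtain ⟨i₀, h₀⟩ := hex
  -- If `lead` vanished behind every common empty site, equality would propagate from `i₀` round the
  -- cycle: a non-empty state forces its successor.
  have hlead : ∃ i, Both A B i ∧ lead (A (i + 1)) (B (i + 1)) ≠ 0 := by
    by_contra hno
    push Not at hno
    apply hne
    have key : ∀ t : ℕ, A (i₀ + t) = B (i₀ + t) := by
      intro t
      induction t with
      | zero => simp [h₀.1, h₀.2]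
      | succ t ih =>
        have h1 := hA (i₀ + t)
        have h2 := hB (i₀ + t)
        have h3 := hno (i₀ + t)
        rw [Both] at h3
        push_cast
        rw [← add_assoc]
        rw [← ih] at h2 h3
        revert h1 h2 h3
        generalize A (i₀ + t) = a; generalize A (i₀ + t + 1) = b; generalize B (i₀ + t + 1) = c
        revert a b c; decide
    funext j
    have := key (j - i₀).val
    simpa using this
  obtain ⟨i, hi, hl⟩ := hlead
  obtain ⟨k, hs⟩ := exists_isSeg hi
  have c1 := isConfig_splice hA hB hs.left hs.right
  have c2 := isConfig_splice hB hA hs.left.symm hs.right.symm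
  have n1 := cnt_splice (i := i) hs.le A B
  have n2 := cnt_splice (i := i) hs.le B A
  rw [segD_symm] at n2
  rcases segD_cases hA hB hs with ⟨h1, h2⟩ | ⟨h1 | h1, h2⟩
  · right
    refine ⟨_, _, c1, c2, by rw [n1, h1]; ring, by rw [n2, h1, hc]; ring, ?_,
      fun τ => form_splice _ _ _ _ _, ?_⟩
    · intro heq
      exact hl (by rw [eq_on_of_splice_eq hA hB hs heq, lead_self])
    · intro c hcl
      rw [omega_form]
      norm_cast
      -- `C` agrees with `A` outside the segment, so the line condition makes `A` and `B` have the
      -- same exponents there. The whole bracket then comes from the segment, where it is `lead`.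
      have hout : ∀ j, ¬ (j - i).val < k → cov (A j) = cov (B j) ∧ hd (A j) = hd (B j) := by
        intro j hj
        have e1 := congrFun (congrArg Prod.fst hcl) j
        have e2 := congrFun (congrArg Prod.snd hcl) j
        simp only [form, splice, if_neg hj, Prod.fst_sub, Prod.snd_sub, Prod.smul_fst,
          Prod.smul_snd, Pi.sub_apply, Pi.smul_apply, sub_self, smul_zero, fx, fy] at e1 e2
        rw [sub_eq_zero] at e1 e2
        exact ⟨by exact_mod_cast e1.symm, by exact_mod_cast e2.symm⟩
      have hsum : ∑ j, locW true true (A j) (B j) (A (j + 1)) (B (j + 1)) = segW A B i k := by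
        rw [segW, ← sum_ite_val_lt (fun j => locW true true (A j) (B j) (A (j + 1)) (B (j + 1)))
          i hs.le]
        refine Finset.sum_congr rfl fun j _ => ?_
        split_ifs with hj
        · rfl
        have g1 := hout j hj
        have g2 : cov (A (j + 1)) = cov (B (j + 1)) ∧ hd (A (j + 1)) = hd (B (j + 1)) := by
          by_cases hj1 : (j + 1 - i).val < k
          · have : j + 1 = i := by
              rw [show j + 1 - i = j - i + 1 by ring] at hj1
              rcases val_add_one_cases (j - i) with ⟨a1, a2⟩ | ⟨a1, a2⟩
              · omega
              · have : j - i + 1 = 0 := by rwa [ZMod.val_eq_zero] at a1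
                linear_combination this
            rw [this, hi.1, hi.2]
            exact ⟨rfl, rfl⟩
          · exact hout _ hj1
        simp only [locW, fx, fy, g1.1, g1.2, g2.1, g2.2]
        ring
      rw [hsum, h2]
      exact hl
  · left
    refine ⟨_, _, c2, c1, by rw [n2, h1, hc]; ring, by rw [n1, h1], fun τ => ?_⟩
    rw [add_comm, form_splice]
  · left
    exact ⟨_, _, c1, c2, by rw [n1, h1]; ring, by rw [n2, h1, hc]; ring, fun τ => form_splice _ _ _ _ _⟩

/-! ### The bracket of configurations of different types -/

/-- The pairs of states inside a run of alternating long factors of the two types. -/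
def Inner (a b : Cell) : Prop := (a = l ∧ b = e) ∨ (a = m ∧ b = l) ∨ (a = e ∧ b = m)

/-- The pairs of states in front of a run that is blocked on the left. -/
def Start (a a' : Cell) : Prop := (a = s ∧ a' = l) ∨ (a = e ∧ a' = s)

instance : DecidableRel Inner := fun _ _ => by unfold Inner; infer_instance
instance : DecidableRel Start := fun _ _ => by unfold Start; infer_instance

/-- The sites `j, …, j + t` belong to a run that is blocked on the left by the site `j`. -/
structure IsRun (A B : ZMod n → Cell) (j : ZMod n) (t : ℕ) : Prop where
  start : Start (A j) (B j)
  inner : ∀ u : ℕ, 0 < u → u ≤ t → Inner (A (j + u)) (B (j + u))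
  zero : t = 0 → A j = s

/-- The site belongs to a run that is blocked on the left. -/
def InRun (A B : ZMod n → Cell) (i : ZMod n) : Prop := ∃ j t, i = j + (t : ℕ) ∧ IsRun A B j t

theorem inRun_cases {A B : ZMod n → Cell} {i : ZMod n} (h : InRun A B i) :
    (A i = s ∧ B i = l) ∨ Inner (A i) (B i) := by
  obtain ⟨j, t, rfl, h⟩ := h
  rcases Nat.eq_zero_or_pos t with rfl | ht
  · left
    have h1 := h.zero rfl
    have h2 := h.start
    simp only [Nat.cast_zero, add_zero]
    simpa [Start, h1] using h2
  · exact Or.inr (h.inner t ht le_rfl)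

theorem inRun_of_single {A B : ZMod n → Cell} {i : ZMod n} (h : A i = s ∧ B i = l) :
    InRun A B i :=
  ⟨i, 0, by simp, Or.inl h, fun u h1 h2 => by omega, fun _ => h.1⟩

/-- Membership in a run obeys a recursion along the cycle that looks only at neighbouring states.
This makes it usable as a Boolean in the finite check `locW_le_potM`. -/
theorem inRun_succ {A B : ZMod n → Cell} {i : ZMod n} :
    InRun A B (i + 1) ↔ (A (i + 1) = s ∧ B (i + 1) = l) ∨
      (Inner (A (i + 1)) (B (i + 1)) ∧ (InRun A B i ∨ Start (A i) (B i))) := by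
  constructor
  · intro h
    rcases inRun_cases h with h1 | h1
    · exact Or.inl h1
    right
    refine ⟨h1, ?_⟩
    obtain ⟨j, t, ht, hr⟩ := h
    rcases Nat.eq_zero_or_pos t with rfl | hpos
    · exfalso
      have := hr.start
      simp only [Nat.cast_zero, add_zero] at ht
      rw [← ht] at this
      revert this h1
      generalize A (i + 1) = a; generalize B (i + 1) = b; revert a b; decide
    · obtain ⟨r, rfl⟩ : ∃ r, t = r + 1 := ⟨t - 1, by omega⟩
      have hi : i = j + (r : ℕ) := by
        push_cast at ht
        linear_combination ht
      by_cases hz : r = 0 ∧ A j ≠ s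
      · right
        rw [hi, hz.1, Nat.cast_zero, add_zero]
        exact hr.start
      · left
        refine ⟨j, r, hi, hr.start, fun u h1 h2 => hr.inner u h1 (by omega), fun h0 => ?_⟩
        by_contra hs
        exact hz ⟨h0, hs⟩
  · rintro (h | ⟨h, ⟨j, t, rfl, hr⟩ | h2⟩)
    · exact inRun_of_single h
    · refine ⟨j, t + 1, by push_cast; ring, hr.start, fun u h1 h2 => ?_, fun h0 => by omega⟩
      rcases Nat.lt_or_ge t u with h3 | h3
      · rw [show u = t + 1 by omega]
        push_cast
        rwa [← add_assoc]
      · exact hr.inner u h1 h3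
    · refine ⟨i, 1, by simp, h2, fun u h1 h3 => ?_, fun h0 => by omega⟩
      rw [show u = 1 by omega]
      simpa using h

/-- The states after the exchange, for the configuration of `O`-type. -/
def trA (a a' : Cell) : Cell :=
  match a, a' with
  | s, _ => l | _, l => l | e, m => m | m, e => s | _, _ => e

/-- The states after the exchange, for the configuration of `E`-type. -/
def trB (a a' : Cell) : Cell :=
  match a, a' with
  | e, _ => l | l, _ => m | _, _ => e

/-- The state after the exchange of the last site, for the configuration of `E`-type. -/
def trE (a' : Cell) : Cell := match a' with | m => s | _ => e

/-- A run on `L` sites that is blocked on the left and free on the right. -/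
structure IsWin (A B : ZMod n → Cell) (j : ZMod n) (L : ℕ) : Prop where
  two_le : 2 ≤ L
  le : L ≤ n
  start : Start (A j) (B j)
  inner : ∀ u : ℕ, 0 < u → u + 1 < L → Inner (A (j + u)) (B (j + u))
  last : (A (j + (L - 1 : ℕ)) = e ∧ B (j + (L - 1 : ℕ)) = m ∧ A (j + L) = e) ∨
    (A (j + (L - 1 : ℕ)) = m ∧ B (j + (L - 1 : ℕ)) = e)

/-- The configuration of `O`-type after the exchange. -/
def winA (A B : ZMod n → Cell) (j : ZMod n) (L : ℕ) (i : ZMod n) : Cell :=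
  if (i - j).val < L then trA (A i) (B i) else A i

/-- The configuration of `E`-type after the exchange. -/
def winB (A B : ZMod n → Cell) (j : ZMod n) (L : ℕ) (i : ZMod n) : Cell :=
  if (i - j).val < L then (if (i - j).val + 1 = L then trE (B i) else trB (A i) (B i)) else B i

section Window

variable {A B : ZMod n → Cell} {j : ZMod n} {L : ℕ} (hA : IsConfig A) (hB : IsConfig B)
  (h : IsWin A B j L)
include h

theorem eq_add_val (i j : ZMod n) : i = j + ((i - j).val : ℕ) := by simp

theorem IsWin.before {i : ZMod n} (hi : (i - j).val + 1 < L) :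
    Start (A i) (B i) ∨ Inner (A i) (B i) := by
  rcases Nat.eq_zero_or_pos (i - j).val with h0 | h0
  · left
    have : i = j := by rw [ZMod.val_eq_zero] at h0; linear_combination h0
    rw [this]; exact h.start
  · right
    have := h.inner _ h0 hi
    rwa [← eq_add_val h i j] at this

theorem IsWin.at_last {i : ZMod n} (hi : (i - j).val + 1 = L) :
    (A i = e ∧ B i = m ∧ A (i + 1) = e) ∨ (A i = m ∧ B i = e) := by
  have h1 := h.last
  have e1 : i = j + ((L - 1 : ℕ) : ZMod n) := by
    rw [← hi]; simp
  have e2 : i + 1 = j + (L : ZMod n) := by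
    rw [e1, ← hi]; simp; ring
  rwa [← e1, ← e2] at h1

theorem IsWin.after_start {i : ZMod n} (hi : 0 < (i - j).val) (hi' : (i - j).val + 1 < L) :
    Inner (A i) (B i) := by
  have := h.inner _ hi hi'
  rwa [← eq_add_val h i j] at this

include hA hB

theorem IsWin.isConfig_winA : IsConfig (winA A B j L) := by
  intro i
  have sA := hA i
  have sB := hB i
  simp only [winA]
  have e1 : i + 1 - j = i - j + 1 := by ring
  rcases val_add_one_cases (i - j) with ⟨h1, h2⟩ | ⟨h1, h2⟩
  · rw [e1, h1]
    split_ifs with c1 c2 c2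
    · have b1 := h.before c2
      have b2 : Inner (A (i + 1)) (B (i + 1)) ∨
          ((A (i + 1) = e ∧ B (i + 1) = m) ∨ (A (i + 1) = m ∧ B (i + 1) = e)) := by
        rcases Nat.lt_or_ge ((i - j).val + 1 + 1) L with c3 | c3
        · left
          exact h.after_start (by rw [e1, h1]; omega) (by rw [e1, h1]; exact c3)
        · right
          have := h.at_last (i := i + 1) (by rw [e1, h1]; omega)
          tauto
      revert sA sB b1 b2
      generalize A i = a; generalize B i = a'; generalize A (i + 1) = b; generalize B (i + 1) = b'
      revert a a' b b'; decide
    · have b1 := h.at_last (i := i) (by omega)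
      revert sA sB b1
      generalize A i = a; generalize B i = a'; generalize A (i + 1) = b; generalize B (i + 1) = b'
      revert a a' b b'; decide
    · omega
    · exact sA
  · have hj : i + 1 = j := by
      have : i - j + 1 = 0 := by rwa [ZMod.val_eq_zero] at h1
      linear_combination this
    have b0 := h.start
    have hL := h.two_le
    rw [hj] at sA sB ⊢
    rw [sub_self, ZMod.val_zero, if_pos (show 0 < L by omega)]
    split_ifs with c1
    · have b1 := h.at_last (i := i) (by have := h.le; omega)
      rw [hj] at b1
      revert sA sB b1 b0
      generalize A i = a; generalize B i = a'; generalize A j = b; generalize B j = b'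
      revert a a' b b'; decide
    · revert sA sB b0
      generalize A i = a; generalize B i = a'; generalize A j = b; generalize B j = b'
      revert a a' b b'; decide

theorem IsWin.isConfig_winB : IsConfig (winB A B j L) := by
  intro i
  have sA := hA i
  have sB := hB i
  simp only [winB]
  have e1 : i + 1 - j = i - j + 1 := by ring
  rcases val_add_one_cases (i - j) with ⟨h1, h2⟩ | ⟨h1, h2⟩
  · rw [e1, h1]
    by_cases c2 : (i - j).val + 1 < L
    · have b1 := h.before c2
      rw [if_pos (show (i - j).val < L by omega), if_neg c2.ne, if_pos c2]
      split_ifs with c3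
      · have b2 := h.at_last (i := i + 1) (by rw [e1, h1]; omega)
        have b3 : (A (i + 1) = e ∧ B (i + 1) = m) ∨ (A (i + 1) = m ∧ B (i + 1) = e) := by tauto
        revert sA sB b1 b3
        generalize A i = a; generalize B i = a'; generalize A (i + 1) = b
        generalize B (i + 1) = b'
        revert a a' b b'; decide
      · have b2 := h.after_start (i := i + 1) (by rw [e1, h1]; omega) (by rw [e1, h1]; omega)
        revert sA sB b1 b2
        generalize A i = a; generalize B i = a'; generalize A (i + 1) = b
        generalize B (i + 1) = b'
        revert a a' b b'; decide
    · rw [if_neg c2]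
      split_ifs with c1 c3
      · have b1 := h.at_last (i := i) (by omega)
        revert sA sB b1
        generalize A i = a; generalize B i = a'; generalize A (i + 1) = b
        generalize B (i + 1) = b'
        revert a a' b b'; decide
      · omega
      · exact sB
  · have hj : i + 1 = j := by
      have : i - j + 1 = 0 := by rwa [ZMod.val_eq_zero] at h1
      linear_combination this
    have b0 := h.start
    have hL := h.two_le
    rw [hj] at sA sB ⊢
    rw [sub_self, ZMod.val_zero, if_pos (show 0 < L by omega), if_neg (show ¬ 0 + 1 = L by omega)]
    split_ifs with c1 c3
    · have b1 := h.at_last (i := i) (by have := h.le; omega)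
      rw [hj] at b1
      revert sA sB b1 b0
      generalize A i = a; generalize B i = a'; generalize A j = b; generalize B j = b'
      revert a a' b b'; decide
    · have := h.le
      omega
    · revert sA sB b0
      generalize A i = a; generalize B i = a'; generalize A j = b; generalize B j = b'
      revert a a' b b'; decide

theorem IsWin.form_win :
    form true (winA A B j L) + form false (winB A B j L) = form true A + form false B := by
  have key : ∀ i, fx true (winA A B j L i) + fx false (winB A B j L i) =
      fx true (A i) + fx false (B i) ∧ fy true (winA A B j L i) + fy false (winB A B j L i) =
      fy true (A i) + fy false (B i) := by
    intro i
    simp only [winA, winB]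
    split_ifs with c1 c2
    · have b1 := h.at_last (i := i) c2
      have b2 : (A i = e ∧ B i = m) ∨ (A i = m ∧ B i = e) := by tauto
      revert b2
      generalize A i = a; generalize B i = a'
      revert a a'; decide
    · have b1 := h.before (i := i) (by omega)
      revert b1
      generalize A i = a; generalize B i = a'
      revert a a'; decide
    · exact ⟨rfl, rfl⟩
  refine Prod.ext (funext fun i => ?_) (funext fun i => ?_) <;>
    simp only [form, Prod.fst_add, Prod.snd_add, Pi.add_apply]
  · exact_mod_cast (key i).1
  · exact_mod_cast (key i).2

omit hA hB h in
/-- Long factors do not cross the boundary of the window. -/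
theorem sum_window_eq_zero {S : ZMod n → Cell} (hS : IsConfig S) (h0 : S j ≠ m)
    (hlast : ∀ i : ZMod n, (i - j).val + 1 = L → S i ≠ l) :
    (∑ i, if (i - j).val < L then tl (S i) - hd (S i) else 0) = 0 := by
  have h1 : (∑ i, if (i - j).val < L then hd (S i) else 0) =
      ∑ i, if (i - j).val < L then tl (S i) else 0 := by
    rw [← sum_shift (fun i => if (i - j).val < L then tl (S i) else 0) 1]
    refine Finset.sum_congr rfl fun i _ => ?_
    have hs := hS i
    have hv : tl (S (i + 1)) = hd (S i) := by
      revert hs; generalize S i = a; generalize S (i + 1) = b; revert a b; decide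
    rw [hv]
    by_cases hl : S i = l
    swap
    · have : hd (S i) = 0 := by
        revert hl; generalize S i = a; revert a; decide
      simp [this]
    have e1 : i + 1 - j = i - j + 1 := by ring
    rcases val_add_one_cases (i - j) with ⟨g1, g2⟩ | ⟨g1, g2⟩
    · rw [e1, g1]
      have := hlast i
      by_cases c : (i - j).val + 1 = L
      · exact absurd hl (this c)
      · congr 1
        apply propext
        omega
    · exfalso
      have hj : i + 1 = j := by
        have : i - j + 1 = 0 := by rwa [ZMod.val_eq_zero] at g1
        linear_combination this
      rw [hj, hl] at hs
      exact h0 hs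
  have h2 : (∑ i, if (i - j).val < L then tl (S i) - hd (S i) else 0) =
      (∑ i, if (i - j).val < L then tl (S i) else 0) -
      ∑ i, if (i - j).val < L then hd (S i) else 0 := by
    rw [← Finset.sum_sub_distrib]
    refine Finset.sum_congr rfl fun i _ => ?_
    split_ifs <;> simp
  rw [h2, h1, sub_self]

theorem IsWin.cnt_winA : cnt (winA A B j L) = cnt A := by
  have h1 := sum_window_eq_zero (j := j) (L := L) hA
    (by have := h.start; revert this; generalize A j = a; generalize B j = b; revert a b; decide)
    (fun i hi => by rcases h.at_last hi with g | g <;> simp [g.1])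
  -- At each site of the window the exchange changes the count by tail minus head of `A`; adding
  -- this vanishing sum reduces the claim to single sites.
  rw [cnt, cnt, ← add_zero (∑ i, st (A i)), ← h1, ← Finset.sum_add_distrib]
  refine Finset.sum_congr rfl fun i _ => ?_
  simp only [winA]
  split_ifs with c1
  · have b : Start (A i) (B i) ∨ Inner (A i) (B i) ∨ (A i = e ∧ B i = m) ∨ (A i = m ∧ B i = e) := by
      by_cases c2 : (i - j).val + 1 = L
      · have := h.at_last c2; tauto
      · have := h.before (i := i) (by omega); tauto
    revert b; generalize A i = a; generalize B i = b; revert a b; decide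
  · ring

theorem IsWin.cnt_winB : cnt (winB A B j L) = cnt B := by
  have h1 := sum_window_eq_zero (j := j) (L := L) hB
    (by have := h.start; revert this; generalize A j = a; generalize B j = b; revert a b; decide)
    (fun i hi => by rcases h.at_last hi with g | g <;> simp [g.2])
  rw [cnt, cnt, ← add_zero (∑ i, st (B i)), ← h1, ← Finset.sum_add_distrib]
  refine Finset.sum_congr rfl fun i _ => ?_
  simp only [winB]
  split_ifs with c1 c2
  · have b : (A i = e ∧ B i = m) ∨ (A i = m ∧ B i = e) := by
      have := h.at_last c2; tauto
    revert b; generalize A i = a; generalize B i = b; revert a b; decide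
  · have b := h.before (i := i) (by omega)
    revert b; generalize A i = a; generalize B i = b; revert a b; decide
  · ring

theorem IsWin.ne : ¬ (winA A B j L = A ∧ winB A B j L = B) := by
  rintro ⟨h1, h2⟩
  have g1 := congrFun h1 j
  have g2 := congrFun h2 j
  have hL := h.two_le
  simp only [winA, winB, sub_self, ZMod.val_zero, if_pos (show 0 < L by omega),
    if_neg (show ¬ 0 + 1 = L by omega)] at g1 g2
  have b := h.start
  revert b g1 g2; generalize A j = a; generalize B j = b; revert a b; decide

end Window

theorem IsRun.isWin {A B : ZMod n → Cell} (hA : IsConfig A) {j : ZMod n} {t : ℕ}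
    (h : IsRun A B j t)
    (ho : (A (j + t) = e ∧ B (j + t) = m ∧ A (j + t + 1) = e) ∨
      (A (j + t) = l ∧ B (j + t) = e ∧ B (j + t + 1) = e)) :
    ∃ L, IsWin A B j L := by
  have hst : ¬ Inner (A j) (B j) ∧ ¬ (A j = m ∧ B j = e) ∧ ¬ (A j = l ∧ B j = e) := by
    have := h.start
    revert this; generalize A j = a; generalize B j = b; revert a b; decide
  have hpos : 0 < t := by
    rcases Nat.eq_zero_or_pos t with rfl | ht
    · exfalso
      simp only [Nat.cast_zero, add_zero] at ho
      have h1 : ¬ (A j = e ∧ B j = m) := fun hh => hst.1 (Or.inr (Or.inr hh))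
      tauto
    · exact ht
  have hlt : t < n := by
    by_contra hge
    have := h.inner n (Nat.pos_of_ne_zero (NeZero.ne n)) (not_lt.1 hge)
    simp only [CharP.cast_eq_zero, add_zero] at this
    exact hst.1 this
  -- In the first case the run itself ends the window, giving length `t + 1`; in the second the tail
  -- behind its last head must be included, giving `t + 2`.
  rcases ho with ho | ho
  · refine ⟨t + 1, by omega, by omega, h.start, fun u h1 h2 => h.inner u h1 (by omega), Or.inl ?_⟩
    simpa [add_assoc] using ho
  · have hm : A (j + t + 1) = m := by
      have := hA (j + t)
      rw [ho.1] at this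
      exact this
    refine ⟨t + 2, by omega, ?_, h.start, fun u h1 h2 => h.inner u h1 (by omega), Or.inr ?_⟩
    · by_contra hgt
      have hn : t + 1 = n := by omega
      have e1 : j + (t : ZMod n) + 1 = j := by
        have : ((t + 1 : ℕ) : ZMod n) = 0 := by rw [hn]; simp
        push_cast at this
        linear_combination this
      rw [e1] at hm ho
      exact hst.2.1 ⟨hm, ho.2.2⟩
    · simpa [add_assoc] using And.intro hm ho.2.2

open Classical in
/-- A potential that bounds the bracket of configurations of different types. -/
noncomputable def potM (f : Prop) (b b' : Cell) : ℤ :=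
  (if f then 1 else 0) + (if b = l ∧ b' = m then 1 else 0) - (if b = m ∧ b' = l then 1 else 0) -
    (if b = s ∧ b' = l then 1 else 0)

-- Unless a run ends freely at this step, the bracket contribution is at most the increment of the
-- potential. The Booleans `f`, `f'` stand for membership of the two sites in a run.
set_option synthInstance.maxSize 1000 in
set_option maxRecDepth 10000 in
theorem locW_le_potM : ∀ (a a' b b' : Cell) (f f' : Bool), Step a b → Step a' b' →
    (f = true → (a = s ∧ a' = l) ∨ Inner a a') → ((a = s ∧ a' = l) → f = true) →
    (f' = true ↔ ((b = s ∧ b' = l) ∨ (Inner b b' ∧ (f = true ∨ Start a a')))) →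
    ¬ (f = true ∧ ((a = e ∧ a' = m ∧ b = e) ∨ (a = l ∧ a' = e ∧ b' = e))) →
    locW true false a a' b b' ≤
      ((if f' = true then 1 else 0) + (if b = l ∧ b' = m then 1 else 0) -
        (if b = m ∧ b' = l then 1 else 0) - (if b = s ∧ b' = l then 1 else 0)) -
      ((if f = true then 1 else 0) + (if a = l ∧ a' = m then 1 else 0) -
        (if a = m ∧ a' = l then 1 else 0) - (if a = s ∧ a' = l then 1 else 0)) := by
  decide

/-- Without a window no run ends freely, so every contribution is bounded by an increment of `potM`,
and these sum to zero round the cycle. -/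
theorem exists_isWin_of_pos {A B : ZMod n → Cell} (hA : IsConfig A) (hB : IsConfig B)
    (h : 0 < ∑ i, locW true false (A i) (B i) (A (i + 1)) (B (i + 1))) :
    ∃ j L, IsWin A B j L := by
  classical
  by_contra hno
  have hopen : ∀ i, ¬ (InRun A B i ∧ ((A i = e ∧ B i = m ∧ A (i + 1) = e) ∨
      (A i = l ∧ B i = e ∧ B (i + 1) = e))) := by
    rintro i ⟨⟨j, t, rfl, hr⟩, ho⟩
    obtain ⟨L, hL⟩ := hr.isWin hA ho
    exact hno ⟨j, L, hL⟩
  have hle : ∀ i, locW true false (A i) (B i) (A (i + 1)) (B (i + 1)) ≤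
      potM (InRun A B (i + 1)) (A (i + 1)) (B (i + 1)) - potM (InRun A B i) (A i) (B i) := by
    intro i
    have := locW_le_potM (A i) (B i) (A (i + 1)) (B (i + 1)) (decide (InRun A B i))
      (decide (InRun A B (i + 1))) (hA i) (hB i)
    simp only [decide_eq_true_eq] at this
    have := this inRun_cases inRun_of_single inRun_succ (hopen i)
    simp only [potM]
    convert this using 2
  have h1 := Finset.sum_le_sum fun i (_ : i ∈ Finset.univ) => hle i
  rw [Finset.sum_sub_distrib, sum_shift (fun i => potM (InRun A B i) (A i) (B i)) 1, sub_self] at h1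
  omega

theorem sum_locW_nonpos {q : Phase n} (hq : Gen q) {A B : ZMod n → Cell}
    (hA : IsOpt true A q) (hB : IsOpt false B q) :
    omega (form true A) (form false B) ≤ 0 := by
  rw [omega_form]
  by_contra hpos
  have hpos' : 0 < ∑ i, locW true false (A i) (B i) (A (i + 1)) (B (i + 1)) := by
    exact_mod_cast not_le.1 hpos
  obtain ⟨j, L, h⟩ := exists_isWin_of_pos hA.1 hB.1 hpos'
  exact h.ne hA.1 hB.1 (hq.exchange hA hB (h.isConfig_winA hA.1 hB.1) (h.isConfig_winB hA.1 hB.1)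
    (h.cnt_winA hA.1 hB.1) (h.cnt_winB hA.1 hB.1) (h.form_win hA.1 hB.1))

/-- An exchange in a window excludes positive brackets only. Reflection preserves `omega` but
interchanges the roles of the two types, and antisymmetry turns this into the opposite inequality.
-/
theorem omega_form_mixed {q : Phase n} (hq : Gen q) {A B : ZMod n → Cell}
    (hA : IsOpt true A q) (hB : IsOpt false B q) :
    omega (form true A) (form false B) = 0 := by
  refine le_antisymm (sum_locW_nonpos hq hA hB) ?_
  have h := sum_locW_nonpos hq.rho hB.refl hA.refl
  have e1 := form_refl false B
  have e2 := form_refl true A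
  simp only [Bool.not_false, Bool.not_true] at h e1 e2
  rw [e1, e2, omega_rho_rho, omega_swap] at h
  linarith

/-- At a generic point the optimal configurations commute. -/
theorem omega_form_eq_zero {q : Phase n} (hq : Gen q) {τ τ' : Bool} {A B : ZMod n → Cell}
    (hA : IsOpt τ A q) (hB : IsOpt τ' B q) : omega (form τ A) (form τ' B) = 0 := by
  cases τ <;> cases τ'
  · have := omega_formO_eq_zero hq.rho hA.refl hB.refl
    have e1 := form_refl false A
    have e2 := form_refl false B
    simp only [Bool.not_false] at e1 e2
    rwa [e1, e2, omega_rho_rho] at this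
  · rw [omega_swap, omega_form_mixed hq hB hA, neg_zero]
  · exact omega_form_mixed hq hA hB
  · exact omega_formO_eq_zero hq hA hB

/-! ### Configurations without common empty sites -/

/-- The pairs of states of two configurations without common empty sites. -/
def Tight (a a' : Cell) : Prop :=
  (a = e ∧ a' ≠ e) ∨ (a ≠ e ∧ a' = e) ∨ (a = m ∧ a' = l) ∨ (a = l ∧ a' = m)

instance : DecidableRel Tight := fun _ _ => by unfold Tight; infer_instance

/-- The state obtained from two configurations without common empty sites, as a function of the
states of two neighbouring sites. -/
def merge (a a' b b' : Cell) : Cell :=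
  if (a = m ∧ a' = l) ∨ (a = l ∧ a' = m) then m
  else if (b = m ∧ b' = l) ∨ (b = l ∧ b' = m) then l
  else if a = l ∨ a' = l then s else e

theorem step_merge : ∀ a a', Tight a a' → ∀ b b', Tight b b' → Step a b → Step a' b' →
    ∀ c c', Tight c c' → Step b c → Step b' c' → Step (merge a a' b b') (merge b b' c c') := by
  decide

theorem merge_identities : ∀ a a', Tight a a' → ∀ b b', Tight b b' → Step a b → Step a' b' →
    fx true a + fx true a' = 1 + fx false (merge a a' b b') ∧
    fy true a + fy true a' = fy false (merge a a' b b') ∧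
    st a + st a' + st (merge a a' b b') = 1 + (hd a - tl a) + (hd a' - tl a') := by
  decide

theorem tight_of_not_both : ∀ b b', ¬ (b = e ∧ b' = e) → ∀ a, Step a b → ∀ a', Step a' b' →
    ¬ (a = e ∧ a' = e) → ∀ c, Step b c → ∀ c', Step b' c' → ¬ (c = e ∧ c' = e) → Tight b b' := by
  decide

theorem sum_hd_sub_tl {S : ZMod n → Cell} (hS : IsConfig S) : ∑ i, (hd (S i) - tl (S i)) = 0 := by
  have h := sum_tl_eq_sum_hd hS fun _ => (1 : ℤ)
  have h1 : ∑ i, hd (S i) = ∑ i, if S i = l then 1 else 0 :=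
    Finset.sum_congr rfl fun i _ => by generalize S i = a; revert a; decide
  have h2 : ∑ i, tl (S i) = ∑ i, if S i = m then 1 else 0 :=
    Finset.sum_congr rfl fun i _ => by generalize S i = a; revert a; decide
  rw [Finset.sum_sub_distrib, h1, h2, h, sub_self]

/-- Every site is covered, so the product of the two monomials is divisible by all `x_i`. The
quotient has its `y` at the heads of long factors and an extra `x` at the overlaps of a head with a
tail: this is an E-monomial. -/
theorem exists_merge_O {A B : ZMod n → Cell} (hA : IsConfig A) (hB : IsConfig B)
    (hno : ∀ i, ¬ Both A B i) :
    ∃ C : ZMod n → Cell, IsConfig C ∧ cnt C + 2 * cnt A = n ∧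
      form true A + form true B = total true + form false C := by
  have ht : ∀ i, Tight (A i) (B i) := by
    intro i
    have h1 := hA (i - 1)
    have h2 := hB (i - 1)
    rw [sub_add_cancel] at h1 h2
    exact tight_of_not_both _ _ (hno _) _ h1 _ h2 (hno _) _ (hA i) _ (hB i) (hno _)
  have hid := fun i => merge_identities _ _ (ht i) _ _ (ht (i + 1)) (hA i) (hB i)
  refine ⟨fun i => merge (A i) (B i) (A (i + 1)) (B (i + 1)), fun i =>
    step_merge _ _ (ht i) _ _ (ht (i + 1)) (hA i) (hB i) _ _ (ht _) (hA _) (hB _), ?_, ?_⟩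
  · have h1 := Finset.sum_congr (s₁ := Finset.univ) rfl fun i _ => (hid i).2.2
    simp only [Finset.sum_add_distrib] at h1
    rw [sum_hd_sub_tl hA, sum_hd_sub_tl hB] at h1
    have h2 := (cnt_eq_of_no_both hA hB hno).1
    simp only [cnt] at h2 ⊢
    simp only [Finset.sum_const, Finset.card_univ, ZMod.card, nsmul_eq_mul, mul_one] at h1
    linarith
  · refine Prod.ext (funext fun i => ?_) (funext fun i => ?_)
    · have := (hid i).1
      simp only [form, total, if_true, Prod.fst_add, Pi.add_apply, Pi.one_apply]
      exact_mod_cast this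
    · have := (hid i).2.1
      simp only [form, total, if_true, Prod.snd_add, Pi.add_apply, Pi.zero_apply, zero_add]
      exact_mod_cast this

/-! ### Splitting the filled complement by two colours -/

/-- Whether a factor starts at a site with state `b` behind a site with state `a`, when the
complement is filled. -/
def opens (a b : Cell) : Bool := decide (b ≠ e ∨ a = e)

/-- The number of factors up to a site, modulo two. -/
def parity (C : ZMod n → Cell) : ℕ → Bool
  | 0 => opens (C (-1)) (C 0)
  | t + 1 => xor (parity C t) (opens (C t) (C (t + 1 : ℕ)))

/-- The state at a site of the factors of one colour. -/
def colour (γ : Bool) (a b : Cell) (c d : Bool) : Cell :=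
  if a ≠ e ∧ c = γ then m else if opens a b ∧ d = γ then (if b ≠ e then l else s) else e

theorem step_colour : ∀ (γ c : Bool) (x y z : Cell), Step x y → Step y z →
    Step (colour γ x y c (xor c (opens x y)))
      (colour γ y z (xor c (opens x y)) (xor (xor c (opens x y)) (opens y z))) := by decide

theorem colour_identities : ∀ (c : Bool) (x y : Cell), Step x y →
    fx true (colour true x y c (xor c (opens x y))) +
      fx true (colour false x y c (xor c (opens x y))) = 1 + fx false y ∧
    fy true (colour true x y c (xor c (opens x y))) +
      fy true (colour false x y c (xor c (opens x y))) = fy false y ∧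
    ¬ (colour true x y c (xor c (opens x y)) = e ∧ colour false x y c (xor c (opens x y)) = e) ∧
    colour true x y c (xor c (opens x y)) ≠ colour false x y c (xor c (opens x y)) ∧
    st (colour true x y c (xor c (opens x y))) + st (colour false x y c (xor c (opens x y))) =
      if opens x y then 1 else 0 := by decide

theorem parity_eq (C : ZMod n → Cell) (t : ℕ) :
    parity C t = decide ((∑ r ∈ Finset.range (t + 1),
      if opens (C ((r : ZMod n) - 1)) (C r) then 1 else 0) % 2 = 1) := by
  induction t with
  | zero =>
    rw [zero_add, Finset.sum_range_one, parity]
    simp only [Nat.cast_zero, zero_sub]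
    cases opens (C (-1)) (C 0) <;> simp
  | succ t ih =>
    rw [Finset.sum_range_succ, parity, ih]
    simp only [Nat.cast_add, Nat.cast_one, add_sub_cancel_right]
    generalize (∑ r ∈ Finset.range (t + 1), if opens (C ((r : ZMod n) - 1)) (C r) then 1 else 0) = N
    rcases Nat.mod_two_eq_zero_or_one N with h | h <;>
      cases opens (C t) (C (t + 1)) <;> simp [Nat.add_mod, h]

/-- In the filled complement a factor opens at every site except those just behind a factor of `C`.
-/
theorem sum_opens {C : ZMod n → Cell} (hC : IsConfig C) :
    (∑ i, if opens (C (i - 1)) (C i) then 1 else 0) + cnt C = n := by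
  have h1 : cnt C = ∑ i, if C (i - 1) = s ∨ C (i - 1) = m then 1 else 0 := by
    rw [hC.cnt_eq_sum_tl, ← Finset.sum_add_distrib,
      ← sum_shift (fun i => if C (i - 1) = s ∨ C (i - 1) = m then (1 : ℤ) else 0) 1]
    refine Finset.sum_congr rfl fun i _ => ?_
    rw [add_sub_cancel_right]
    generalize C i = a; revert a; decide
  rw [h1, ← Finset.sum_add_distrib]
  have h2 : ∀ i ∈ (Finset.univ : Finset (ZMod n)),
      ((if opens (C (i - 1)) (C i) then (1 : ℤ) else 0) +
        if C (i - 1) = s ∨ C (i - 1) = m then 1 else 0) = 1 := by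
    intro i _
    have := hC (i - 1)
    rw [sub_add_cancel] at this
    revert this; generalize C (i - 1) = a; generalize C i = b; revert a b; decide
  rw [Finset.sum_congr rfl h2]
  simp [ZMod.card]

/-- The filled complement of a configuration falls into two configurations of equal length. -/
theorem exists_split_O {C : ZMod n → Cell} (hC : IsConfig C) {k : ℤ} (hk : cnt C + 2 * k = n) :
    ∃ A B : ZMod n → Cell, IsConfig A ∧ IsConfig B ∧ A ≠ B ∧ cnt A = k ∧ cnt B = k ∧
      form true A + form true B = total true + form false C := by
  set c : ZMod n → Bool := fun i => parity C i.val with hc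
  have hn1 : n - 1 + 1 = n := Nat.succ_pred_eq_of_ne_zero (NeZero.ne n)
  have hrec : ∀ i, c (i + 1) = xor (c i) (opens (C i) (C (i + 1))) := by
    intro i
    simp only [c]
    rcases val_add_one_cases i with ⟨h1, h2⟩ | ⟨h1, h2⟩
    · rw [h1, parity]
      simp
    · have hi : i + 1 = 0 := by rwa [ZMod.val_eq_zero] at h1
      have hi' : i = -1 := by linear_combination hi
      -- The alternating colouring must close up after one turn. It does because the number of
      -- factors is `n - cnt C = 2k`, which is even.
      have hev : parity C i.val = false := by
        rw [parity_eq, h2]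
        have h3 := sum_opens hC
        rw [sum_zmod_eq_sum_range _ 0] at h3
        simp only [zero_add] at h3
        have h4 : ((∑ r ∈ Finset.range n,
            if opens (C ((r : ZMod n) - 1)) (C r) then 1 else 0 : ℕ) : ℤ) = 2 * k := by
          push_cast
          linarith
        simp only [decide_eq_false_iff_not]
        omega
      rw [h1, hev, hi, hi', parity, Bool.false_xor]
  have hrec' : ∀ i, c i = xor (c (i - 1)) (opens (C (i - 1)) (C i)) := by
    intro i
    have := hrec (i - 1)
    rwa [sub_add_cancel] at this
  have hs : ∀ i, Step (C (i - 1)) (C i) := by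
    intro i
    have := hC (i - 1)
    rwa [sub_add_cancel] at this
  let F : Bool → ZMod n → Cell := fun γ i => colour γ (C (i - 1)) (C i) (c (i - 1)) (c i)
  have hid : ∀ i, _ := fun i => colour_identities (c (i - 1)) (C (i - 1)) (C i) (hs i)
  simp only [← hrec'] at hid
  have hF : ∀ γ, IsConfig (F γ) := by
    intro γ i
    have := step_colour γ (c (i - 1)) (C (i - 1)) (C i) (C (i + 1)) (hs i) (hC i)
    rw [← hrec', ← hrec] at this
    simp only [F, add_sub_cancel_right]
    exact this
  have hcnt := (cnt_eq_of_no_both (hF true) (hF false) fun i => (hid i).2.2.1).1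
  have hsum : cnt (F true) + cnt (F false) = 2 * k := by
    have h3 := sum_opens hC
    have h4 : cnt (F true) + cnt (F false) = ∑ i, if opens (C (i - 1)) (C i) then 1 else 0 := by
      rw [cnt, cnt, ← Finset.sum_add_distrib]
      exact Finset.sum_congr rfl fun i _ => (hid i).2.2.2.2
    rw [h4]
    linarith
  refine ⟨F true, F false, hF true, hF false, ?_, by omega, by omega, ?_⟩
  · intro h
    exact (hid 0).2.2.2.1 (congrFun h 0)
  · refine Prod.ext (funext fun i => ?_) (funext fun i => ?_)
    · have := (hid i).1
      simp only [form, total, if_true, Prod.fst_add, Pi.add_apply, Pi.one_apply, F]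
      exact_mod_cast this
    · have := (hid i).2.1
      simp only [form, total, if_true, Prod.snd_add, Pi.add_apply, Pi.zero_apply, zero_add, F]
      exact_mod_cast this

/-! ### Both types -/

theorem form_eq_rho (τ : Bool) (S : ZMod n → Cell) : form τ S = rho (form (!τ) (refl S)) := by
  rw [form_refl, rho_rho]

theorem both_refl {A B : ZMod n → Cell} {i : ZMod n} : Both (refl A) (refl B) i ↔ Both A B (-i) := by
  have h : ∀ a, rev a = e ↔ a = e := by decide
  simp only [Both, refl, h]

theorem refl_injective {A B : ZMod n → Cell} (h : refl A = refl B) : A = B := by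
  rw [← refl_refl A, h, refl_refl]

theorem exists_merge (τ : Bool) {A B : ZMod n → Cell} (hA : IsConfig A) (hB : IsConfig B)
    (hno : ∀ i, ¬ Both A B i) :
    ∃ C : ZMod n → Cell, IsConfig C ∧ cnt C + 2 * cnt A = n ∧
      form τ A + form τ B = total τ + form (!τ) C := by
  cases τ
  · obtain ⟨C, h1, h2, h3⟩ := exists_merge_O hA.refl hB.refl fun i hi => hno _ (both_refl.1 hi)
    refine ⟨refl C, h1.refl, by rw [h1.cnt_refl, ← h2, hA.cnt_refl], ?_⟩
    have := congrArg rho h3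
    rw [map_add, map_add, rho_total] at this
    rw [form_eq_rho false A, form_eq_rho false B, form_eq_rho _ (refl C), refl_refl]
    exact this
  · exact exists_merge_O hA hB hno

theorem exists_split (τ : Bool) {C : ZMod n → Cell} (hC : IsConfig C) {k : ℤ}
    (hk : cnt C + 2 * k = n) :
    ∃ A B : ZMod n → Cell, IsConfig A ∧ IsConfig B ∧ A ≠ B ∧ cnt A = k ∧ cnt B = k ∧
      form τ A + form τ B = total τ + form (!τ) C := by
  cases τ
  · obtain ⟨A, B, h1, h2, h3, h4, h5, h6⟩ := exists_split_O hC.refl (k := k)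
      (by rw [hC.cnt_refl, hk])
    refine ⟨refl A, refl B, h1.refl, h2.refl, fun h => h3 (refl_injective h),
      by rw [h1.cnt_refl, h4], by rw [h2.cnt_refl, h5], ?_⟩
    have := congrArg rho h6
    rw [map_add, map_add, rho_total] at this
    rw [form_eq_rho false (refl A), form_eq_rho false (refl B), form_eq_rho _ C, refl_refl,
      refl_refl]
    exact this
  · exact exists_split_O hC hk

/-- How two different configurations of the same length can be rearranged. -/
theorem rearrange (τ : Bool) {A B : ZMod n → Cell} (hA : IsConfig A) (hB : IsConfig B)
    (hc : cnt A = cnt B) (hne : A ≠ B) :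
    (∃ C : ZMod n → Cell, IsConfig C ∧ cnt C + 2 * cnt A = n ∧
      form τ A + form τ B = total τ + form (!τ) C) ∨
    (∃ C D : ZMod n → Cell, IsConfig C ∧ IsConfig D ∧ cnt C = cnt A + 1 ∧ cnt D = cnt A - 1 ∧
      form τ C + form τ D = form τ A + form τ B) ∨
    ∃ C D : ZMod n → Cell, IsConfig C ∧ IsConfig D ∧ cnt C = cnt A ∧ cnt D = cnt A ∧ C ≠ A ∧
      form τ C + form τ D = form τ A + form τ B ∧
      ∀ c : ℝ, form τ B - form τ A = c • (form τ C - form τ A) →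
        omega (form τ A) (form τ B) ≠ 0 := by
  by_cases hex : ∃ i, Both A B i
  swap
  · push Not at hex
    exact Or.inl (exists_merge τ hA hB hex)
  right
  cases τ
  · have hex' : ∃ i, Both (refl A) (refl B) i := by
      obtain ⟨i, hi⟩ := hex
      exact ⟨-i, both_refl.2 (by rwa [neg_neg])⟩
    have hf : ∀ S : ZMod n → Cell, form false S = rho (form true (refl S)) := form_eq_rho false
    rcases rearrange_of_both hA.refl hB.refl (by rw [hA.cnt_refl, hB.cnt_refl, hc])
      (fun h => hne (refl_injective h)) hex' with
      ⟨C, D, h1, h2, h3, h4, h5⟩ | ⟨C, D, h1, h2, h3, h4, h5, h6, h7⟩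
    · left
      refine ⟨refl C, refl D, h1.refl, h2.refl, by rw [h1.cnt_refl, h3, hA.cnt_refl],
        by rw [h2.cnt_refl, h4, hA.cnt_refl], ?_⟩
      rw [hf, hf, hf, hf, refl_refl, refl_refl, ← map_add, ← map_add, h5]
    · right
      refine ⟨refl C, refl D, h1.refl, h2.refl, by rw [h1.cnt_refl, h3, hA.cnt_refl],
        by rw [h2.cnt_refl, h4, hA.cnt_refl], fun h => h5 (by rw [← h, refl_refl]), ?_, ?_⟩
      · rw [hf, hf, hf, hf, refl_refl, refl_refl, ← map_add, ← map_add, h6]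
      · intro c hcl
        have := h7 c
        rw [hf, hf, hf, refl_refl, ← map_sub, ← map_sub, ← map_smul] at hcl
        have hcl' := congrArg rho hcl
        rw [rho_rho, rho_rho] at hcl'
        rw [hf, hf, omega_rho_rho]
        exact this hcl'
  · rcases rearrange_of_both hA hB hc hne hex with
      ⟨C, D, h1, h2, h3, h4, h5⟩ | ⟨C, D, h1, h2, h3, h4, h5, h6, h7⟩
    · exact Or.inl ⟨C, D, h1, h2, h3, h4, h5 true⟩
    · exact Or.inr ⟨C, D, h1, h2, h3, h4, h5, h6 true, h7⟩

/-! ### Differences of exponent vectors -/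

-- The exponents at one site do not separate a short factor from a tail (O-type) or from a head
-- (E-type); the exponents of the two neighbours do.
set_option synthInstance.maxSize 1000 in
set_option maxRecDepth 10000 in
theorem cell_eq_of_local : ∀ τ : Bool, ∀ b b', fx τ b = fx τ b' → fy τ b = fy τ b' →
    ∀ a, Step a b → ∀ a', Step a' b' → fx τ a = fx τ a' → fy τ a = fy τ a' →
    ∀ c, Step b c → ∀ c', Step b' c' → fx τ c = fx τ c' → fy τ c = fy τ c' → b = b' := by
  decide

theorem form_injective (τ : Bool) {S S' : ZMod n → Cell} (hS : IsConfig S) (hS' : IsConfig S')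
    (h : form τ S = form τ S') : S = S' := by
  have h1 : ∀ i, fx τ (S i) = fx τ (S' i) := fun i => by
    have := congrFun (congrArg Prod.fst h) i
    simp only [form] at this
    exact_mod_cast this
  have h2 : ∀ i, fy τ (S i) = fy τ (S' i) := fun i => by
    have := congrFun (congrArg Prod.snd h) i
    simp only [form] at this
    exact_mod_cast this
  funext i
  have a1 := hS (i - 1)
  have a2 := hS' (i - 1)
  rw [sub_add_cancel] at a1 a2
  exact cell_eq_of_local τ _ _ (h1 i) (h2 i) _ a1 _ a2 (h1 _) (h2 _) _ (hS i) _ (hS' i) (h1 _) (h2 _)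

/-- The differences of the exponent vectors of two monomials of the same type and length. -/
def diffs (n : ℕ) [NeZero n] : Set (Phase n) :=
  {f | ∃ (τ : Bool) (S S' : ZMod n → Cell), IsConfig S ∧ IsConfig S' ∧ cnt S = cnt S' ∧
    f = form τ S - form τ S'}

theorem diffs_finite : (diffs n).Finite := by
  refine (Set.finite_range fun x : Bool × (ZMod n → Cell) × (ZMod n → Cell) =>
    form x.1 x.2.1 - form x.1 x.2.2).subset ?_
  rintro f ⟨τ, S, S', -, -, -, rfl⟩
  exact ⟨(τ, S, S'), rfl⟩

theorem sub_mem_diffs (τ : Bool) {S S' : ZMod n → Cell} (hS : IsConfig S) (hS' : IsConfig S')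
    (h : cnt S = cnt S') : form τ S - form τ S' ∈ diffs n := ⟨τ, S, S', hS, hS', h, rfl⟩

theorem neg_mem_diffs {f : Phase n} (hf : f ∈ diffs n) : -f ∈ diffs n := by
  obtain ⟨τ, S, S', h1, h2, h3, rfl⟩ := hf
  exact ⟨τ, S', S, h2, h1, h3.symm, by abel⟩

theorem gen_iff {q : Phase n} : Gen q ↔ ∀ f ∈ diffs n, f ≠ 0 → dot f q ≠ 0 := by
  constructor
  · rintro h f ⟨τ, S, S', h1, h2, h3, rfl⟩ hf h0
    rw [map_sub, LinearMap.sub_apply, sub_eq_zero] at h0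
    rw [h τ S S' h1 h2 h3 h0, sub_self] at hf
    exact hf rfl
  · intro h τ S S' h1 h2 h3 h4
    by_contra hne
    refine h _ (sub_mem_diffs τ h1 h2 h3) (fun h0 => hne ?_) ?_
    · exact form_injective τ h1 h2 (sub_eq_zero.1 h0)
    · rw [map_sub, LinearMap.sub_apply, h4, sub_self]

theorem isOpt_iff {τ : Bool} {S : ZMod n → Cell} {q : Phase n} : IsOpt τ S q ↔
    IsConfig S ∧ ∀ S', IsConfig S' → cnt S' = cnt S → 0 ≤ dot (form τ S - form τ S') q := by
  simp only [IsOpt, map_sub, LinearMap.sub_apply, sub_nonneg]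

/-- An optimal monomial remains optimal where no difference loses its positivity. -/
theorem IsOpt.of_pos {τ : Bool} {S : ZMod n → Cell} {q q₀ : Phase n} (h : IsOpt τ S q)
    (hs : ∀ f ∈ diffs n, 0 < dot f q₀ → 0 < dot f q) : IsOpt τ S q₀ := by
  rw [isOpt_iff] at h ⊢
  refine ⟨h.1, fun S' hS' hc => ?_⟩
  by_contra! hneg
  have h1 := hs _ (neg_mem_diffs (sub_mem_diffs τ h.1 hS' hc.symm)) (by simpa using hneg)
  have h2 := h.2 S' hS' hc
  simp only [map_neg, LinearMap.neg_apply] at h1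
  linarith

theorem IsOpt.dot_eq {τ : Bool} {S S' : ZMod n → Cell} {q : Phase n} (h : IsOpt τ S q)
    (h' : IsOpt τ S' q) (hc : cnt S = cnt S') : dot (form τ S) q = dot (form τ S') q :=
  le_antisymm (h'.2 S h.1 hc) (h.2 S' h'.1 hc.symm)

theorem IsConfig.form_eq_zero (τ : Bool) {S : ZMod n → Cell} (hS : IsConfig S) (h : cnt S = 0) :
    form τ S = 0 := by
  have h1 : ∀ i, st (S i) = 0 := by
    have := (Finset.sum_eq_zero_iff_of_nonneg (s := Finset.univ) (f := fun i => st (S i))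
      fun i _ => by generalize S i = a; revert a; decide).1 h
    exact fun i => this i (Finset.mem_univ _)
  have h2 : ∀ i, S i = e := by
    intro i
    have a1 := hS (i - 1)
    rw [sub_add_cancel] at a1
    have key : ∀ a b, st a = 0 → st b = 0 → Step a b → b = e := by decide
    exact key _ _ (h1 _) (h1 _) a1
  have h3 : fx τ e = 0 ∧ fy τ e = 0 := by revert τ; decide
  refine Prod.ext (funext fun i => ?_) (funext fun i => ?_)
  · simp [form, h2, h3.1]
  · simp [form, h2, h3.2]

/-! ### Selections of monomials -/

/-- A choice of a monomial of each type and each length. -/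
abbrev Sel (n : ℕ) : Type := Bool → Fin (n / 2 + 1) → ZMod n → Cell

/-- The chosen monomials have the right length and are optimal at `q`. -/
def IsSel (s : Sel n) (q : Phase n) : Prop :=
  ∀ τ k, IsOpt τ (s τ k) q ∧ cnt (s τ k) = (k : ℕ)

theorem exists_isSel (q : Phase n) : ∃ s : Sel n, IsSel s q := by
  choose s hs using fun (τ : Bool) (k : Fin (n / 2 + 1)) =>
    exists_isOpt τ q (k := (k : ℕ)) (Nat.lt_succ_iff.1 k.2)
  exact ⟨s, hs⟩

/-- The exponent vectors of the linear functions with which the invariants agree. -/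
noncomputable def vec (s : Sel n) (i : Bool × Fin (n / 2 + 1)) : Phase n :=
  if i.2 = 0 then total i.1 else form i.1 (s i.1 i.2)

theorem omega_vec {q : Phase n} (hq : Gen q) {s : Sel n} (hs : IsSel s q) {τ : Bool}
    {A : ZMod n → Cell} (hA : IsOpt τ A q) (i : Bool × Fin (n / 2 + 1)) :
    omega (form τ A) (vec s i) = 0 := by
  unfold vec
  split_ifs
  · exact omega_total _ _
  · exact omega_form_eq_zero hq hA (hs _ _).1

/-! ### Families changed by multiples of one vector -/

section LinearAlgebra

variable {ι V : Type*} [Fintype ι] [AddCommGroup V] [Module ℝ V]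

/-- A relation among the `N i` expresses a multiple of `g` through the `M i`; the coefficient must
vanish, and the relation is then one among the `M i`. -/
theorem linearIndependent_of_add_smul_of_notMem {M N : ι → V} {g : V} {c : ι → ℝ}
    (hM : LinearIndependent ℝ M) (hN : ∀ i, N i = M i + c i • g)
    (hg : g ∉ Submodule.span ℝ (Set.range M)) : LinearIndependent ℝ N := by
  rw [Fintype.linearIndependent_iff] at hM ⊢
  intro a ha
  simp only [hN, smul_add, Finset.sum_add_distrib, smul_smul, ← Finset.sum_smul] at ha
  by_cases h : ∑ i, a i * c i = 0
  · rw [h, zero_smul, add_zero] at ha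
    exact hM a ha
  · refine absurd ?_ hg
    have : g = -(∑ i, a i * c i)⁻¹ • ∑ i, a i • M i := by
      rw [eq_neg_of_add_eq_zero_left ha, smul_neg, neg_smul, neg_neg, inv_smul_smul₀ h]
    rw [this]
    exact Submodule.smul_mem _ _ (Submodule.sum_mem _ fun i _ =>
      Submodule.smul_mem _ _ (Submodule.subset_span ⟨i, rfl⟩))

/-- The linear map on the span of the `M i` with `M i ↦ N i` moves vectors by multiples of `g`, so a
non-trivial kernel is spanned by `g`. But it sends `μ • g` to `v ≠ 0`. -/
theorem linearIndependent_of_add_smul_of_fold {M N : ι → V} {g : V} {c : ι → ℝ}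
    (hM : LinearIndependent ℝ M) (hN : ∀ i, N i = M i + c i • g) {μ : ℝ} {v : V} (hv : v ≠ 0)
    (h : (μ • g, v) ∈ Submodule.span ℝ (Set.range fun i => (M i, N i))) :
    LinearIndependent ℝ N := by
  obtain ⟨ε, hε⟩ := (Submodule.mem_span_range_iff_exists_fun ℝ).1 h
  have h1 : ∑ i, ε i • M i = μ • g := by
    have := congrArg Prod.fst hε
    simpa [Prod.fst_sum] using this
  have h2 : ∑ i, ε i • N i = v := by
    have := congrArg Prod.snd hε
    simpa [Prod.snd_sum] using this
  have hM' := Fintype.linearIndependent_iff.1 hM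
  rw [Fintype.linearIndependent_iff]
  intro a ha
  simp only [hN, smul_add, Finset.sum_add_distrib, smul_smul, ← Finset.sum_smul] at ha h2
  by_cases hz : ∑ i, a i * c i = 0
  · rw [hz, zero_smul, add_zero] at ha
    exact hM' a ha
  exfalso
  have hg : g = -(∑ i, a i * c i)⁻¹ • ∑ i, a i • M i := by
    rw [eq_neg_of_add_eq_zero_left ha, smul_neg, neg_smul, neg_neg, inv_smul_smul₀ hz]
  set z := ∑ i, a i * c i with hzd
  have h3 : ∀ i, ε i + μ * z⁻¹ * a i = 0 := by
    refine hM' (fun i => ε i + μ * z⁻¹ * a i) ?_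
    simp only [add_smul, Finset.sum_add_distrib, mul_smul, ← Finset.smul_sum]
    rw [h1]
    nth_rw 1 [hg]
    simp [neg_smul]
  have h4 : ∑ i, ε i * c i = -μ := by
    have : ∀ i, ε i * c i = -(μ * z⁻¹) * (a i * c i) := fun i => by
      linear_combination c i * h3 i
    rw [Finset.sum_congr rfl fun i _ => this i, ← Finset.mul_sum, ← hzd]
    field_simp
  apply hv
  rw [← h2, h1, h4, neg_smul, add_neg_cancel]

end LinearAlgebra

/-! ### Crossing a wall -/

/-- Two monomials whose average is the optimum are both optimal, so by genericity they coincide. -/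
theorem IsOpt.eq_of_sum {q : Phase n} (hq : Gen q) {τ : Bool} {S A B : ZMod n → Cell}
    (hS : IsOpt τ S q) (hA : IsConfig A) (hB : IsConfig B) (hcA : cnt A = cnt S)
    (hcB : cnt B = cnt S) (h : form τ A + form τ B = (2 : ℝ) • form τ S) : A = B := by
  have h1 := hS.2 A hA hcA
  have h2 := hS.2 B hB hcB
  have h3 := congrArg (fun v => dot v q) h
  simp only [map_add, map_smul, LinearMap.add_apply, LinearMap.smul_apply, smul_eq_mul] at h3
  exact hq τ A B hA hB (hcA.trans hcB.symm) (by linarith)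

/-- Two optimal monomials of the same type and length differ by a multiple of `g`. -/
def Wall (g q₀ : Phase n) : Prop := ∀ f ∈ diffs n, dot f q₀ = 0 → ∃ c : ℝ, f = c • g

theorem Wall.exists_smul {g q₀ : Phase n} (h : Wall g q₀) {τ : Bool} {S S' : ZMod n → Cell}
    (hS : IsOpt τ S q₀) (hS' : IsConfig S') (hc : cnt S' = cnt S)
    (hd : dot (form τ S) q₀ ≤ dot (form τ S') q₀) :
    ∃ c : ℝ, form τ S' = form τ S + c • g := by
  obtain ⟨c, hc⟩ := h _ (sub_mem_diffs τ hS' hS.1 hc) (by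
    rw [map_sub, LinearMap.sub_apply]
    linarith [hS.2 S' hS' hc])
  exact ⟨c, by rw [← hc]; abel⟩

/-- Both selections are optimal on the wall, so corresponding vectors differ by multiples of `g`. If
some pair differs, `rearrange` leaves three cases: two give a fold relation, the third puts `g`
outside the span by means of the bracket. -/
theorem wall_crossing {q₁ q₂ q₀ g : Phase n} (h₁ : Gen q₁) (h₂ : Gen q₂)
    (hp₁ : ∀ f ∈ diffs n, 0 < dot f q₀ → 0 < dot f q₁)
    (hp₂ : ∀ f ∈ diffs n, 0 < dot f q₀ → 0 < dot f q₂) (hg : Wall g q₀) {s₁ s₂ : Sel n}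
    (hs₁ : IsSel s₁ q₁) (hs₂ : IsSel s₂ q₂) (hi : LinearIndependent ℝ (vec s₁)) :
    LinearIndependent ℝ (vec s₂) := by
  have ho₁ : IsSel s₁ q₀ := fun τ k => ⟨(hs₁ τ k).1.of_pos hp₁, (hs₁ τ k).2⟩
  have ho₂ : IsSel s₂ q₀ := fun τ k => ⟨(hs₂ τ k).1.of_pos hp₂, (hs₂ τ k).2⟩
  have hcnt : ∀ τ k, cnt (s₂ τ k) = cnt (s₁ τ k) := fun τ k => by rw [(hs₁ τ k).2, (hs₂ τ k).2]
  have hexf : ∀ τ k, ∃ c : ℝ, form τ (s₂ τ k) = form τ (s₁ τ k) + c • g := fun τ k =>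
    hg.exists_smul (ho₁ τ k).1 (ho₂ τ k).1.1 (hcnt τ k)
      ((ho₁ τ k).1.dot_eq (ho₂ τ k).1 (hcnt τ k).symm).le
  have hex : ∀ i, ∃ c : ℝ, vec s₂ i = vec s₁ i + c • g := by
    intro i
    unfold vec
    split_ifs
    · exact ⟨0, by rw [zero_smul, add_zero]⟩
    · exact hexf _ _
  choose c hc using hex
  by_cases heq : ∀ τ k, s₁ τ k = s₂ τ k
  · have : s₁ = s₂ := funext fun τ => funext fun k => heq τ k
    rwa [← this]
  push Not at heq
  obtain ⟨τ, k, hne⟩ := heq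
  set P := Submodule.span ℝ (Set.range fun i => (vec s₁ i, vec s₂ i)) with hP
  have hPt : ∀ σ, ((total σ, total σ) : Phase n × Phase n) ∈ P := fun σ =>
    Submodule.subset_span ⟨(σ, 0), by simp [vec]⟩
  have hPf : ∀ σ j, (form σ (s₁ σ j), form σ (s₂ σ j)) ∈ P := by
    intro σ j
    -- Slot 0 of `vec` holds a total; the actual monomial of length zero has exponent vector zero
    -- and lies in `P` trivially.
    by_cases hj : j = 0
    · rw [(hs₁ σ j).1.1.form_eq_zero σ (by rw [(hs₁ σ j).2, hj]; rfl),
        (hs₂ σ j).1.1.form_eq_zero σ (by rw [(hs₂ σ j).2, hj]; rfl)]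
      exact P.zero_mem
    · exact Submodule.subset_span ⟨(σ, j), by simp [vec, hj]⟩
  have hA := (ho₁ τ k).1
  have hB := (ho₂ τ k).1
  have hAB := hA.dot_eq hB (hcnt τ k).symm
  have hA₂ : ∀ S, IsConfig S → cnt S = (k : ℕ) →
      dot (form τ S) q₀ ≤ dot (form τ (s₁ τ k)) q₀ :=
    fun S hS h => hA.2 S hS (by rw [h, (hs₁ τ k).2])
  obtain ⟨cAB, hcAB⟩ := hexf τ k
  rcases rearrange τ hA.1 hB.1 (hcnt τ k).symm hne with
    ⟨C, hC, hcC, hf⟩ | ⟨C, D, hC, hD, hcC, hcD, hf⟩ | ⟨C, D, hC, hD, hcC, hcD, hCA, hf, hom⟩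
  · -- the two monomials fill the cycle
    have hl := hC.two_mul_cnt_le
    have hl0 := cnt_nonneg C
    obtain ⟨j, hj⟩ : ∃ j : Fin (n / 2 + 1), cnt C = (j : ℕ) :=
      ⟨⟨(cnt C).toNat, by omega⟩, by simp [hl0]⟩
    have hCk : ∀ S : ZMod n → Cell, IsConfig S → cnt S = (j : ℕ) → cnt S + 2 * ((k : ℕ) : ℤ) = n := by
      intro S _ hS
      rw [hS, ← hj, ← hcC, (hs₁ τ k).2]
    have hE := (ho₂ (!τ) j).1
    obtain ⟨A', B', a1, a2, -, a4, a5, a6⟩ := exists_split τ hE.1 (hCk _ hE.1 (hs₂ _ j).2)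
    -- `C` is optimal on the wall: total plus the optimum of its length splits into two monomials of
    -- length `k`, whose values are at most those of the tied pair, and the tied pair adds up to
    -- total plus `C`.
    have hCo : dot (form (!τ) (s₁ (!τ) j)) q₀ ≤ dot (form (!τ) C) q₀ := by
      rw [(ho₁ (!τ) j).1.dot_eq hE (hcnt _ _).symm]
      have e1 := congrArg (fun v => dot v q₀) a6
      have e2 := congrArg (fun v => dot v q₀) hf
      simp only [map_add, LinearMap.add_apply] at e1 e2
      linarith [hA₂ A' a1 a4, hA₂ B' a2 a5]
    obtain ⟨d, hd⟩ := hg.exists_smul (ho₁ (!τ) j).1 hC (by rw [hj, (hs₁ _ j).2]) hCo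
    obtain ⟨A'', B'', b1, b2, b3, b4, b5, b6⟩ :=
      exists_split τ (hs₂ (!τ) j).1.1 (hCk _ (hs₂ _ j).1.1 (hs₂ _ j).2)
    -- The combination total plus the vector of length `j` of the other type minus twice that of
    -- length `k` is a multiple of `g` for `s₁`. For `s₂` it is non-zero, since total plus the
    -- vector of length `j` splits into two different monomials that cannot average to a unique
    -- optimum.
    refine linearIndependent_of_add_smul_of_fold hi hc (μ := cAB - d)
      (v := total τ + form (!τ) (s₂ (!τ) j) - (2 : ℝ) • form τ (s₂ τ k)) ?_ ?_
    · intro h0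
      rw [← b6, sub_eq_zero] at h0
      exact b3 ((hs₂ τ k).1.eq_of_sum h₂ b1 b2 (by rw [b4, (hs₂ τ k).2]) (by rw [b5, (hs₂ τ k).2])
        h0)
    · have := P.sub_mem (P.add_mem (hPt τ) (hPf (!τ) j)) (P.smul_mem (2 : ℝ) (hPf τ k))
      convert this using 1
      simp only [Prod.mk_add_mk, Prod.smul_mk, Prod.mk_sub_mk, Prod.mk.injEq, and_true]
      rw [hcAB, hd] at hf
      have : total τ + form (!τ) (s₁ (!τ) j) =
          form τ (s₁ τ k) + (form τ (s₁ τ k) + cAB • g) - d • g := by rw [hf]; abel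
      rw [this]
      module
  -- The tied pair rearranges into lengths `k + 1` and `k - 1`. Concavity on the wall forces both
  -- new monomials to be optimal, and `exists_intermediate` replaces the splitting of the first
  -- case.
  · have hl := hC.two_mul_cnt_le
    have hl0 := cnt_nonneg D
    rw [(hs₁ τ k).2] at hcC hcD
    obtain ⟨j, hj⟩ : ∃ j : Fin (n / 2 + 1), cnt C = (j : ℕ) :=
      ⟨⟨(cnt C).toNat, by omega⟩, by simp; omega⟩
    obtain ⟨j', hj'⟩ : ∃ j : Fin (n / 2 + 1), cnt D = (j : ℕ) :=
      ⟨⟨(cnt D).toNat, by omega⟩, by simp [hl0]⟩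
    have hE := (ho₂ τ j).1
    have hF := (ho₂ τ j').1
    have hjj : cnt (s₂ τ j) = cnt (s₂ τ j') + 2 := by
      rw [(hs₂ τ j).2, (hs₂ τ j').2, ← hj, ← hj']; omega
    obtain ⟨A', B', a1, a2, a3, a4, a5, a6⟩ := exists_intermediate hE.1 hF.1 hjj
    have hk : cnt (s₂ τ j') + 1 = (k : ℕ) := by rw [(hs₂ τ j').2, ← hj']; omega
    rw [hk] at a4 a5
    have e1 := congrArg (fun v => dot v q₀) (a6 τ)
    have e2 := congrArg (fun v => dot v q₀) hf
    simp only [map_add, LinearMap.add_apply] at e1 e2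
    have e3 := hA₂ A' a1 a4
    have e4 := hA₂ B' a2 a5
    have e5 := (ho₁ τ j).1.dot_eq hE (hcnt _ _).symm
    have e6 := (ho₁ τ j').1.dot_eq hF (hcnt _ _).symm
    have e7 := (ho₁ τ j).1.2 C hC (by rw [hj, (hs₁ _ j).2])
    have e8 := (ho₁ τ j').1.2 D hD (by rw [hj', (hs₁ _ j').2])
    obtain ⟨d, hd⟩ := hg.exists_smul (ho₁ τ j).1 hC (by rw [hj, (hs₁ _ j).2]) (by linarith)
    obtain ⟨d', hd'⟩ := hg.exists_smul (ho₁ τ j').1 hD (by rw [hj', (hs₁ _ j').2]) (by linarith)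
    refine linearIndependent_of_add_smul_of_fold hi hc (μ := cAB - d - d')
      (v := form τ (s₂ τ j) + form τ (s₂ τ j') - (2 : ℝ) • form τ (s₂ τ k)) ?_ ?_
    · intro h0
      rw [← a6 τ, sub_eq_zero] at h0
      exact a3 ((hs₂ τ k).1.eq_of_sum h₂ a1 a2 (by rw [a4, (hs₂ τ k).2]) (by rw [a5, (hs₂ τ k).2])
        h0)
    · have := P.sub_mem (P.add_mem (hPf τ j) (hPf τ j')) (P.smul_mem (2 : ℝ) (hPf τ k))
      convert this using 1
      simp only [Prod.mk_add_mk, Prod.smul_mk, Prod.mk_sub_mk, Prod.mk.injEq, and_true]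
      rw [hcAB, hd, hd'] at hf
      have : form τ (s₁ τ j) + form τ (s₁ τ j') =
          form τ (s₁ τ k) + (form τ (s₁ τ k) + cAB • g) - d • g - d' • g := by rw [← hf]; abel
      rw [this]
      module
  · -- the bracket separates `g` from the family
    refine linearIndependent_of_add_smul_of_notMem hi hc fun hmem => ?_
    have e2 := congrArg (fun v => dot v q₀) hf
    simp only [map_add, LinearMap.add_apply] at e2
    have e3 := hA.2 D hD hcD
    obtain ⟨d, hd⟩ := hg.exists_smul hA hC hcC (by linarith)
    have hd0 : d ≠ 0 := by
      rintro rfl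
      rw [zero_smul, add_zero] at hd
      exact hCA (form_injective τ hC hA.1 hd)
    -- Both differences are multiples of `g`, so the line condition holds and the tied monomials do
    -- not commute. Their bracket is `cAB` times that with `g`, which would vanish if `g` were in
    -- the span.
    refine hom (cAB / d) ?_ ?_
    · rw [hd, hcAB, add_sub_cancel_left, add_sub_cancel_left, smul_smul, div_mul_cancel₀ _ hd0]
    · have hz : ∀ v ∈ Submodule.span ℝ (Set.range (vec s₁)), omega (form τ (s₁ τ k)) v = 0 := by
        intro v hv
        have : Submodule.span ℝ (Set.range (vec s₁)) ≤ LinearMap.ker (omega (form τ (s₁ τ k))) := by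
          rw [Submodule.span_le]
          rintro _ ⟨i, rfl⟩
          exact omega_vec h₁ hs₁ (hs₁ τ k).1 i
        exact this hv
      rw [hcAB, map_add, map_smul, omega_self, hz g hmem]
      simp

/-! ### A point with independent functions -/

/-- Weights that favour the sites `0, 2, 4, …` in this order. -/
noncomputable def baseWeight (i : ZMod n) : ℝ :=
  if i.val % 2 = 0 ∧ i.val < 2 * (n / 2) then -(i.val / 2 : ℕ) - 1 else -n

/-- The point with all weights equal to the favouring ones. -/
noncomputable def basePoint (n : ℕ) [NeZero n] : Phase n := (baseWeight, baseWeight)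

theorem baseWeight_le (i : ZMod n) : baseWeight i ≤ -1 := by
  have : (1 : ℝ) ≤ n := by exact_mod_cast NeZero.one_le
  unfold baseWeight
  split_ifs
  · have : (0 : ℝ) ≤ (i.val / 2 : ℕ) := Nat.cast_nonneg _
    linarith
  · linarith

/-- The multiplier `k + 1/2` per factor separates the weights `-1, …, -k` from those at most `-k -
1`, so `evens k` is best at each single site. A head may tie, because an E-type long factor pays for
its `x` only at the tail. -/
theorem site_le {k : ℕ} (hk : k ≤ n / 2) (τ : Bool) (i : ZMod n) (a : Cell) :
    (st a : ℝ) * (k + 1 / 2) + (fx τ a + fy τ a) * baseWeight i ≤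
      st (evens k i) * (k + 1 / 2) + (fx τ (evens k i) + fy τ (evens k i)) * baseWeight i ∧
    (st (evens k i) * (k + 1 / 2) + (fx τ (evens k i) + fy τ (evens k i)) * baseWeight i =
      (st a : ℝ) * (k + 1 / 2) + (fx τ a + fy τ a) * baseWeight i → a = evens k i ∨ a = l) := by
  have hw := baseWeight_le i
  have hk0 : (0 : ℝ) ≤ k := Nat.cast_nonneg _
  by_cases h : i.val % 2 = 0 ∧ i.val < 2 * k
  · have h1 : -(k : ℝ) ≤ baseWeight i := by
      have h2 : i.val / 2 + 1 ≤ k := by omega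
      have h3 : ((i.val / 2 : ℕ) : ℝ) + 1 ≤ k := by exact_mod_cast h2
      rw [baseWeight, if_pos ⟨h.1, by omega⟩]
      linarith
    simp only [evens, if_pos h]
    cases τ <;> cases a <;> simp [st, fx, fy, cov, hd, tl] <;>
      (try constructor) <;> (try intro) <;> linarith
  · have h1 : baseWeight i ≤ -(k : ℝ) - 1 := by
      unfold baseWeight
      split_ifs with h'
      · have h2 : k ≤ i.val / 2 := by omega
        have h3 : (k : ℝ) ≤ (i.val / 2 : ℕ) := by exact_mod_cast h2
        linarith
      · have h2 : k + 1 ≤ n := by have := NeZero.one_le (n := n); omega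
        have h3 : (k : ℝ) + 1 ≤ n := by exact_mod_cast h2
        linarith
    simp only [evens, if_neg h]
    cases τ <;> cases a <;> simp [st, fx, fy, cov, hd, tl] <;>
      (try constructor) <;> (try intro) <;> linarith

theorem IsOpt.eq_evens {τ : Bool} {S : ZMod n → Cell} (hS : IsOpt τ S (basePoint n)) {k : ℕ}
    (hk : k ≤ n / 2) (hc : cnt S = k) : S = evens k := by
  have h1 := hS.2 (evens k) (isConfig_evens hk) (by rw [cnt_evens hk, hc])
  have hsum : ∀ S' : ZMod n → Cell, cnt S' = k →
      ∑ i, ((st (S' i) : ℝ) * (k + 1 / 2) + (fx τ (S' i) + fy τ (S' i)) * baseWeight i) =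
        k * (k + 1 / 2) + dot (form τ S') (basePoint n) := by
    intro S' h
    have h' : ∑ i, (st (S' i) : ℝ) = k := by
      rw [cnt] at h
      exact_mod_cast h
    rw [Finset.sum_add_distrib, ← Finset.sum_mul, h', dot_apply]
    simp only [form, basePoint]
    congr 1
    exact Finset.sum_congr rfl fun i _ => by ring
  have h2 := hsum S hc
  have h3 := hsum (evens k) (cnt_evens hk)
  have hle := fun i (_ : i ∈ (Finset.univ : Finset (ZMod n))) => (site_le hk τ i (S i)).1
  have h4 := (Finset.sum_eq_sum_iff_of_le hle).1
    (le_antisymm (Finset.sum_le_sum hle) (by rw [h2, h3]; linarith))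
  have h5 : ∀ i, S i = evens k i ∨ S i = l := fun i =>
    (site_le hk τ i (S i)).2 (h4 i (Finset.mem_univ _)).symm
  funext i
  -- A head forces a tail at the next site, and a tail is neither a state of `evens k` nor a head.
  refine (h5 i).resolve_right fun hl => ?_
  have h6 := hS.1 i
  rw [hl] at h6
  simp only [Step] at h6
  rcases h5 (i + 1) with h7 | h7
  · rw [h6, evens] at h7
    split_ifs at h7
  · rw [h6] at h7
    cases h7

theorem linearIndependent_vec_evens (hn : 3 ≤ n) {s : Sel n} (hs : ∀ τ k, s τ k = evens (k : ℕ)) :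
    LinearIndependent ℝ (vec s) := by
  -- the values of a combination in one of the two components
  have key : ∀ a : Fin (n / 2 + 1) → ℝ,
      (∀ i : ZMod n, ∑ k, a k * (if k = 0 then 1 else (cov (evens (k : ℕ) i) : ℝ)) = 0) →
      ∀ k, a k = 0 := by
    intro a ha
    -- Site 1 is covered by no `evens k`, so only the total contributes there.
    have h0 : a 0 = 0 := by
      have := ha ((1 : ℕ) : ZMod n)
      have hv : ((1 : ℕ) : ZMod n).val = 1 := ZMod.val_natCast_of_lt (by omega)
      simp only [evens, hv] at this
      simpa [cov] using this
    -- Site `2j` is covered by `evens k` exactly for `j < k`; differences of these tail sums isolate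
    -- each coefficient.
    have hF : ∀ j : ℕ, ∑ k : Fin (n / 2 + 1), (if j < k then a k else 0) = 0 := by
      intro j
      by_cases hj : j < n / 2
      · have := ha ((2 * j : ℕ) : ZMod n)
        have hv : ((2 * j : ℕ) : ZMod n).val = 2 * j := ZMod.val_natCast_of_lt (by omega)
        refine Eq.trans (Finset.sum_congr rfl fun k _ => ?_) this
        by_cases hk : k = 0
        · simp [hk, h0]
        · simp only [evens, hv, if_neg hk]
          by_cases hjk : j < k
          · simp [hjk, cov]
          · simp [hjk, cov]
      · refine Finset.sum_eq_zero fun k _ => if_neg ?_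
        have := k.2
        omega
    intro k
    by_cases hk : k = 0
    · rw [hk, h0]
    have hk' : (k : ℕ) ≠ 0 := fun h => hk (Fin.ext h)
    have h1 := hF (k - 1)
    have h2 := hF k
    have h3 : (∑ j : Fin (n / 2 + 1), if j = k then a j else 0) =
        (∑ j : Fin (n / 2 + 1), if (k : ℕ) - 1 < j then a j else 0) -
          ∑ j : Fin (n / 2 + 1), if (k : ℕ) < j then a j else 0 := by
      rw [← Finset.sum_sub_distrib]
      refine Finset.sum_congr rfl fun j _ => ?_
      have : j = k ↔ (j : ℕ) = k := Fin.ext_iff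
      split_ifs <;> first | omega | simp
    rw [h1, h2, sub_zero] at h3
    simpa using h3
  rw [Fintype.linearIndependent_iff]
  intro a ha
  rw [Fintype.sum_prod_type, Fintype.sum_bool] at ha
  have hx := congrArg Prod.fst ha
  have hy := congrArg Prod.snd ha
  have htl : ∀ k (i : ZMod n), tl (evens k i) = 0 := fun k i => by
    unfold evens; split_ifs <;> rfl
  have hhd : ∀ k (i : ZMod n), hd (evens k i) = 0 := fun k i => by
    unfold evens; split_ifs <;> rfl
  have h1 : ∀ k, a (true, k) = 0 := by
    refine key _ fun i => ?_
    have := congrFun hx i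
    simp only [Prod.fst_add, Prod.fst_sum, Pi.add_apply, Finset.sum_apply, Prod.smul_fst,
      Pi.smul_apply, smul_eq_mul, Prod.fst_zero, Pi.zero_apply, vec, hs] at this
    rw [Finset.sum_eq_zero (f := fun k => a (false, k) * _), add_zero] at this
    · rw [← this]
      refine Finset.sum_congr rfl fun k _ => ?_
      split_ifs <;> simp [total, form, fx]
    · intro k _
      split_ifs <;> simp [total, form, fx, htl]
  have h2 : ∀ k, a (false, k) = 0 := by
    refine key _ fun i => ?_
    have := congrFun hy i
    simp only [Prod.snd_add, Prod.snd_sum, Pi.add_apply, Finset.sum_apply, Prod.smul_snd,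
      Pi.smul_apply, smul_eq_mul, Prod.snd_zero, Pi.zero_apply, vec, hs] at this
    rw [Finset.sum_eq_zero (f := fun k => a (true, k) * _), zero_add] at this
    · rw [← this]
      refine Finset.sum_congr rfl fun k _ => ?_
      split_ifs <;> simp [total, form, fy]
    · intro k _
      split_ifs <;> simp [total, form, fy, hhd]
  rintro ⟨τ, k⟩
  cases τ
  · exact h2 k
  · exact h1 k

/-! ### Generic points -/

open Filter Topology

theorem dot_self_ne_zero {v : Phase n} (hv : v ≠ 0) : dot v v ≠ 0 := by
  intro h
  rw [dot_apply, Finset.sum_eq_zero_iff_of_nonneg fun i _ =>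
    add_nonneg (mul_self_nonneg _) (mul_self_nonneg _)] at h
  refine hv (Prod.ext (funext fun i => ?_) (funext fun i => ?_))
  · have := h i (Finset.mem_univ _)
    simp only [Prod.fst_zero, Pi.zero_apply]
    nlinarith [sq_nonneg (v.1 i), sq_nonneg (v.2 i)]
  · have := h i (Finset.mem_univ _)
    simp only [Prod.snd_zero, Pi.zero_apply]
    nlinarith [sq_nonneg (v.1 i), sq_nonneg (v.2 i)]

theorem exists_dot_ne_zero {Z : Set (Phase n)} (hZ : Z.Finite) (h0 : ∀ z ∈ Z, z ≠ 0) :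
    ∃ v, ∀ z ∈ Z, dot z v ≠ 0 := by
  have := hZ.to_subtype
  obtain ⟨v, hv⟩ := Module.Dual.exists_forall_ne_zero_of_forall_exists (K := ℝ)
    (fun z : Z => dot (z : Phase n))
    fun z => ⟨z, dot_self_ne_zero (h0 z z.2)⟩
  exact ⟨v, fun z hz => hv ⟨z, hz⟩⟩

theorem eventually_dot_ne_zero {Z : Set (Phase n)} (hZ : Z.Finite) (p : Phase n) {v : Phase n}
    (hv : ∀ z ∈ Z, dot z v ≠ 0) : ∀ᶠ t in 𝓝[>] (0 : ℝ), ∀ z ∈ Z, dot z (p + t • v) ≠ 0 := by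
  rw [hZ.eventually_all]
  intro z hz
  simp only [map_add, map_smul, smul_eq_mul]
  by_cases hp : dot z p = 0
  · filter_upwards [self_mem_nhdsWithin] with t ht
    rw [hp, zero_add]
    exact mul_ne_zero (ne_of_gt ht) (hv z hz)
  · have : ContinuousAt (fun t : ℝ => dot z p + t * dot z v) 0 := by fun_prop
    exact nhdsWithin_le_nhds (this.eventually_ne (by simpa using hp))

theorem eventually_dot_pos {Z : Set (Phase n)} (hZ : Z.Finite) (p v : Phase n) :
    ∀ᶠ t in 𝓝[>] (0 : ℝ), ∀ z ∈ Z, 0 < dot z p → 0 < dot z (p + t • v) := by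
  rw [hZ.eventually_all]
  intro z _
  simp only [map_add, map_smul, smul_eq_mul]
  by_cases hp : 0 < dot z p
  · have : ContinuousAt (fun t : ℝ => dot z p + t * dot z v) 0 := by fun_prop
    filter_upwards [nhdsWithin_le_nhds (this.eventually (lt_mem_nhds (by simpa using hp)))]
      with t ht _ using ht
  · exact Eventually.of_forall fun t h => absurd h hp

/-- Every point is a limit of generic points at which the same monomials are optimal. -/
theorem exists_generic_near {Z : Set (Phase n)} (hZ : Z.Finite) (h0 : ∀ z ∈ Z, z ≠ 0)
    (p : Phase n) : ∃ p', (∀ z ∈ Z, dot z p' ≠ 0) ∧ ∀ s : Sel n, IsSel s p' → IsSel s p := by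
  obtain ⟨v, hv⟩ := exists_dot_ne_zero hZ h0
  obtain ⟨t, h1, h2⟩ := ((eventually_dot_ne_zero hZ p hv).and
    (eventually_dot_pos diffs_finite p v)).exists
  exact ⟨p + t • v, h1, fun s hs τ k => ⟨(hs τ k).1.of_pos h2, (hs τ k).2⟩⟩

/-- The functions with which the invariants agree at `q` are independent. -/
def Indep (q : Phase n) : Prop := ∀ s : Sel n, IsSel s q → LinearIndependent ℝ (vec s)

theorem gen_of_forall {q : Phase n} (h : ∀ f ∈ diffs n \ {0}, dot f q ≠ 0) : Gen q :=
  gen_iff.2 fun f hf hf0 => h f ⟨hf, hf0⟩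

theorem exists_gen_indep (hn : 3 ≤ n) : ∃ b : Phase n, Gen b ∧ Indep b := by
  obtain ⟨b, h1, h2⟩ := exists_generic_near (diffs_finite.subset Set.sdiff_subset)
    (fun z (hz : z ∈ diffs n \ {0}) => hz.2) (basePoint n)
  refine ⟨b, gen_of_forall h1, fun s hs => linearIndependent_vec_evens hn fun τ k => ?_⟩
  have := h2 s hs τ k
  exact this.1.eq_evens (Nat.lt_succ_iff.1 k.2) this.2

/-! ### Following a segment -/

section Segment

variable (b q : Phase n)

/-- The point of the segment from `b` to `q`. -/
noncomputable def seg (t : ℝ) : Phase n := b + t • (q - b)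

theorem dot_seg (f : Phase n) (t : ℝ) :
    dot f (seg b q t) = dot f b + t * (dot f q - dot f b) := by
  simp [seg, map_add, map_smul, map_sub]

/-- The differences that change their sign between `b` and the point with parameter `t`. -/
noncomputable def crossed (t : ℝ) : Finset (Phase n) :=
  open Classical in (diffs_finite (n := n)).toFinset.filter fun f => dot f b * dot f (seg b q t) < 0

variable {b q}

theorem mem_crossed {t : ℝ} {f : Phase n} :
    f ∈ crossed b q t ↔ f ∈ diffs n ∧ dot f b * dot f (seg b q t) < 0 := by
  simp [crossed]

/-- Induction on the number of differences that change sign since `b`. Stepping back over the last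
zero lowers this number, and by `hq` all differences vanishing at that moment are proportional, so
it is a single wall. -/
theorem indep_seg (hb : Gen b) (hbi : Indep b)
    (hq : ∀ f ∈ diffs n, ∀ f' ∈ diffs n, dot f b • f' - dot f' b • f ≠ 0 →
      dot (dot f b • f' - dot f' b • f) q ≠ 0) :
    ∀ (N : ℕ) (t : ℝ), (crossed b q t).card = N → 0 ≤ t → Gen (seg b q t) →
      Indep (seg b q t) := by
  intro N
  induction N using Nat.strong_induction_on with
  | _ N ih =>
  intro t hN ht hg s hs
  have hb' := gen_iff.1 hb
  have hg' := gen_iff.1 hg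
  rcases (crossed b q t).eq_empty_or_nonempty with hemp | hne
  · obtain ⟨s₁, hs₁⟩ := exists_isSel b
    have hpos : ∀ f ∈ diffs n, 0 < dot f b → 0 < dot f (seg b q t) := by
      intro f hf hfb
      by_contra! hle
      have hf0 : f ≠ 0 := by rintro rfl; simp at hfb
      have : f ∈ crossed b q t :=
        mem_crossed.2 ⟨hf, mul_neg_of_pos_of_neg hfb (lt_of_le_of_ne hle (hg' f hf hf0))⟩
      rw [hemp] at this
      exact absurd this (Finset.notMem_empty _)
    -- Without sign changes `b` itself serves as wall point, with direction zero.
    refine wall_crossing (g := 0) hb hg (fun f _ h => h) hpos (fun f hf h => ⟨0, ?_⟩) hs₁ hs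
      (hbi s₁ hs₁)
    rw [smul_zero]
    by_contra hf0
    exact hb' f hf hf0 h
  · -- the time at which a difference vanishes
    let T : Phase n → ℝ := fun f => dot f b / (dot f b - dot f q)
    -- `g` is a difference with the latest zero before `t`; that zero is the wall parameter `t₀`.
    obtain ⟨g, hgm, hmax⟩ := (crossed b q t).exists_max_image T hne
    have hT : ∀ f ∈ crossed b q t, 0 < T f ∧ T f < t ∧
        ∀ r, dot f (seg b q r) = dot f b * (1 - r / T f) := by
      intro f hf
      have h1 := (mem_crossed.1 hf).2
      rw [dot_seg] at h1
      have hb0 : dot f b ≠ 0 := by rintro h; simp [h] at h1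
      have hd : dot f b - dot f q ≠ 0 := by
        intro h
        have : dot f q = dot f b := by linarith
        rw [this] at h1
        nlinarith [sq_nonneg (dot f b)]
      have hx : 0 < dot f b * (dot f b - dot f q) := by
        have := mul_self_nonneg (dot f b)
        by_contra! hle
        nlinarith
      have hTe : T f = dot f b * dot f b / (dot f b * (dot f b - dot f q)) := by
        simp only [T]; field_simp
      have hbb : 0 < dot f b * dot f b := mul_self_pos.2 hb0
      refine ⟨?_, ?_, fun r => ?_⟩
      · rw [hTe]; positivity
      · rw [hTe, div_lt_iff₀ hx]; nlinarith
      · rw [dot_seg]; simp only [T]; field_simp; ring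
    obtain ⟨hT0, hTt, hTg⟩ := hT g hgm
    set t₀ := T g with ht₀
    have hgd := (mem_crossed.1 hgm).1
    have hgb : dot g b ≠ 0 := by
      intro h
      have := (mem_crossed.1 hgm).2
      simp [h] at this
    have hg0 : dot g (seg b q t₀) = 0 := by rw [hTg, div_self hT0.ne']; ring
    -- a parameter shortly before
    have hev : ∀ᶠ r in 𝓝[<] t₀, ∀ f ∈ diffs n,
        (dot f (seg b q t₀) ≠ 0 → 0 < dot f (seg b q t₀) * dot f (seg b q r)) := by
      rw [diffs_finite.eventually_all]
      intro f _
      by_cases h : dot f (seg b q t₀) = 0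
      · exact Eventually.of_forall fun r h' => absurd h h'
      · have hc : ContinuousAt (fun r : ℝ => dot f (seg b q t₀) * dot f (seg b q r)) t₀ := by
          simp only [dot_seg]; fun_prop
        filter_upwards [nhdsWithin_le_nhds (hc.eventually (lt_mem_nhds (mul_self_pos.2 h)))]
          with r hr _ using hr
    have hev2 : ∀ᶠ r in 𝓝[<] t₀, 0 < r := nhdsWithin_le_nhds (lt_mem_nhds hT0)
    obtain ⟨r, ⟨hr1, hr2⟩, hr3⟩ := ((hev.and hev2).and self_mem_nhdsWithin).exists
    replace hr3 : r < t₀ := hr3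
    -- the differences vanishing at `t₀`
    have hvan : ∀ f, dot f (seg b q t₀) = 0 → ∀ u, dot f (seg b q u) * t₀ = dot f b * (t₀ - u) := by
      intro f hf u
      rw [dot_seg] at hf ⊢
      linear_combination u * hf
    have hgr : Gen (seg b q r) := by
      refine gen_iff.2 fun f hf hf0 h => ?_
      by_cases hz : dot f (seg b q t₀) = 0
      · have := hvan f hz r
        rw [h, zero_mul] at this
        rcases mul_eq_zero.1 this.symm with h' | h'
        · exact hb' f hf hf0 h'
        · linarith
      · have := hr1 f hf hz
        rw [h, mul_zero] at this
        exact lt_irrefl _ this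
    have hsub : crossed b q r ⊂ crossed b q t := by
      rw [Finset.ssubset_iff_of_subset]
      · refine ⟨g, hgm, fun h => ?_⟩
        have h1 := (mem_crossed.1 h).2
        rw [hTg] at h1
        have h2 : 0 < 1 - r / t₀ := by rw [sub_pos, div_lt_one hT0]; exact hr3
        nlinarith [mul_self_pos.2 hgb, mul_pos (mul_self_pos.2 hgb) h2]
      · intro f hf
        obtain ⟨h1, h2⟩ := mem_crossed.1 hf
        refine mem_crossed.2 ⟨h1, ?_⟩
        rw [dot_seg] at h2 ⊢
        have h3 := mul_self_nonneg (dot f b)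
        have h4 : dot f b * (dot f q - dot f b) < 0 := by
          by_contra! h
          nlinarith [mul_nonneg hr2.le h]
        nlinarith
    obtain ⟨s₁, hs₁⟩ := exists_isSel (seg b q r)
    refine wall_crossing (q₀ := seg b q t₀) (g := g) hgr hg ?_ ?_ ?_ hs₁ hs
      (ih _ (hN ▸ Finset.card_lt_card hsub) r rfl hr2.le hgr s₁ hs₁)
    · intro f hf hpos
      exact (pos_iff_pos_of_mul_pos (hr1 f hf hpos.ne')).1 hpos
    · intro f hf hpos
      by_contra! hle
      have hf0 : f ≠ 0 := by rintro rfl; simp at hpos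
      have hlt := lt_of_le_of_ne hle (hg' f hf hf0)
      -- Affine in the parameter, positive at `t₀` and negative later: positive at 0, so `f` is
      -- crossed after `t₀`, against the choice of `g`.
      have hfb : 0 < dot f b := by
        rw [dot_seg] at hpos hlt
        by_contra! h
        have : 0 < dot f q - dot f b := by
          by_contra! h'
          nlinarith
        nlinarith
      have hfc : f ∈ crossed b q t := mem_crossed.2 ⟨hf, mul_neg_of_pos_of_neg hfb hlt⟩
      obtain ⟨h1, h2, h3⟩ := hT f hfc
      have h4 := hmax f hfc
      rw [h3] at hpos
      have h5 := (pos_iff_pos_of_mul_pos hpos).1 hfb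
      rw [sub_pos, div_lt_one h1] at h5
      linarith
    · intro f hf hz
      refine ⟨dot f b / dot g b, ?_⟩
      by_contra hne'
      refine hq g hgd f hf ?_ ?_
      · intro h
        apply hne'
        rw [sub_eq_zero] at h
        rw [div_eq_inv_mul, mul_smul, ← h, inv_smul_smul₀ hgb]
      · rw [dot_seg] at hz hg0
        simp only [map_sub, map_smul, LinearMap.sub_apply, LinearMap.smul_apply, smul_eq_mul]
        have : t₀ * (dot g b * dot f q - dot f b * dot g q) = 0 := by
          linear_combination dot g b * hz - dot f b * hg0
        exact (mul_eq_zero.1 this).resolve_left hT0.ne'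

end Segment

/-- Outside finitely many hyperplanes, the functions with which the invariants agree are
independent. -/
theorem exists_finite_indep (hn : 3 ≤ n) : ∃ Z : Set (Phase n), Z.Finite ∧ (∀ z ∈ Z, z ≠ 0) ∧
    ∀ q, (∀ z ∈ Z, dot z q ≠ 0) → Gen q ∧ Indep q := by
  obtain ⟨b, hb, hbi⟩ := exists_gen_indep hn
  -- The second family prevents two non-proportional differences from vanishing at the same positive
  -- parameter of the segment from `b`.
  refine ⟨(diffs n ∪ (fun x : Phase n × Phase n => dot x.1 b • x.2 - dot x.2 b • x.1) ''
    (diffs n ×ˢ diffs n)) \ {0}, ?_, fun z hz => hz.2, fun q hq => ?_⟩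
  · exact (diffs_finite.union ((diffs_finite.prod diffs_finite).image _)).subset Set.sdiff_subset
  · have hg : Gen q := gen_of_forall fun f hf => hq f ⟨Or.inl hf.1, hf.2⟩
    have h1 : seg b q 1 = q := by simp [seg]
    refine ⟨hg, ?_⟩
    rw [← h1]
    refine indep_seg hb hbi (fun f hf f' hf' hne => ?_) _ 1 rfl zero_le_one (by rwa [h1])
    exact hq _ ⟨Or.inr ⟨(f, f'), ⟨hf, hf'⟩, rfl⟩, hne⟩

/-! ### Polyhedra -/

section Polyhedron

open Filter Topology

variable {V W J : Type*} [NormedAddCommGroup V] [NormedSpace ℝ V] [FiniteDimensional ℝ V]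
  [AddCommGroup W] [Module ℝ W] [Finite J]

/-- The polyhedron of the solutions of the inequalities `0 ≤ a j` on a fibre of `L`. -/
def polyhedron (a : J → V →ₗ[ℝ] ℝ) (L : V →ₗ[ℝ] W) (c : W) : Set V :=
  {p | (∀ j, 0 ≤ a j p) ∧ L p = c}

variable {a : J → V →ₗ[ℝ] ℝ} {L : V →ₗ[ℝ] W} {c : W}

theorem convex_polyhedron : Convex ℝ (polyhedron a L c) := by
  rintro x ⟨hx, hx'⟩ y ⟨hy, hy'⟩ r s hr hs hrs
  refine ⟨fun j => ?_, ?_⟩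
  · rw [map_add, map_smul, map_smul, smul_eq_mul, smul_eq_mul]
    exact add_nonneg (mul_nonneg hr (hx j)) (mul_nonneg hs (hy j))
  · rw [map_add, map_smul, map_smul, hx', hy', ← add_smul, hrs, one_smul]

theorem isClosed_polyhedron : IsClosed (polyhedron a L c) := by
  have h1 : IsClosed {p : V | ∀ j, 0 ≤ a j p} := by
    simp only [Set.ofPred_forall]
    exact isClosed_iInter fun j =>
      isClosed_le continuous_const (a j).continuous_of_finiteDimensional
  have h2 : IsClosed {p : V | L p = c} := by
    by_cases h : ∃ p, L p = c
    · obtain ⟨p₀, rfl⟩ := h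
      have : {p : V | L p = L p₀} = (fun p => p - p₀) ⁻¹' (LinearMap.ker L : Set V) := by
        ext p
        simp [sub_eq_zero]
      rw [this]
      exact (Submodule.closed_of_finiteDimensional _).preimage (by fun_prop)
    · push Not at h
      have : {p : V | L p = c} = ∅ := Set.eq_empty_of_forall_notMem h
      rw [this]
      exact isClosed_empty
  exact h1.inter h2

/-- Points of a polyhedron can be moved a little in the directions that respect the active
inequalities. -/
theorem eventually_add_smul_mem {x v : V} (hx : x ∈ polyhedron a L c) (hv : L v = 0)
    (ha : ∀ j, a j x = 0 → a j v = 0) : ∀ᶠ t in 𝓝 (0 : ℝ), x + t • v ∈ polyhedron a L c := by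
  have h : ∀ᶠ t in 𝓝 (0 : ℝ), ∀ j, 0 ≤ a j (x + t • v) := by
    rw [eventually_all]
    intro j
    simp only [map_add, map_smul, smul_eq_mul]
    by_cases hj : a j x = 0
    · simp [hj, ha j hj]
    · have : ContinuousAt (fun t : ℝ => a j x + t * a j v) 0 := by fun_prop
      have h0 : 0 < a j x + 0 * a j v := by
        rw [zero_mul, add_zero]
        exact lt_of_le_of_ne (hx.1 j) (Ne.symm hj)
      filter_upwards [this.eventually (lt_mem_nhds h0)] with t ht using ht.le
  filter_upwards [h] with t ht
  exact ⟨ht, by rw [map_add, map_smul, hv, smul_zero, add_zero, hx.2]⟩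

/-- An extreme point is determined by its active inequalities: another one with the same active set
would give a direction in which the point can move both ways. -/
theorem finite_extremePoints_polyhedron : ((polyhedron a L c).extremePoints ℝ).Finite := by
  refine Set.Finite.of_finite_image (f := fun x => {j | a j x = 0}) (Set.toFinite _) ?_
  intro x hx y hy hxy
  simp only at hxy
  have hact : ∀ j, a j x = 0 → a j (y - x) = 0 := by
    intro j hj
    have : j ∈ {j | a j y = 0} := by rw [← hxy]; exact hj
    rw [map_sub, hj, sub_zero]
    exact this
  have hL : L (y - x) = 0 := by rw [map_sub, hx.1.2, hy.1.2, sub_self]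
  have h1 := eventually_add_smul_mem hx.1 hL hact
  have h2 := eventually_add_smul_mem (v := -(y - x)) hx.1 (by rw [map_neg, hL, neg_zero])
    fun j hj => by rw [map_neg, hact j hj, neg_zero]
  obtain ⟨t, ⟨ht1, ht2⟩, ht0⟩ :=
    (((h1.and h2).filter_mono nhdsWithin_le_nhds).and
      (self_mem_nhdsWithin (s := Set.Ioi (0 : ℝ)))).exists
  have hseg : x ∈ openSegment ℝ (x + t • (y - x)) (x + t • -(y - x)) := by
    refine ⟨1 / 2, 1 / 2, by norm_num, by norm_num, by norm_num, ?_⟩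
    module
  have := hx.2 ht1 ht2 hseg
  have h3 : t • (y - x) = 0 := by simpa using this
  rcases smul_eq_zero.1 h3 with h | h
  · exact absurd h (ne_of_gt ht0)
  · exact (sub_eq_zero.1 h).symm

/-- Krein–Milman with finitely many extreme points. At `x` no nontrivial inequality is active, so
every direction of the fibre is realized. -/
theorem exists_finset_convexHull_eq (hb : Bornology.IsBounded (polyhedron a L c)) {x : V}
    (hx : x ∈ polyhedron a L c) (hpos : ∀ j, a j = 0 ∨ 0 < a j x) :
    ∃ s : Finset V, convexHull ℝ (s : Set V) = polyhedron a L c ∧ s.Nonempty ∧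
      Module.finrank ℝ (vectorSpan ℝ (s : Set V)) = Module.finrank ℝ (LinearMap.ker L) := by
  have : ProperSpace V := FiniteDimensional.proper_real V
  have hcpt : IsCompact (polyhedron a L c) :=
    Metric.isCompact_of_isClosed_isBounded isClosed_polyhedron hb
  have hfin := finite_extremePoints_polyhedron (a := a) (L := L) (c := c)
  have hull : convexHull ℝ (hfin.toFinset : Set V) = polyhedron a L c := by
    rw [hfin.coe_toFinset, ← (hfin.isClosed_convexHull ℝ).closure_eq]
    exact closure_convexHull_extremePoints hcpt convex_polyhedron
  refine ⟨hfin.toFinset, hull, ?_, ?_⟩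
  · rw [← Finset.coe_nonempty, ← convexHull_nonempty_iff (𝕜 := ℝ), hull]
    exact ⟨x, hx⟩
  · have h1 : vectorSpan ℝ (hfin.toFinset : Set V) = vectorSpan ℝ (polyhedron a L c) := by
      conv_rhs => rw [← hull]
      rw [← direction_affineSpan, ← direction_affineSpan, affineSpan_convexHull]
    have h2 : vectorSpan ℝ (polyhedron a L c) = LinearMap.ker L := ?_
    · rw [h1, h2]
    refine le_antisymm ?_ ?_
    · rw [vectorSpan, Submodule.span_le]
      rintro _ ⟨p, hp, p', hp', rfl⟩
      simp only [vsub_eq_sub, SetLike.mem_coe, LinearMap.mem_ker, map_sub]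
      rw [hp.2, hp'.2, sub_self]
    · intro v hv
      have h2 := eventually_add_smul_mem hx (LinearMap.mem_ker.1 hv) fun j hj => by
        rcases hpos j with h | h
        · simp [h]
        · exact absurd hj h.ne'
      obtain ⟨t, ht1, ht0⟩ := ((h2.filter_mono nhdsWithin_le_nhds).and
        (self_mem_nhdsWithin (s := Set.Ioi (0 : ℝ)))).exists
      have h3 := vsub_mem_vectorSpan ℝ ht1 hx
      rw [vsub_eq_sub, add_sub_cancel_left] at h3
      exact (Submodule.smul_mem_iff _ (ne_of_gt ht0)).1 h3

end Polyhedron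

/-! ### The level sets -/

/-- The values of the invariants. -/
noncomputable def value (q : Phase n) (i : Bool × Fin (n / 2 + 1)) : ℝ :=
  if i.2 = 0 then dot (total i.1) q else trop i.1 (i.2 : ℕ) q

theorem dot_total_true (q : Phase n) : dot (total true) q = ∑ i, q.1 i := by
  simp [dot_apply, total]

theorem dot_total_false (q : Phase n) : dot (total false) q = ∑ i, q.2 i := by
  simp [dot_apply, total]

theorem mem_levelSet_iff {p q : Phase n} : p ∈ levelSet q ↔ value p = value q := by
  constructor
  · rintro ⟨h1, h2, h3⟩
    funext ⟨τ, k⟩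
    unfold value
    by_cases hk : k = 0
    · rw [if_pos hk, if_pos hk]
      cases τ
      · rw [dot_total_false, dot_total_false, h2]
      · rw [dot_total_true, dot_total_true, h1]
    · rw [if_neg hk, if_neg hk]
      have hk' : (k : ℕ) ≠ 0 := fun h => hk (Fin.ext h)
      have := h3 k (Finset.mem_Icc.2 ⟨by omega, Nat.lt_succ_iff.1 k.2⟩)
      cases τ
      · exact this.2
      · exact this.1
  · intro h
    have h0 : ∀ τ, dot (total τ) p = dot (total τ) q := fun τ => by
      have := congrFun h (τ, 0)
      simpa [value] using this
    refine ⟨?_, ?_, fun k hk => ?_⟩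
    · rw [← dot_total_true, ← dot_total_true, h0]
    · rw [← dot_total_false, ← dot_total_false, h0]
    · rw [Finset.mem_Icc] at hk
      have h1 : ∀ τ, trop τ k p = trop τ k q := fun τ => by
        have := congrFun h (τ, ⟨k, Nat.lt_succ_of_le hk.2⟩)
        have hne : (⟨k, Nat.lt_succ_of_le hk.2⟩ : Fin (n / 2 + 1)) ≠ 0 := fun h => by
          have := congrArg Fin.val h
          simp at this
          omega
        simpa [value, hne] using this
      exact ⟨h1 true, h1 false⟩

/-- The linear functions of a selection. -/
noncomputable def lin (s : Sel n) : Phase n →ₗ[ℝ] (Bool × Fin (n / 2 + 1) → ℝ) :=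
  LinearMap.pi fun i => dot (vec s i)

theorem IsSel.lin_eq (hn : 3 ≤ n) {s : Sel n} {p : Phase n} (h : IsSel s p) :
    lin s p = value p := by
  funext i
  simp only [lin, LinearMap.pi_apply, value, vec]
  split_ifs
  · rfl
  · exact ((h _ _).1.trop_eq hn (h _ _).2).symm

/-- A functional vanishing on the range is a linear relation among the vectors `vec s`. -/
theorem range_lin {s : Sel n} (hs : LinearIndependent ℝ (vec s)) :
    LinearMap.range (lin s) = ⊤ := by
  by_contra hne
  obtain ⟨φ, hφ, hle⟩ := Submodule.exists_le_ker_of_lt_top _ (lt_top_iff_ne_top.2 hne)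
  have h1 : ∀ x, φ x = ∑ i, φ (Pi.single i 1) * x i := by
    intro x
    conv_lhs => rw [← Finset.univ_sum_single x]
    rw [map_sum]
    refine Finset.sum_congr rfl fun i _ => ?_
    rw [mul_comm, ← smul_eq_mul, ← map_smul, ← Pi.single_smul', smul_eq_mul, mul_one]
  have h2 : ∑ i, φ (Pi.single i 1) • vec s i = 0 := by
    have hz : ∀ w, dot (∑ i, φ (Pi.single i 1) • vec s i) w = 0 := by
      intro w
      have h3 : φ (lin s w) = 0 := hle ⟨w, rfl⟩
      rw [h1] at h3
      rw [← h3]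
      simp [lin]
    by_contra h
    exact dot_self_ne_zero h (hz _)
  have h3 := Fintype.linearIndependent_iff.1 hs _ h2
  refine hφ (LinearMap.ext fun x => ?_)
  rw [h1, LinearMap.zero_apply]
  exact Finset.sum_eq_zero fun i _ => by rw [h3 i, zero_mul]

theorem finrank_ker_lin (hn : 3 ≤ n) {s : Sel n} (hs : LinearIndependent ℝ (vec s)) :
    Module.finrank ℝ (LinearMap.ker (lin s)) = 2 * ((n + 1) / 2) - 2 := by
  have h := LinearMap.finrank_range_add_finrank_ker (lin s)
  rw [range_lin hs, finrank_top, Module.finrank_prod, Module.finrank_fintype_fun_eq_card,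
    Module.finrank_fintype_fun_eq_card, ZMod.card, Fintype.card_prod, Fintype.card_bool,
    Fintype.card_fin] at h
  omega

/-- The inequalities that express the optimality of a selection. -/
noncomputable def ineq (s : Sel n) (j : Bool × Fin (n / 2 + 1) × (ZMod n → Cell)) :
    Phase n →ₗ[ℝ] ℝ :=
  open Classical in
  if IsConfig j.2.2 ∧ cnt j.2.2 = cnt (s j.1 j.2.1) then
    dot (form j.1 (s j.1 j.2.1) - form j.1 j.2.2) else 0

/-- The inequalities compare values only; that `s` consists of configurations of the right lengths
is borrowed from `p₀`. -/
theorem IsSel.iff_ineq {s : Sel n} {p₀ : Phase n} (h₀ : IsSel s p₀) {p : Phase n} :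
    IsSel s p ↔ ∀ j, 0 ≤ ineq s j p := by
  constructor
  · rintro h ⟨τ, k, S⟩
    unfold ineq
    split_ifs with hS
    · exact (isOpt_iff.1 (h τ k).1).2 S hS.1 hS.2
    · exact le_rfl
  · refine fun h τ k => ⟨isOpt_iff.2 ⟨(h₀ τ k).1.1, fun S hS hc => ?_⟩, (h₀ τ k).2⟩
    have := h (τ, k, S)
    rwa [ineq, if_pos ⟨hS, hc⟩] at this

theorem IsSel.ineq_pos {s : Sel n} {p₀ : Phase n} (hg : Gen p₀) (h₀ : IsSel s p₀)
    (j : Bool × Fin (n / 2 + 1) × (ZMod n → Cell)) : ineq s j = 0 ∨ 0 < ineq s j p₀ := by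
  rw [or_iff_not_imp_left]
  intro hne
  refine lt_of_le_of_ne (h₀.iff_ineq.1 h₀ j) fun h => ?_
  unfold ineq at hne h
  split_ifs at hne h with hS
  · refine gen_iff.1 hg _ (sub_mem_diffs _ (h₀ _ _).1.1 hS.1 hS.2.symm) (fun h0 => hne ?_) h.symm
    rw [h0, map_zero]
  · exact hne rfl

/-- The part of the level set of `q` on which a selection is optimal. -/
noncomputable def piece (s : Sel n) (q : Phase n) : Set (Phase n) :=
  polyhedron (ineq s) (lin s) (value q)

theorem IsSel.mem_piece_iff (hn : 3 ≤ n) {s : Sel n} {p₀ : Phase n} (h₀ : IsSel s p₀)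
    {p q : Phase n} : p ∈ piece s q ↔ IsSel s p ∧ p ∈ levelSet q := by
  rw [mem_levelSet_iff]
  constructor
  · rintro ⟨h1, h2⟩
    have h3 := h₀.iff_ineq.2 h1
    exact ⟨h3, by rw [← h3.lin_eq hn, h2]⟩
  · rintro ⟨h1, h2⟩
    exact ⟨h₀.iff_ineq.1 h1, by rw [h1.lin_eq hn, h2]⟩

/-! ### Boundedness -/

/-- The monomial with a single short factor. -/
def single (i j : ZMod n) : Cell := if j = i then s else e

theorem isConfig_single (hn : 3 ≤ n) (i : ZMod n) : IsConfig (single i) := by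
  intro j
  unfold single
  have := one_ne hn
  split_ifs with h1 h2
  · rw [h1] at h2
    simp [this] at h2
  all_goals simp [Step]

theorem cnt_single (i : ZMod n) : cnt (single i) = 1 := by
  have : ∀ j, st (single i j) = if j = i then 1 else 0 := fun j => by
    unfold single; split_ifs <;> rfl
  simp [cnt, this]

theorem dot_form_single (τ : Bool) (i : ZMod n) (p : Phase n) :
    dot (form τ (single i)) p = if τ then p.1 i else p.2 i := by
  have h1 : ∀ j, (cov (single i j) : ℝ) = if j = i then 1 else 0 := fun j => by
    unfold single; split_ifs <;> simp [cov]
  have h2 : ∀ j, hd (single i j) = 0 := fun j => by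
    unfold single; split_ifs <;> rfl
  have h3 : ∀ j, tl (single i j) = 0 := fun j => by
    unfold single; split_ifs <;> rfl
  cases τ <;> simp [dot_apply, form, fx, fy, h1, h2, h3]

theorem coord_le_trop (hn : 3 ≤ n) (τ : Bool) (i : ZMod n) (p : Phase n) :
    (if τ then p.1 i else p.2 i) ≤ trop τ 1 p := by
  obtain ⟨S, hS, hc⟩ := exists_isOpt τ p (k := 1) (by omega)
  rw [hS.trop_eq hn hc, ← dot_form_single]
  exact hS.2 _ (isConfig_single hn i) (by rw [cnt_single, hc]; rfl)

theorem sub_le_of_forall_le {g : ZMod n → ℝ} {M : ℝ} (hg : ∀ i, g i ≤ M) (i : ZMod n) :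
    (∑ j, g j) - (n - 1 : ℕ) * M ≤ g i := by
  have h1 := Finset.add_sum_erase Finset.univ g (Finset.mem_univ i)
  have h2 := Finset.sum_le_card_nsmul (Finset.univ.erase i) g M fun j _ => hg j
  rw [Finset.card_erase_of_mem (Finset.mem_univ i), Finset.card_univ, ZMod.card,
    nsmul_eq_mul] at h2
  linarith

/-- The invariants with `k = 1` dominate every single coordinate, and the fixed totals turn these
upper bounds into lower ones. -/
theorem isBounded_levelSet (hn : 3 ≤ n) (q : Phase n) : Bornology.IsBounded (levelSet q) := by
  refine (isCompact_Icc (a := ((fun _ => (∑ j, q.1 j) - (n - 1 : ℕ) * trop true 1 q,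
    fun _ => (∑ j, q.2 j) - (n - 1 : ℕ) * trop false 1 q) : Phase n))
    (b := (fun _ => trop true 1 q, fun _ => trop false 1 q))).isBounded.subset ?_
  rintro p ⟨h1, h2, h3⟩
  have h4 := h3 1 (Finset.mem_Icc.2 ⟨le_rfl, by omega⟩)
  have h5 : ∀ i, p.1 i ≤ trop true 1 q := fun i => by
    have := coord_le_trop hn true i p
    rw [show trop true 1 p = trop true 1 q from h4.1] at this
    simpa using this
  have h6 : ∀ i, p.2 i ≤ trop false 1 q := fun i => by
    have := coord_le_trop hn false i p
    rw [show trop false 1 p = trop false 1 q from h4.2] at this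
    simpa using this
  refine ⟨⟨fun i => ?_, fun i => ?_⟩, h5, h6⟩
  · simpa only [h1] using sub_le_of_forall_le h5 i
  · simpa only [h2] using sub_le_of_forall_le h6 i

/-! ### The level sets are polytopes -/

/-- The points at which the value of the selection `s'` is attained by `s` on the subspace where
the inequalities in `T` are equalities. -/
noncomputable def exceptional (s s' : Sel n)
    (T : Set (Bool × Fin (n / 2 + 1) × (ZMod n → Cell))) : Submodule ℝ (Phase n) :=
  ((⨅ j ∈ T, LinearMap.ker (ineq s j)).map (lin s)).comap (lin s')

-- If the face of `p` in the piece were too small, only the `q` of a proper subspace could meet it.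
-- For other `q` the face maps onto all values, which leaves room to move from `p` off all active
-- inequalities inside the fibre.
open Filter Topology in
theorem exists_interior (hn : 3 ≤ n) {q : Phase n}
    (hq : ∀ s s' T, exceptional s s' T ≠ ⊤ → q ∉ exceptional s s' T) {s s' : Sel n}
    {p₀ : Phase n} (hg : Gen p₀) (h₀ : IsSel s p₀) (hi : LinearIndependent ℝ (vec s'))
    (hs' : IsSel s' q) {p : Phase n} (hp : p ∈ piece s q) :
    ∃ x ∈ piece s q, ∀ j, ineq s j = 0 ∨ 0 < ineq s j x := by
  set T := {j | ineq s j p = 0} with hT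
  have hmem : q ∈ exceptional s s' T := by
    refine ⟨p, ?_, ?_⟩
    · simp [T]
    · rw [hs'.lin_eq hn]
      exact hp.2
  have htop : exceptional s s' T = ⊤ := by
    by_contra h
    exact hq s s' T h hmem
  -- This produces `w` on the subspace of the active equalities with the same image as `p₀`. The
  -- direction `p₀ - w` stays in the fibre and raises every nontrivial active inequality.
  obtain ⟨z, hz⟩ : ∃ z, lin s' z = lin s p₀ := by
    rw [← LinearMap.mem_range, range_lin hi]
    trivial
  have hz' : z ∈ exceptional s s' T := by rw [htop]; trivial
  obtain ⟨w, hw, hwz⟩ := hz'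
  rw [hz] at hwz
  have hw' : ∀ j ∈ T, ineq s j w = 0 := by simpa using hw
  have hev : ∀ᶠ t in 𝓝[>] (0 : ℝ), ∀ j, ineq s j = 0 ∨ 0 < ineq s j (p + t • (p₀ - w)) := by
    rw [eventually_all]
    intro j
    by_cases hj0 : ineq s j = 0
    · exact Eventually.of_forall fun t => Or.inl hj0
    simp only [map_add, map_smul, map_sub, smul_eq_mul]
    by_cases hj : ineq s j p = 0
    · filter_upwards [self_mem_nhdsWithin] with t ht
      right
      rw [hj, hw' j hj, zero_add, sub_zero]
      exact mul_pos ht ((h₀.ineq_pos hg j).resolve_left hj0)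
    · have hc : ContinuousAt (fun t : ℝ => ineq s j p + t * (ineq s j p₀ - ineq s j w)) 0 := by
        fun_prop
      have hpos : 0 < ineq s j p + 0 * (ineq s j p₀ - ineq s j w) := by
        rw [zero_mul, add_zero]
        exact lt_of_le_of_ne (hp.1 j) (Ne.symm hj)
      filter_upwards [nhdsWithin_le_nhds (hc.eventually (lt_mem_nhds hpos))] with t ht
      exact Or.inr ht
  obtain ⟨t, ht⟩ := hev.exists
  refine ⟨p + t • (p₀ - w), ⟨fun j => ?_, ?_⟩, ht⟩
  · rcases ht j with h | h
    · rw [h]; exact le_rfl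
    · exact h.le
  · rw [map_add, map_smul, map_sub, hwz, sub_self, smul_zero, add_zero, hp.2]

theorem isPolytopeOfDim_levelSet (hn : 3 ≤ n) {q : Phase n}
    (hq : ∀ s s' T, exceptional s s' T ≠ ⊤ → q ∉ exceptional s s' T) :
    IsPolytopeOfDim (levelSet q) (2 * ((n + 1) / 2) - 2) := by
  obtain ⟨Z, hZ, hZ0, hZi⟩ := exists_finite_indep hn
  have hcov : ∀ p : Phase n, ∃ (s : Sel n) (p₀ : Phase n), Gen p₀ ∧ IsSel s p₀ ∧
      LinearIndependent ℝ (vec s) ∧ IsSel s p := by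
    intro p
    obtain ⟨p₀, h1, h2⟩ := exists_generic_near hZ hZ0 p
    obtain ⟨s, hs⟩ := exists_isSel p₀
    exact ⟨s, p₀, (hZi p₀ h1).1, hs, (hZi p₀ h1).2 s hs, h2 s hs⟩
  obtain ⟨s', -, -, -, hi', hs'⟩ := hcov q
  -- Selections that are optimal only at non-generic points are discarded; approximating by generic
  -- points shows that the remaining pieces still cover the level set.
  let full : Set (Sel n) := {s | (∃ p₀, Gen p₀ ∧ IsSel s p₀) ∧ LinearIndependent ℝ (vec s) ∧
    (piece s q).Nonempty}
  have hF : ∀ s ∈ full, ∃ F : Finset (Phase n), convexHull ℝ (F : Set (Phase n)) = piece s q ∧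
      F.Nonempty ∧ Module.finrank ℝ (vectorSpan ℝ (F : Set (Phase n))) =
        2 * ((n + 1) / 2) - 2 := by
    rintro s ⟨⟨p₀, hg, h₀⟩, hi, p, hp⟩
    obtain ⟨x, hx, hpos⟩ := exists_interior hn hq hg h₀ hi' hs' hp
    rw [← finrank_ker_lin hn hi]
    exact exists_finset_convexHull_eq ((isBounded_levelSet hn q).subset fun y hy =>
      ((h₀.mem_piece_iff hn).1 hy).2) hx hpos
  choose! F hF using hF
  have hunion : levelSet q = ⋃ s ∈ full, piece s q := by
    ext p
    simp only [Set.mem_iUnion, exists_prop]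
    constructor
    · intro hp
      obtain ⟨s, p₀, hg, h₀, hi, hs⟩ := hcov p
      have := (h₀.mem_piece_iff hn).2 ⟨hs, hp⟩
      exact ⟨s, ⟨⟨p₀, hg, h₀⟩, hi, p, this⟩, this⟩
    · rintro ⟨s, ⟨⟨p₀, -, h₀⟩, -, -⟩, hp⟩
      exact ((h₀.mem_piece_iff hn).1 hp).2
  refine ⟨F '' full, Set.toFinite _, ?_, ?_, ?_⟩
  · have hqq : q ∈ levelSet q := mem_levelSet_iff.2 rfl
    rw [hunion] at hqq
    simp only [Set.mem_iUnion] at hqq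
    obtain ⟨s, hs, -⟩ := hqq
    exact ⟨F s, s, hs, rfl⟩
  · rintro _ ⟨s, hs, rfl⟩
    exact (hF s hs).2
  · rw [Set.biUnion_image, hunion]
    exact Set.iUnion₂_congr fun s hs => (hF s hs).1.symm

end Pentagram

/-! ### Conclusion: the excluded subspaces are the proper ones among finitely many `exceptional s s'
T` -/

theorem theorem2p3 (n : ℕ) [NeZero n] (hn : 3 ≤ n) :
    (∀ (q : Pentagram.Phase n) (l : ℕ),
      Pentagram.automaton^[l] q ∈ Pentagram.levelSet q) ∧
    ∃ H : Set (AffineSubspace ℝ (Pentagram.Phase n)), H.Finite ∧ (∀ A ∈ H, A ≠ ⊤) ∧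
      ∀ q : Pentagram.Phase n, (∀ A ∈ H, q ∉ A) →
        Pentagram.IsPolytopeOfDim (Pentagram.levelSet q) (2 * ((n + 1) / 2) - 2) := by
  refine ⟨fun q l => Pentagram.iterate_mem_levelSet q hn l,
    {A | A ≠ ⊤ ∧ ∃ s s' T, A = (Pentagram.exceptional s s' T).toAffineSubspace}, ?_,
    fun A hA => hA.1, fun q hq => Pentagram.isPolytopeOfDim_levelSet hn fun s s' T hne hmem => ?_⟩
  · refine (Set.finite_range fun x : Pentagram.Sel n × Pentagram.Sel n ×
      Set (Bool × Fin (n / 2 + 1) × (ZMod n → Pentagram.Cell)) =>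
      (Pentagram.exceptional x.1 x.2.1 x.2.2).toAffineSubspace).subset ?_
    rintro A ⟨-, s, s', T, rfl⟩
    exact ⟨(s, s', T), rfl⟩
  · refine hq _ ⟨fun h => hne ?_, s, s', T, rfl⟩ hmem
    rw [eq_top_iff]
    intro x _
    have : x ∈ (Pentagram.exceptional s s' T).toAffineSubspace := by rw [h]; trivial
    exact this
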